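/- Let $0\le k\le n$ and $m\ge 0$ be integers and consider the problem $$\min\Big\{ f(x)=\sum_{i=1}^k -q_i x_i^2 + h^\top x \;:\; Wx\le w,\ x\in\mathbb Z^n\Big\}\qquad(\mathcal{IQP})$$ with $W\in\mathbb Z^{m\times n}$, $w\in\mathbb Z^m$, $q\in\mathbb Z^k_{>0}$, $h\in\mathbb Z^n$. If $(\mathcal{IQP})$ has an optimal solution $x^*$, let $f_{\max}$ be the maximum of $f$ on the feasible region; a feasible point $x^\diamond$ is an *$\epsilon$-approximate solution* if $f(x^*)=f_{\max}$, or if $f(x^*)<f_{\max}$ and $\frac{f(x^\diamond)-f(x^*)}{f_{\max}-f(x^*)}\le\epsilon$ (every feasible point is one if $f$ has no upper bound on the feasible region). **Theorem.** Suppose that $W$ is totally unimodular (TU). For every $\epsilon\in(0,1]$ there is an algorithm that finds an $\epsilon$-approximate solution to $(\mathcal{IQP})$, or reports correctly that $(\mathcal{IQP})$ is infeasible or that it is unbounded, by solving at most $$N=\left(3+\left\lceil\sqrt{k\left(1+\tfrac1\epsilon\right)}\,\right\rceil\right)^k$$ linear programs (LPs), a number that does not depend on $n$. Each of these LPs has integral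 data, size polynomial in the size of $(\mathcal{IQP})$, at most $n$ variables, at most $m$ linear inequalities and possibly additional variable bounds, and a TU constraint matrix (also with the variable bounds included). The LPs are solved by calls to an arbitrary correct LP solver, which returns any optimal solution, or reports infeasibility or unboundedness. Apart from these calls, the algorithm performs at most $N\cdot\mathrm{poly}(n,m)$ elementary operations (memory accesses, comparisons, $+,-,\times$ and integer division) on integers whose bit length is polynomial in the size of $(\mathcal{IQP})$ and $\log(1/\epsilon)$. The algorithm and the polynomials can be chosen independently of $\epsilon$, with $\epsilon$ accessible to the algorithm through comparisons with rational numbers. -/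

import Mathlib

open scoped Matrix

namespace ConcaveIQP

/-! Integer programs with a separable concave quadratic objective -/

/-- Number of bits of an integer in binary, with one bit for the sign. -/
def intSize (a : ℤ) : ℕ := a.natAbs.size + 1

/-- An instance `min ∑_{i<k} -q_i x_i² + hᵀx  s.t.  W x ≤ w, x ∈ ℤⁿ` with integral data,
where `k ≤ n` and `q > 0`. -/
structure IQP where
  n : ℕ
  m : ℕ
  k : ℕ
  hk : k ≤ n
  W : Matrix (Fin m) (Fin n) ℤ
  w : Fin m → ℤ
  q : Fin k → ℤ
  q_pos : ∀ i, 0 < q i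
  h : Fin n → ℤ

namespace IQP

variable (I : IQP)

def Feasible (x : Fin I.n → ℤ) : Prop := I.W *ᵥ x ≤ I.w

def obj (x : Fin I.n → ℤ) : ℤ :=
  ∑ i : Fin I.k, -I.q i * x (Fin.castLE I.hk i) ^ 2 + I.h ⬝ᵥ x

def Infeasible : Prop := ∀ x, ¬ I.Feasible x

/-- The objective is unbounded from below on the (nonempty) feasible region. -/
def Unbounded : Prop := ∀ B : ℤ, ∃ x, I.Feasible x ∧ I.obj x < B

def IsOptimal (x : Fin I.n → ℤ) : Prop :=
  I.Feasible x ∧ ∀ y, I.Feasible y → I.obj x ≤ I.obj y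

/-- `x` is an `ε`-approximate solution: it is feasible, an optimal solution `x*` exists and, with
`f_max` the maximum of the objective `f` on the feasible region, either `f(x*) = f_max`, or
`f(x*) < f_max` and `(f(x) - f(x*)) / (f_max - f(x*)) ≤ ε`. If `f` has no upper bound on the
feasible region, every feasible point is an `ε`-approximate solution. -/
def IsApprox (ε : ℝ) (x : Fin I.n → ℤ) : Prop :=
  I.Feasible x ∧ ∃ xs, I.IsOptimal xs ∧
    ∀ fmax : ℤ, IsGreatest {v | ∃ y, I.Feasible y ∧ I.obj y = v} fmax →
      I.obj xs = fmax ∨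
        (I.obj xs < fmax ∧
          ((I.obj x : ℝ) - (I.obj xs : ℝ)) / ((fmax : ℝ) - (I.obj xs : ℝ)) ≤ ε)

/-- Binary encoding size of the instance. -/
def size : ℕ :=
  I.n + I.m + I.k + ∑ i, ∑ j, intSize (I.W i j) + ∑ i, intSize (I.w i) +
    ∑ i, intSize (I.q i) + ∑ j, intSize (I.h j)

end IQP

/-! Linear programs -/

/-- A linear program `min cᵀx  s.t.  A x ≤ b` with `nv` real variables, `nc` inequalities, integral
data, and an optional lower and an optional upper bound on each variable. -/
structure LP where
  nv : ℕ
  nc : ℕ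
  A : Matrix (Fin nc) (Fin nv) ℤ
  b : Fin nc → ℤ
  c : Fin nv → ℤ
  lo : Fin nv → Option ℤ
  hi : Fin nv → Option ℤ

namespace LP

variable (L : LP)

def Feasible (x : Fin L.nv → ℝ) : Prop :=
  (∀ i, ∑ j, (L.A i j : ℝ) * x j ≤ (L.b i : ℝ)) ∧
  (∀ j, ∀ a ∈ L.lo j, (a : ℝ) ≤ x j) ∧
  (∀ j, ∀ a ∈ L.hi j, x j ≤ (a : ℝ))

def value (x : Fin L.nv → ℝ) : ℝ := ∑ j, (L.c j : ℝ) * x j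

/-- The matrix of all constraints, variable bounds included: `A` on top of `-I` and `I`
(the actual constraints are among these rows, as some bounds may be absent). -/
def constraintMatrix : Matrix (Fin L.nc ⊕ (Fin L.nv ⊕ Fin L.nv)) (Fin L.nv) ℤ :=
  Matrix.fromRows L.A (Matrix.fromRows (-1) 1)

/-- Binary size of an optional bound (nothing is stored but a flag if it is absent). -/
def boundSize : Option ℤ → ℕ
  | none => 1
  | some a => 1 + intSize a

/-- Binary encoding size of the linear program. -/
def size : ℕ :=
  L.nv + L.nc + ∑ i, ∑ j, intSize (L.A i j) + ∑ i, intSize (L.b i) + ∑ j, intSize (L.c j) +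
    ∑ j, boundSize (L.lo j) + ∑ j, boundSize (L.hi j)

/-- What a solver may answer to a linear program. -/
inductive Answer (L : LP) : Type
  | infeasible : Answer L
  | unbounded : Answer L
  | optimal (x : Fin L.nv → ℚ) : Answer L

/-- The answer is right. An arbitrary rational optimal solution is allowed: it need be neither a
vertex nor integral. -/
def IsRight : L.Answer → Prop
  | .infeasible => ∀ x, ¬ L.Feasible x
  | .unbounded => ∀ B : ℝ, ∃ x, L.Feasible x ∧ L.value x < B
  | .optimal x => L.Feasible (fun j => (x j : ℝ)) ∧
      ∀ y, L.Feasible y → L.value (fun j => (x j : ℝ)) ≤ L.value y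

end LP

/-- A solver for linear programs. -/
def Solver : Type := (L : LP) → L.Answer

/-- The solver answers every linear program correctly. -/
def Solver.Correct (S : Solver) : Prop := ∀ L : LP, LP.IsRight L (S L)

/-! Algorithms: programs of a random access machine that can call an LP solver.

The memory consists of arrays, each a sequence of integer cells; a program names finitely many
arrays, and computes the positions of the cells that it accesses. The elementary operations are
memory access, addition, subtraction, multiplication, integer division and comparison. The real
number `ε` is accessible only through comparisons with rational numbers. The run of a program
records the number of elementary operations, the largest bit length of a number that is computed,
and the list of the linear programs that are handed to the solver. -/

/-- The memory: `σ a i` is the content of cell `i` of array `a`. -/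
def Store : Type := ℕ → ℤ → ℤ

/-- Arithmetic expressions; `get a e` is the content of cell `e` of array `a`. -/
inductive Expr : Type
  | const (z : ℤ) : Expr
  | get (a : ℕ) (e : Expr) : Expr
  | add (e f : Expr) : Expr
  | sub (e f : Expr) : Expr
  | mul (e f : Expr) : Expr
  | div (e f : Expr) : Expr

namespace Expr

def eval (σ : Store) : Expr → ℤ
  | const z => z
  | get a e => σ a (e.eval σ)
  | add e f => e.eval σ + f.eval σ
  | sub e f => e.eval σ - f.eval σ
  | mul e f => e.eval σ * f.eval σ
  | div e f => e.eval σ / f.eval σ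

/-- Number of elementary operations in the evaluation. -/
def time : Expr → ℕ
  | const _ => 1
  | get _ e => e.time + 1
  | add e f => e.time + f.time + 1
  | sub e f => e.time + f.time + 1
  | mul e f => e.time + f.time + 1
  | div e f => e.time + f.time + 1

/-- Largest size of a number that occurs in the evaluation, intermediate results included. -/
def bits (σ : Store) : Expr → ℕ
  | const z => intSize z
  | get a e => max (intSize ((get a e).eval σ)) (e.bits σ)
  | add e f => max (intSize ((add e f).eval σ)) (max (e.bits σ) (f.bits σ))
  | sub e f => max (intSize ((sub e f).eval σ)) (max (e.bits σ) (f.bits σ))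
  | mul e f => max (intSize ((mul e f).eval σ)) (max (e.bits σ) (f.bits σ))
  | div e f => max (intSize ((div e f).eval σ)) (max (e.bits σ) (f.bits σ))

end Expr

/-- Tests: `e ≤ f`, and `e ≤ ε * f`. -/
inductive Test : Type
  | le (e f : Expr) : Test
  | leEps (e f : Expr) : Test

namespace Test

def Holds (ε : ℝ) (σ : Store) : Test → Prop
  | le e f => e.eval σ ≤ f.eval σ
  | leEps e f => (e.eval σ : ℝ) ≤ ε * (f.eval σ : ℝ)

def time : Test → ℕ
  | le e f => e.time + f.time + 1
  | leEps e f => e.time + f.time + 1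

def bits (σ : Store) : Test → ℕ
  | le e f => max (e.bits σ) (f.bits σ)
  | leEps e f => max (e.bits σ) (f.bits σ)

end Test

/-- The places from which a call of the solver reads a linear program and to which it writes the
answer: two expressions for the numbers of variables and of inequalities; arrays for the matrix
(row by row), the right-hand side and the objective; for each of the two kinds of variable bounds an
array of flags (a nonzero flag: the bound is present) and an array of values; and arrays for the
status (cell 0) and for the numerators and denominators of a solution. -/
structure Call where
  nv : Expr
  nc : Expr
  matA : ℕ
  vecb : ℕ
  vecc : ℕ
  loFlag : ℕ
  loVal : ℕ
  hiFlag : ℕ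
  hiVal : ℕ
  status : ℕ
  num : ℕ
  den : ℕ

/-- The linear program that a call reads from the memory. -/
def Call.lp (κ : Call) (σ : Store) : LP where
  nv := (κ.nv.eval σ).toNat
  nc := (κ.nc.eval σ).toNat
  A := fun i j => σ κ.matA ((i : ℤ) * ((κ.nv.eval σ).toNat : ℤ) + (j : ℤ))
  b := fun i => σ κ.vecb (i : ℤ)
  c := fun j => σ κ.vecc (j : ℤ)
  lo := fun j => if σ κ.loFlag (j : ℤ) = 0 then none else some (σ κ.loVal (j : ℤ))
  hi := fun j => if σ κ.hiFlag (j : ℤ) = 0 then none else some (σ κ.hiVal (j : ℤ))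

namespace Store

/-- Overwrite one cell. -/
def write (σ : Store) (a : ℕ) (i v : ℤ) : Store :=
  fun a' i' => if a' = a ∧ i' = i then v else σ a' i'

/-- Write the entries of a vector into the cells `0, 1, …` of an array. -/
def writeVec (σ : Store) (a : ℕ) {N : ℕ} (v : Fin N → ℤ) : Store :=
  fun a' i' => if h : a' = a ∧ 0 ≤ i' ∧ i'.toNat < N then v ⟨i'.toNat, h.2.2⟩ else σ a' i'

/-- Write the answer of the solver: status 0 for infeasible, 1 for unbounded, 2 for an optimal
solution, which is written as well. -/
def writeAnswer (σ : Store) (κ : Call) {L : LP} : L.Answer → Store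
  | .infeasible => σ.write κ.status 0 0
  | .unbounded => σ.write κ.status 0 1
  | .optimal x => ((σ.writeVec κ.num fun j => (x j).num).writeVec κ.den
      fun j => ((x j).den : ℤ)).write κ.status 0 2

end Store

/-- Programs. -/
inductive Prog : Type
  | skip : Prog
  | assign (a : ℕ) (i e : Expr) : Prog
  | seq (P Q : Prog) : Prog
  | cond (t : Test) (P Q : Prog) : Prog
  | loop (t : Test) (P : Prog) : Prog
  | solve (κ : Call) : Prog

/-- What is recorded of a run: number of elementary operations, largest size of a number computed,
linear programs solved. -/
structure Record where
  time : ℕ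
  bits : ℕ
  lps : List LP

/-- Record of two consecutive parts of a run. -/
def Record.append (r s : Record) : Record :=
  ⟨r.time + s.time, max r.bits s.bits, r.lps ++ s.lps⟩

/-- `Exec S ε P σ τ r`: with solver `S` and accuracy `ε`, the program `P` started in memory `σ` halts
in memory `τ`, with record `r`. -/
inductive Exec (S : Solver) (ε : ℝ) : Prog → Store → Store → Record → Prop
  | skip (σ : Store) : Exec S ε .skip σ σ ⟨1, 0, []⟩
  | assign (a : ℕ) (i e : Expr) (σ : Store) :
      Exec S ε (.assign a i e) σ (σ.write a (i.eval σ) (e.eval σ))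
        ⟨i.time + e.time + 1, max (i.bits σ) (e.bits σ), []⟩
  | seq {P Q : Prog} {σ τ υ : Store} {r s : Record} :
      Exec S ε P σ τ r → Exec S ε Q τ υ s → Exec S ε (.seq P Q) σ υ (r.append s)
  | condTrue {t : Test} {P Q : Prog} {σ τ : Store} {r : Record} :
      t.Holds ε σ → Exec S ε P σ τ r →
        Exec S ε (.cond t P Q) σ τ (Record.append ⟨t.time, t.bits σ, []⟩ r)
  | condFalse {t : Test} {P Q : Prog} {σ τ : Store} {r : Record} :
      ¬ t.Holds ε σ → Exec S ε Q σ τ r →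
        Exec S ε (.cond t P Q) σ τ (Record.append ⟨t.time, t.bits σ, []⟩ r)
  | loopTrue {t : Test} {P : Prog} {σ τ υ : Store} {r s : Record} :
      t.Holds ε σ → Exec S ε P σ τ r → Exec S ε (.loop t P) τ υ s →
        Exec S ε (.loop t P) σ υ (Record.append ⟨t.time, t.bits σ, []⟩ (r.append s))
  | loopFalse {t : Test} {P : Prog} {σ : Store} :
      ¬ t.Holds ε σ → Exec S ε (.loop t P) σ σ ⟨t.time, t.bits σ, []⟩
  | solve (κ : Call) (σ : Store) :
      Exec S ε (.solve κ) σ (σ.writeAnswer κ (S (κ.lp σ)))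
        ⟨κ.nv.time + κ.nc.time + 1, max (κ.nv.bits σ) (κ.nc.bits σ), [κ.lp σ]⟩

namespace IQP

variable (I : IQP)

/-- The input: array 0 holds `n, m, k`, array 1 the matrix `W` (row by row), arrays 2, 3, 4 the
vectors `w`, `q`, `h`; all other cells are 0. -/
def input : Store :=
  Store.writeVec (Store.writeVec (Store.writeVec (Store.writeVec (Store.writeVec
    (fun _ _ => 0)
    0 ![(I.n : ℤ), (I.m : ℤ), (I.k : ℤ)])
    1 (fun t : Fin (I.m * I.n) => I.W (finProdFinEquiv.symm t).1 (finProdFinEquiv.symm t).2))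
    2 I.w)
    3 I.q)
    4 I.h

/-- The final memory holds a correct output in the arrays 5 and 6: the indicator 0 if the problem is
infeasible, the indicator 1 if it is unbounded, and otherwise the indicator 2 together with an
`ε`-approximate solution. -/
def CorrectOutput (ε : ℝ) (τ : Store) : Prop :=
  (τ 5 0 = 0 ∧ I.Infeasible) ∨
  (τ 5 0 = 1 ∧ I.Unbounded) ∨
  (τ 5 0 = 2 ∧ I.IsApprox ε (fun j => τ 6 (j : ℤ)))

/-- The number `(3 + ⌈√(k (1 + 1/ε))⌉)^k`. -/
noncomputable def lpCount (k : ℕ) (ε : ℝ) : ℕ :=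
  (3 + ⌈Real.sqrt ((k : ℝ) * (1 + 1 / ε))⌉₊) ^ k

end IQP

end ConcaveIQP

/-! On a box, `-q x²` has the secant as linear underestimator, with error at most `q/4` times the
squared width. So the range `[l_i, u_i]` of each nonlinear variable is cut into `P` parts, the
underestimator is minimized on each of the `P^k` cells, and the best point found is kept. With `δ_i
= ⌊(u_i - l_i) / P⌋` its error is at most `(1/4) ∑ q_i δ_i²`, which is `gap / 4`.

The spread of `f` is bounded below by concavity. If `a` and `b` attain the two ends of the range of
`x_i`, then `a + b` is the sum of two feasible integral points that differ from the midpoint by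
rounding only, and comparing the objective at the four points gives `q_i ((u_i - l_i)² - 1) ≤ 4
(f_max - f_min)` (`spread_lower_bound`). Summing over `i`, the error is at most `k / (P² - 1)` times
the spread, hence at most `ε` times the spread as soon as `P² > k (1 + 1/ε)` (`gap_le`). The ranges
cost `2k` further linear programs, and `2k + P^k ≤ (P + 2)^k`.

Total unimodularity enters through integer decomposition (`exists_balanced_decomposition`): an
integral `x` is a sum of `N` integral parts whose coordinates and row values are all roundings of
the `N`-th part of those of `x`. It is used for three kinds of `N`. With `N = 2` it provides the
integral midpoints. With `N` large the parts have entries in `{-1, 0, 1}`, and this gives a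
dichotomy (`exists_ray_or_small`): either some such part is an improving ray, or the feasible point
is dominated by one of controlled size. With `N` a common denominator of an LP solution it writes
the solution as an average of feasible integral points.

The solver may return any optimal solution, not just a vertex. Therefore each objective `c` is
replaced by `D^n c_j + D^j`, where `D = 2R + 1` and `R` bounds all variables. This objective takes
distinct values at distinct integral points of the box, so the points in the average coincide and
the answer is integral (`perturbed_answer`).

Restricting everything to the box loses nothing because of the dichotomy. Let `A` be `mag`, a bound
on the data. The minimum of `x_i` or `-x_i` over the box is below `-A` exactly if a ray improves it;
then the problem is unbounded, since `-q_i x_i²` dominates along that ray (`side_of_box_min`).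
Otherwise all nonlinear variables are bounded by `A`, only rays that keep them fixed remain, and
comparing the best value found with `-A^6` decides whether such a ray decreases `f`
(`best_correct`).

The second half of the proof realizes this on the machine. `Runs` is a calculus of total correctness
that carries along the running time, the number of solver calls and a single bound `X` on all memory
cells. The bit length of intermediate results then follows from the syntactic `weight` of the
expressions. -/

namespace ConcaveIQP

/-! ### Totally unimodular matrices -/

section TotallyUnimodular

variable {ι : Type*} [Fintype ι] {n : ℕ}

/-- If a totally unimodular system has full column rank, a rational solution for an integral
right-hand side is integral. -/
theorem exists_int_of_mulVec_injective {A : Matrix ι (Fin n) ℤ} (hA : A.IsTotallyUnimodular)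
    (hker : ∀ z : Fin n → ℚ, (∀ i, ∑ j, (A i j : ℚ) * z j = 0) → z = 0)
    (x : Fin n → ℚ) (b : ι → ℤ) (hx : ∀ i, ∑ j, (A i j : ℚ) * x j = b i) :
    ∃ y : Fin n → ℤ, ∀ j, x j = y j := by
  classical
  set M : Matrix ι (Fin n) ℚ := A.map (Int.castRingHom ℚ) with hM
  have hinj : Function.Injective M.mulVecLin := by
    rw [← LinearMap.ker_eq_bot, LinearMap.ker_eq_bot']
    intro z hz
    refine hker z fun i => ?_
    have := congrFun hz i
    simpa [hM, Matrix.mulVec, dotProduct] using this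
  have hrank : M.rank = n := by
    have h := LinearMap.finrank_range_of_inj hinj
    rw [Matrix.rank]
    simpa using h
  -- A maximal independent set of rows forms a nonsingular square submatrix `B`; its determinant is
  -- `±1`, so `B⁻¹` is integral and recovers `x` from entries of `b`.
  obtain ⟨κ, a, ha, hsp, hli⟩ := exists_linearIndependent' ℚ M.row
  have : Finite κ := Finite.of_injective a ha
  have := Fintype.ofFinite κ
  have hcard : Fintype.card κ = n := by
    have h := linearIndependent_iff_card_eq_finrank_span.mp hli
    rw [h, Set.finrank, hsp, ← Matrix.rank_eq_finrank_span_row, hrank]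
  let e : Fin n ≃ κ := (Fintype.equivFinOfCardEq hcard).symm
  set B : Matrix (Fin n) (Fin n) ℤ := A.submatrix (a ∘ e) id with hB
  have hBM : B.map (Int.castRingHom ℚ) = M.submatrix (a ∘ e) id := by
    ext i j; simp [hB, hM]
  have hBu : IsUnit (B.map (Int.castRingHom ℚ)) := by
    rw [← Matrix.linearIndependent_rows_iff_isUnit, hBM]
    exact hli.comp e e.injective
  have hdet : B.det ≠ 0 := by
    intro h0
    rw [Matrix.isUnit_iff_isUnit_det, ← RingHom.mapMatrix_apply, ← RingHom.map_det, h0] at hBu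
    simp at hBu
  have hdu : IsUnit B.det := by
    obtain ⟨s, hs⟩ := (Matrix.isTotallyUnimodular_iff _).1 hA n (a ∘ e) id
    rw [← hB] at hs
    have key : ∀ s : SignType, ((s : ℤ)) ≠ 0 → IsUnit (s : ℤ) := by
      intro s
      cases s <;> simp
    rw [← hs] at hdet ⊢
    exact key s hdet
  refine ⟨B⁻¹ *ᵥ (b ∘ a ∘ e), ?_⟩
  have hBx : (B.map (Int.castRingHom ℚ)) *ᵥ x = fun i => ((b (a (e i)) : ℤ) : ℚ) := by
    ext i
    have := hx (a (e i))
    simpa [hB, Matrix.mulVec, dotProduct] using this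
  have hinv : (B⁻¹).map (Int.castRingHom ℚ) * B.map (Int.castRingHom ℚ) = 1 := by
    rw [← Matrix.map_mul, Matrix.nonsing_inv_mul _ hdu]
    simp
  have h1 : x = (B⁻¹).map (Int.castRingHom ℚ) *ᵥ
      ((B.map (Int.castRingHom ℚ)) *ᵥ x) := by
    rw [Matrix.mulVec_mulVec, hinv, Matrix.one_mulVec]
  intro j
  rw [h1, hBx]
  simp [Matrix.mulVec, dotProduct]

/-- A vector whose image is not integral can be moved, without leaving the integral cell of its
image, such that one more component of the image is integral. -/
theorem exists_more_integral_rows {A : Matrix ι (Fin n) ℤ}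
    (hA : A.IsTotallyUnimodular) (hinj : ∀ z : Fin n → ℚ, (∀ i, ∑ j, (A i j : ℚ) * z j = 0) → z = 0)
    (x : Fin n → ℚ) (i₀ : ι) (hi₀ : ∀ z : ℤ, ∑ j, (A i₀ j : ℚ) * x j ≠ z) :
    ∃ x' : Fin n → ℚ,
      (∀ i, (⌊∑ j, (A i j : ℚ) * x j⌋ : ℚ) ≤ ∑ j, (A i j : ℚ) * x' j ∧
        ∑ j, (A i j : ℚ) * x' j ≤ (⌈∑ j, (A i j : ℚ) * x j⌉ : ℚ)) ∧
      {i | ∀ z : ℤ, ∑ j, (A i j : ℚ) * x' j ≠ z} ⊂ {i | ∀ z : ℤ, ∑ j, (A i j : ℚ) * x j ≠ z} := by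
  classical
  set ρ : (Fin n → ℚ) → ι → ℚ := fun x i => ∑ j, (A i j : ℚ) * x j with hρ
  change ∃ x' : Fin n → ℚ, (∀ i, (⌊ρ x i⌋ : ℚ) ≤ ρ x' i ∧ ρ x' i ≤ (⌈ρ x i⌉ : ℚ)) ∧
      {i | ∀ z : ℤ, ρ x' i ≠ z} ⊂ {i | ∀ z : ℤ, ρ x i ≠ z}
  change ∀ z : ℤ, ρ x i₀ ≠ z at hi₀
  have hadd : ∀ (z : Fin n → ℚ) (t : ℚ) i, ρ (x + t • z) i = ρ x i + t * ρ z i := by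
    intro z t i
    simp only [hρ, Pi.add_apply, Pi.smul_apply, smul_eq_mul, mul_add, Finset.sum_add_distrib,
      Finset.mul_sum]
    congr 1
    exact Finset.sum_congr rfl fun j _ => by ring
  -- A direction that leaves the integral rows unchanged. Without one, the integral rows alone would
  -- have full column rank, so `x` would be integral and with it row `i₀`.
  obtain ⟨z, hz0, hz⟩ : ∃ z : Fin n → ℚ, z ≠ 0 ∧ ∀ i, (∃ c : ℤ, ρ x i = c) → ρ z i = 0 := by
    by_contra! hcon
    let T := {i : ι // ∃ c : ℤ, ρ x i = c}
    have hT : (A.submatrix (Subtype.val : T → ι) id).IsTotallyUnimodular := hA.submatrix _ _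
    have : Fintype T := Fintype.ofFinite _
    obtain ⟨y, hy⟩ := exists_int_of_mulVec_injective hT (fun z hz => by
      by_contra hne
      obtain ⟨i, hi, hi'⟩ := hcon z hne
      exact hi' (hz ⟨i, hi⟩)) x (fun i => i.2.choose) (fun i => i.2.choose_spec)
    refine hi₀ (∑ j, A i₀ j * y j) ?_
    simp [hρ, hy]
  obtain ⟨i₁, hi₁⟩ : ∃ i, ρ z i ≠ 0 := by
    by_contra! hcon
    exact hz0 (hinj z hcon)
  -- The step length at which row `i`, moving along `z`, reaches the next integer. The least one
  -- over the rows that move keeps every row in its cell and makes the minimizing row integral.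
  let lam : ι → ℚ := fun i =>
    if 0 < ρ z i then (⌈ρ x i⌉ - ρ x i) / ρ z i else (⌊ρ x i⌋ - ρ x i) / ρ z i
  obtain ⟨i₂, hi₂, hmin⟩ := Finset.exists_min_image (Finset.univ.filter fun i => ρ z i ≠ 0) lam
    ⟨i₁, by simp [hi₁]⟩
  simp only [Finset.mem_filter, Finset.mem_univ, true_and] at hi₂ hmin
  have hlam0 : 0 ≤ lam i₂ := by
    simp only [lam]
    split_ifs with h
    · exact div_nonneg (by linarith [Int.le_ceil (ρ x i₂)]) h.le
    · exact div_nonneg_of_nonpos (by linarith [Int.floor_le (ρ x i₂)]) (not_lt.1 h)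
  have hcell : ∀ i, (⌊ρ x i⌋ : ℚ) ≤ ρ x i + lam i₂ * ρ z i ∧
      ρ x i + lam i₂ * ρ z i ≤ (⌈ρ x i⌉ : ℚ) := by
    intro i
    have hf := Int.floor_le (ρ x i)
    have hc := Int.le_ceil (ρ x i)
    by_cases h0 : ρ z i = 0
    · simp [h0, hf, hc]
    have hm := hmin i h0
    rcases lt_or_gt_of_ne h0 with h | h
    · have h1 : lam i = (⌊ρ x i⌋ - ρ x i) / ρ z i := by simp [lam, not_lt.2 h.le]
      rw [h1, le_div_iff_of_neg h] at hm
      constructor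
      · linarith
      · nlinarith
    · have h1 : lam i = (⌈ρ x i⌉ - ρ x i) / ρ z i := by simp [lam, h]
      rw [h1, le_div_iff₀ h] at hm
      constructor
      · nlinarith
      · linarith
  refine ⟨x + lam i₂ • z, fun i => by rw [hadd]; exact hcell i, ?_⟩
  have hsub : {i | ∀ c : ℤ, ρ (x + lam i₂ • z) i ≠ c} ⊆ {i | ∀ c : ℤ, ρ x i ≠ c} := by
    intro i hi c hc
    refine hi c ?_
    rw [hadd, hz i ⟨c, hc⟩, mul_zero, add_zero, hc]
  refine ⟨hsub, fun hcon => ?_⟩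
  have hmem : i₂ ∈ {i | ∀ c : ℤ, ρ x i ≠ c} := fun c hc => hi₂ (hz i₂ ⟨c, hc⟩)
  have := hcon hmem
  by_cases h : 0 < ρ z i₂
  · refine this ⌈ρ x i₂⌉ ?_
    rw [hadd]
    simp only [lam, h, if_true]
    field_simp
    ring
  · refine this ⌊ρ x i₂⌋ ?_
    rw [hadd]
    simp only [lam, h, if_false]
    field_simp
    ring

/-- Integral rounding in a system with full column rank. -/
theorem exists_int_rounding_of_injective {A : Matrix ι (Fin n) ℤ}
    (hA : A.IsTotallyUnimodular) (hinj : ∀ z : Fin n → ℚ, (∀ i, ∑ j, (A i j : ℚ) * z j = 0) → z = 0)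
    (x : Fin n → ℚ) :
    ∃ y : Fin n → ℤ, ∀ i, ⌊∑ j, (A i j : ℚ) * x j⌋ ≤ ∑ j, A i j * y j ∧
      ∑ j, A i j * y j ≤ ⌈∑ j, (A i j : ℚ) * x j⌉ := by
  classical
  -- Induction on the number of rows with nonintegral value.
  induction hN : Set.ncard {i | ∀ z : ℤ, ∑ j, (A i j : ℚ) * x j ≠ z} using Nat.strong_induction_on
    generalizing x with
  | _ N ih =>
    by_cases hall : ∃ i₀, ∀ z : ℤ, ∑ j, (A i₀ j : ℚ) * x j ≠ z
    · obtain ⟨i₀, hi₀⟩ := hall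
      obtain ⟨x', hx', hlt⟩ := exists_more_integral_rows hA hinj x i₀ hi₀
      obtain ⟨y, hy⟩ := ih _ (hN ▸ Set.ncard_lt_ncard hlt (Set.toFinite _)) x' rfl
      exact ⟨y, fun i => ⟨(Int.le_floor.2 (hx' i).1).trans (hy i).1,
        (hy i).2.trans (Int.ceil_le.2 (hx' i).2)⟩⟩
    · push Not at hall
      choose b hb using hall
      obtain ⟨y, hy⟩ := exists_int_of_mulVec_injective hA hinj x b hb
      refine ⟨y, fun i => ?_⟩
      have : ∑ j, (A i j : ℚ) * x j = ((∑ j, A i j * y j : ℤ) : ℚ) := by simp [hy]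
      rw [this, Int.floor_intCast, Int.ceil_intCast]
      exact ⟨le_rfl, le_rfl⟩

/-- Integral rounding: every rational vector `x` has an integral vector `y` such that each component
of `y` and of `A y` lies between the floor and the ceiling of that of `x` and of `A x`. -/
theorem exists_int_rounding {A : Matrix ι (Fin n) ℤ} (hA : A.IsTotallyUnimodular)
    (x : Fin n → ℚ) :
    ∃ y : Fin n → ℤ,
      (∀ i, ⌊∑ j, (A i j : ℚ) * x j⌋ ≤ (A *ᵥ y) i ∧ (A *ᵥ y) i ≤ ⌈∑ j, (A i j : ℚ) * x j⌉) ∧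
      ∀ j, ⌊x j⌋ ≤ y j ∧ y j ≤ ⌈x j⌉ := by
  classical
  -- Appending the identity forces full column rank and turns the bounds on rows into bounds on the
  -- coordinates as well.
  have hA' : (A.fromRows (1 : Matrix (Fin n) (Fin n) ℤ)).IsTotallyUnimodular :=
    (Matrix.fromRows_one_isTotallyUnimodular_iff A).2 hA
  have hone : ∀ (z : Fin n → ℚ) (j : Fin n),
      ∑ l, ((A.fromRows (1 : Matrix (Fin n) (Fin n) ℤ) (Sum.inr j) l : ℤ) : ℚ) * z l = z j := by
    intro z j
    simp [Matrix.one_apply]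
  have hone' : ∀ (z : Fin n → ℤ) (j : Fin n),
      ∑ l, (A.fromRows (1 : Matrix (Fin n) (Fin n) ℤ) (Sum.inr j) l : ℤ) * z l = z j := by
    intro z j
    simp [Matrix.one_apply]
  obtain ⟨y, hy⟩ := exists_int_rounding_of_injective hA' (fun z hz => by
    ext j
    have := hz (Sum.inr j)
    rwa [hone] at this) x
  refine ⟨y, fun i => hy (Sum.inl i), fun j => ?_⟩
  have := hy (Sum.inr j)
  rwa [hone, hone'] at this

/-! ### Balanced splittings and integer decomposition. -/

/-- `a` is one of the `N` parts in a balanced splitting of `b`. -/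
def Balanced (N : ℕ) (b a : ℤ) : Prop :=
  ∀ c : ℤ, (b ≤ N * c → a ≤ c) ∧ ((N : ℤ) * c ≤ b → c ≤ a)

theorem balanced_of_floor_ceil {N : ℕ} (hN : 0 < N) {b a : ℤ} {r : ℚ} (hr : r = (b : ℚ) / N)
    (h1 : ⌊r⌋ ≤ a) (h2 : a ≤ ⌈r⌉) : Balanced N b a := by
  have hN' : (0 : ℚ) < N := by exact_mod_cast hN
  refine fun c => ⟨fun h => h2.trans (Int.ceil_le.2 ?_), fun h => (Int.le_floor.2 ?_).trans h1⟩
  · rw [hr, div_le_iff₀ hN']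
    have : (b : ℚ) ≤ N * c := by exact_mod_cast h
    linarith
  · rw [hr, le_div_iff₀ hN']
    have : (N : ℚ) * c ≤ b := by exact_mod_cast h
    linarith

/-- Write `b = (N + 1) q + r` with `0 ≤ r ≤ N`. Then `a` is `q` or `q + 1`, and `q` if `r = 0`, so
`b - a = N q + (q + r - a)` with `0 ≤ q + r - a ≤ N`. Hence splitting the rest into `N` parts yields
no values beyond the floor and the ceiling of `b / (N + 1)`. This lets the decomposition split off
one part at a time. -/
theorem Balanced.of_sub {N : ℕ} (hN : 0 < N) {b a a' : ℤ} (h : Balanced (N + 1) b a)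
    (h' : Balanced N (b - a) a') : Balanced (N + 1) b a' := by
  intro c
  have hN' : (0 : ℤ) < N := by exact_mod_cast hN
  have hq := Int.emod_add_mul_ediv b (N + 1)
  have hr0 := Int.emod_nonneg b (show (N : ℤ) + 1 ≠ 0 by omega)
  have hr1 := Int.emod_lt_of_pos b (show (0 : ℤ) < (N : ℤ) + 1 by omega)
  set q := b / ((N : ℤ) + 1)
  set r := b % ((N : ℤ) + 1)
  have hqa : q ≤ a := (h q).2 (by push_cast; linarith)
  have haq : a ≤ q + 1 := (h (q + 1)).1 (by push_cast; linarith)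
  have hra : r = 0 → a ≤ q := fun h0 => (h q).1 (by push_cast; linarith)
  have e1 : b - a = N * q + (q + r - a) := by rw [← hq]; ring
  constructor
  · intro hb
    refine (h' c).1 ?_
    push_cast at hb
    rcases eq_or_lt_of_le hr0 with h0 | h0
    · have hqc : q ≤ c := by
        by_contra hcon
        have h1 : c + 1 ≤ q := by omega
        nlinarith
      have := hra h0.symm
      nlinarith
    · have hqc : q + 1 ≤ c := by
        by_contra hcon
        have h1 : c ≤ q := by omega
        nlinarith
      nlinarith
  · intro hb
    refine (h' c).2 ?_
    push_cast at hb
    have hqc : c ≤ q := by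
      by_contra hcon
      have h1 : q + 1 ≤ c := by omega
      nlinarith
    have h3 : 0 ≤ q + r - a := by
      rcases eq_or_lt_of_le hr0 with h0 | h0
      · have := hra h0.symm
        omega
      · omega
    nlinarith

/-- Integer decomposition: an integral vector is a sum of `N` integral parts, all balanced, also
under the matrix. -/
theorem exists_balanced_decomposition {A : Matrix ι (Fin n) ℤ} (hA : A.IsTotallyUnimodular)
    {N : ℕ} (hN : 0 < N) (x : Fin n → ℤ) :
    ∃ y : Fin N → Fin n → ℤ, ∑ s, y s = x ∧
      ∀ s, (∀ i, Balanced N ((A *ᵥ x) i) ((A *ᵥ y s) i)) ∧ ∀ j, Balanced N (x j) (y s j) := by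
  induction N, hN using Nat.le_induction generalizing x with
  | base =>
    refine ⟨fun _ => x, by simp, fun s => ⟨fun i c => ?_, fun j c => ?_⟩⟩ <;> simp
  | succ N hN ih =>
    -- The part split off is an integral rounding of `x / (N + 1)`.
    obtain ⟨y₀, h1, h2⟩ := exists_int_rounding hA (fun j => (x j : ℚ) / (N + 1 : ℕ))
    have hb1 : ∀ i, Balanced (N + 1) ((A *ᵥ x) i) ((A *ᵥ y₀) i) := fun i =>
      balanced_of_floor_ceil (Nat.succ_pos N) (by
        simp only [Matrix.mulVec, dotProduct, Int.cast_sum, Int.cast_mul, Finset.sum_div]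
        exact Finset.sum_congr rfl fun j _ => by ring) (h1 i).1 (h1 i).2
    have hb2 : ∀ j, Balanced (N + 1) (x j) (y₀ j) := fun j =>
      balanced_of_floor_ceil (Nat.succ_pos N) rfl (h2 j).1 (h2 j).2
    obtain ⟨y, hsum, hy⟩ := ih (x - y₀)
    refine ⟨Fin.cons y₀ y, by simp [Fin.sum_univ_succ, hsum], fun s => ?_⟩
    refine Fin.cases ?_ (fun s => ?_) s
    · exact ⟨hb1, hb2⟩
    · simp only [Fin.cons_succ]
      refine ⟨fun i => (hb1 i).of_sub hN ?_, fun j => (hb2 j).of_sub hN ((hy s).2 j)⟩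
      have := (hy s).1 i
      rwa [Matrix.mulVec_sub] at this

end TotallyUnimodular

/-! ### Decomposition of feasible points into a small point and rays -/

section Rays

variable {ι : Type*} [Fintype ι] {n : ℕ}

/-- Balanced parts all have the same weak sign. For `w ≥ 0`, `G` consists of the positive parts
(there are at most `b ≤ w` of them, or none if `b ≤ 0`). For `w < 0` all parts are nonpositive, and
`G` consists of `-w` parts that are at most `-1`. For one row of the system, `G` marks the parts
needed to satisfy the inequality; every other part satisfies its homogeneous version. -/
theorem sum_le_of_superset_of_balanced {N : ℕ} {a : Fin N → ℤ} {b w : ℤ} (hsum : ∑ s, a s = b)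
    (hbal : ∀ s, Balanced N b (a s)) (hb : b ≤ w) (hw : |w| ≤ N) :
    ∃ G : Finset (Fin N), (G.card : ℤ) ≤ |w| ∧ (∀ s ∉ G, a s ≤ 0) ∧
      ∀ G' : Finset (Fin N), G ⊆ G' → ∑ s ∈ G', a s ≤ w := by
  classical
  rcases le_or_gt 0 w with h0 | h0
  · rw [abs_of_nonneg h0] at hw ⊢
    rcases le_or_gt b 0 with hb0 | hb0
    · have hle : ∀ s, a s ≤ 0 := fun s => (hbal s 0).1 (by simpa using hb0)
      exact ⟨∅, by simpa using h0, fun s _ => hle s,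
        fun G' _ => (Finset.sum_nonpos fun s _ => hle s).trans h0⟩
    · have hnn : ∀ s, 0 ≤ a s := fun s => (hbal s 0).2 (by simpa using hb0.le)
      refine ⟨Finset.univ.filter fun s => 0 < a s, ?_, fun s hs => by simpa using hs, ?_⟩
      · calc ((Finset.univ.filter fun s => 0 < a s).card : ℤ)
            = ∑ s ∈ Finset.univ.filter (fun s => 0 < a s), 1 := by simp
          _ ≤ ∑ s ∈ Finset.univ.filter (fun s => 0 < a s), a s :=
              Finset.sum_le_sum fun s hs => by
                have := (Finset.mem_filter.1 hs).2
                omega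
          _ ≤ ∑ s, a s := Finset.sum_le_sum_of_subset_of_nonneg (Finset.filter_subset _ _)
              fun s _ _ => hnn s
          _ ≤ w := by rw [hsum]; exact hb
      · intro G' _
        exact (Finset.sum_le_sum_of_subset_of_nonneg (Finset.subset_univ _)
              fun s _ _ => hnn s).trans (by rw [hsum]; exact hb)
  · rw [abs_of_neg h0] at hw ⊢
    have hle : ∀ s, a s ≤ 0 := fun s => (hbal s 0).1 (by simpa using (hb.trans h0.le))
    have hcard : (-w).toNat ≤ (Finset.univ.filter fun s => a s ≤ -1).card := by
      rcases le_or_gt b (-N) with hbN | hbN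
      · have : ∀ s, a s ≤ -1 := fun s => (hbal s (-1)).1 (by simpa using hbN)
        simp only [this, Finset.filter_true, Finset.card_univ, Fintype.card_fin]
        omega
      · have hge : ∀ s, -1 ≤ a s := fun s => (hbal s (-1)).2 (by simpa using hbN.le)
        have h1 : -((Finset.univ.filter fun s => a s ≤ -1).card : ℤ) = ∑ s, a s := by
          rw [Finset.card_filter]
          push_cast
          rw [← Finset.sum_neg_distrib]
          refine Finset.sum_congr rfl fun s _ => ?_
          have := hle s
          have := hge s
          split_ifs <;> omega
        omega
    obtain ⟨G, hG, hGc⟩ := Finset.exists_subset_card_eq hcard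
    refine ⟨G, by rw [hGc]; omega, fun s _ => hle s, fun G' hGG => ?_⟩
    calc ∑ s ∈ G', a s = ∑ s ∈ G' \ G, a s + ∑ s ∈ G, a s := (Finset.sum_sdiff hGG).symm
      _ ≤ 0 + ∑ s ∈ G, (-1) := add_le_add (Finset.sum_nonpos fun s _ => hle s)
          (Finset.sum_le_sum fun s hs => (Finset.mem_filter.1 (hG hs)).2)
      _ ≤ w := by simp [hGc]; omega

/-- A linear objective either decreases along a ray of the recession cone with entries in
`{-1, 0, 1}`, or every feasible point is dominated by a small one. -/
theorem exists_ray_or_small {A : Matrix ι (Fin n) ℤ} (hA : A.IsTotallyUnimodular) {w : ι → ℤ}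
    (c : Fin n → ℤ) {x : Fin n → ℤ} (hx : A *ᵥ x ≤ w) :
    (∃ y : Fin n → ℤ, A *ᵥ y ≤ 0 ∧ (∀ j, |y j| ≤ 1) ∧ c ⬝ᵥ y < 0) ∨
    (∃ v : Fin n → ℤ, A *ᵥ v ≤ w ∧ (∀ j, |v j| ≤ ∑ i, |w i|) ∧ c ⬝ᵥ v ≤ c ⬝ᵥ x) := by
  classical
  -- `N ≥ |x_j|` makes the entries of all parts lie in `{-1, 0, 1}`; `N ≥ |w_i|` provides enough
  -- parts for the marked sets.
  obtain ⟨N, hN, hNw, hNx⟩ : ∃ N : ℕ, 0 < N ∧ (∀ i, |w i| ≤ N) ∧ ∀ j, |x j| ≤ N := by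
    refine ⟨1 + (∑ i, (w i).natAbs + ∑ j, (x j).natAbs), by omega, fun i => ?_, fun j => ?_⟩
    · have := Finset.single_le_sum (f := fun i => (w i).natAbs) (fun _ _ => Nat.zero_le _)
        (Finset.mem_univ i)
      have h := Int.natCast_natAbs (w i)
      omega
    · have := Finset.single_le_sum (f := fun i => (x i).natAbs) (fun _ _ => Nat.zero_le _)
        (Finset.mem_univ j)
      have h := Int.natCast_natAbs (x j)
      omega
  obtain ⟨y, hsum, hy⟩ := exists_balanced_decomposition hA hN x
  have hAy : ∀ i, ∑ s, (A *ᵥ y s) i = (A *ᵥ x) i := by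
    intro i
    rw [← hsum, ← Matrix.mulVecLin_apply, map_sum, Finset.sum_apply]
    rfl
  have hy1 : ∀ s j, |y s j| ≤ 1 := by
    intro s j
    have h := abs_le.1 (hNx j)
    exact abs_le.2 ⟨((hy s).2 j (-1)).2 (by linarith), ((hy s).2 j 1).1 (by linarith)⟩
  choose G hGc hGn hGs using fun i => sum_le_of_superset_of_balanced (hAy i)
    (fun s => (hy s).1 i) (hx i) (hNw i)
  -- A part that no row marks lies in the recession cone. If none of these improves the objective,
  -- all of them can be dropped: the marked parts still sum to a feasible point, and there are at
  -- most `∑ |w_i|` of them.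
  by_cases hray : ∃ s ∉ Finset.univ.biUnion G, c ⬝ᵥ y s < 0
  · obtain ⟨s, hs, hcs⟩ := hray
    simp only [Finset.mem_biUnion, Finset.mem_univ, true_and, not_exists] at hs
    exact Or.inl ⟨y s, fun i => hGn i s (hs i), hy1 s, hcs⟩
  · push Not at hray
    refine Or.inr ⟨∑ s ∈ Finset.univ.biUnion G, y s, fun i => ?_, fun j => ?_, ?_⟩
    · rw [← Matrix.mulVecLin_apply, map_sum, Finset.sum_apply]
      exact hGs i _ (Finset.subset_biUnion_of_mem G (Finset.mem_univ i))
    · rw [Finset.sum_apply]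
      calc |∑ s ∈ Finset.univ.biUnion G, y s j| ≤ ∑ s ∈ Finset.univ.biUnion G, |y s j| :=
            Finset.abs_sum_le_sum_abs _ _
        _ ≤ ∑ s ∈ Finset.univ.biUnion G, 1 := Finset.sum_le_sum fun s _ => hy1 s j
        _ = ((Finset.univ.biUnion G).card : ℤ) := by simp
        _ ≤ ((∑ i, (G i).card : ℕ) : ℤ) := by exact_mod_cast Finset.card_biUnion_le
        _ ≤ ∑ i, |w i| := by push_cast; exact Finset.sum_le_sum fun i _ => hGc i
    · have h1 : c ⬝ᵥ x = ∑ s, c ⬝ᵥ y s := by rw [← hsum, dotProduct_sum]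
      rw [dotProduct_sum, h1]
      refine Finset.sum_le_sum_of_subset_of_nonneg (Finset.subset_univ _) fun s _ hs => hray s hs

end Rays

/-! ### Linear programs with a unique, integral optimal solution -/

section BoxLP

variable {m n : ℕ}

def IntFeasible (W : Matrix (Fin m) (Fin n) ℤ) (w : Fin m → ℤ) (lo hi : Fin n → ℤ)
    (y : Fin n → ℤ) : Prop :=
  W *ᵥ y ≤ w ∧ (∀ j, lo j ≤ y j) ∧ ∀ j, y j ≤ hi j

/-- The linear program with constraint matrix `W` and all variable bounds present. -/
def boxLP (W : Matrix (Fin m) (Fin n) ℤ) (w : Fin m → ℤ) (c lo hi : Fin n → ℤ) : LP where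
  nv := n
  nc := m
  A := W
  b := w
  c := c
  lo := fun j => some (lo j)
  hi := fun j => some (hi j)

variable {W : Matrix (Fin m) (Fin n) ℤ} {w : Fin m → ℤ} {c lo hi : Fin n → ℤ}

theorem boxLP_feasible_intCast {y : Fin n → ℤ} (hy : IntFeasible W w lo hi y) :
    (boxLP W w c lo hi).Feasible (fun j => (y j : ℝ)) := by
  refine ⟨fun i => ?_, fun j a ha => ?_, fun j a ha => ?_⟩
  · have := hy.1 i
    simp only [Matrix.mulVec, dotProduct] at this
    change ∑ j, ((W i j : ℤ) : ℝ) * (y j : ℝ) ≤ (w i : ℝ)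
    exact_mod_cast this
  · obtain rfl : lo j = a := by simpa [boxLP] using ha
    exact Int.cast_le.2 (hy.2.1 j)
  · obtain rfl : hi j = a := by simpa [boxLP] using ha
    exact Int.cast_le.2 (hy.2.2 j)

/-- Because all variable bounds are present, a correct solver never answers "unbounded". -/
theorem boxLP_value_bddBelow : ∃ B : ℝ, ∀ x, (boxLP W w c lo hi).Feasible x →
    B ≤ (boxLP W w c lo hi).value x := by
  refine ⟨∑ j, -(|(c j : ℝ)| * (|(lo j : ℝ)| + |(hi j : ℝ)|)), fun x hx =>
    Finset.sum_le_sum fun j _ => ?_⟩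
  change -(|(c j : ℝ)| * (|(lo j : ℝ)| + |(hi j : ℝ)|)) ≤ (c j : ℝ) * x j
  have h1 : (lo j : ℝ) ≤ x j := hx.2.1 j (lo j) (by simp [boxLP])
  have h2 : x j ≤ hi j := hx.2.2 j (hi j) (by simp [boxLP])
  have h3 : |x j| ≤ |(lo j : ℝ)| + |(hi j : ℝ)| := by
    refine abs_le.2 ⟨?_, ?_⟩
    · linarith [neg_abs_le (lo j : ℝ), abs_nonneg (hi j : ℝ)]
    · linarith [le_abs_self (hi j : ℝ), abs_nonneg (lo j : ℝ)]
  have h4 : |(c j : ℝ) * x j| ≤ |(c j : ℝ)| * (|(lo j : ℝ)| + |(hi j : ℝ)|) := by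
    rw [abs_mul]
    exact mul_le_mul_of_nonneg_left h3 (abs_nonneg _)
  linarith [neg_abs_le ((c j : ℝ) * x j)]

/-- Any right answer to a totally unimodular linear program with distinct values at the integral
points is integral. -/
theorem boxLP_answer (hW : W.IsTotallyUnimodular)
    (hc : ∀ y y', IntFeasible W w lo hi y → IntFeasible W w lo hi y' → c ⬝ᵥ y = c ⬝ᵥ y' → y = y')
    (a : (boxLP W w c lo hi).Answer) (ha : LP.IsRight _ a) :
    (a = .infeasible ∧ ∀ y, ¬ IntFeasible W w lo hi y) ∨
    ∃ z : Fin n → ℤ, a = .optimal (fun j => (z j : ℚ)) ∧ IntFeasible W w lo hi z ∧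
      ∀ y, IntFeasible W w lo hi y → c ⬝ᵥ z ≤ c ⬝ᵥ y := by
  cases a with
  | infeasible => exact Or.inl ⟨rfl, fun y hy => ha _ (boxLP_feasible_intCast hy)⟩
  | unbounded =>
    obtain ⟨B, hB⟩ := boxLP_value_bddBelow (W := W) (w := w) (c := c) (lo := lo) (hi := hi)
    obtain ⟨x, hx, hlt⟩ := ha B
    exact absurd (hB x hx) (not_le.2 hlt)
  | optimal x =>
    right
    change Fin n → ℚ at x
    obtain ⟨hfeas, hopt⟩ := ha
    have hval : ∀ y : Fin n → ℤ, (boxLP W w c lo hi).value (fun j => (y j : ℝ)) =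
        ((c ⬝ᵥ y : ℤ) : ℝ) := by
      intro y
      simp only [LP.value, boxLP, dotProduct, Int.cast_sum, Int.cast_mul]
      rfl
    -- `N` is a common denominator. The balanced parts of `X = N x` are integral feasible points
    -- whose average is `x`.
    obtain ⟨N, hN, X, hX⟩ : ∃ N : ℕ, 0 < N ∧ ∃ X : Fin n → ℤ, ∀ j, (X j : ℚ) = N * x j := by
      refine ⟨∏ j, (x j).den, Finset.prod_pos fun j _ => (x j).den_pos,
        fun j => (x j).num * ∏ l ∈ Finset.univ.erase j, ((x l).den : ℤ), fun j => ?_⟩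
      rw [← Finset.mul_prod_erase Finset.univ _ (Finset.mem_univ j)]
      push_cast
      have := Rat.mul_den_eq_num (x j)
      rw [← this]
      ring
    have hNQ : (0 : ℚ) < N := by exact_mod_cast hN
    obtain ⟨y, hsum, hy⟩ := exists_balanced_decomposition hW hN X
    have hrow : ∀ i, ∑ j, (W i j : ℚ) * x j ≤ w i := by
      intro i
      have := hfeas.1 i
      change ∑ j, ((W i j : ℤ) : ℝ) * ((x j : ℚ) : ℝ) ≤ ((w i : ℤ) : ℝ) at this
      exact_mod_cast this
    have hlo : ∀ j, (lo j : ℚ) ≤ x j := by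
      intro j
      have : ((lo j : ℤ) : ℝ) ≤ ((x j : ℚ) : ℝ) := hfeas.2.1 j (lo j) (by simp [boxLP])
      exact_mod_cast this
    have hhi : ∀ j, x j ≤ (hi j : ℚ) := by
      intro j
      have : ((x j : ℚ) : ℝ) ≤ ((hi j : ℤ) : ℝ) := hfeas.2.2 j (hi j) (by simp [boxLP])
      exact_mod_cast this
    have hyf : ∀ s, IntFeasible W w lo hi (y s) := by
      intro s
      refine ⟨fun i => ((hy s).1 i (w i)).1 ?_, fun j => ((hy s).2 j (lo j)).2 ?_,
        fun j => ((hy s).2 j (hi j)).1 ?_⟩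
      · have h1 : (((W *ᵥ X) i : ℤ) : ℚ) = N * ∑ j, (W i j : ℚ) * x j := by
          simp only [Matrix.mulVec, dotProduct, Int.cast_sum, Int.cast_mul, hX, Finset.mul_sum]
          exact Finset.sum_congr rfl fun j _ => by ring
        have h2 : (((W *ᵥ X) i : ℤ) : ℚ) ≤ N * w i := by
          rw [h1]
          exact mul_le_mul_of_nonneg_left (hrow i) hNQ.le
        exact_mod_cast h2
      · have : (N : ℚ) * lo j ≤ X j := by
          rw [hX]
          exact mul_le_mul_of_nonneg_left (hlo j) hNQ.le
        exact_mod_cast this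
      · have : (X j : ℚ) ≤ N * hi j := by
          rw [hX]
          exact mul_le_mul_of_nonneg_left (hhi j) hNQ.le
        exact_mod_cast this
    have hcx : ∀ v, IntFeasible W w lo hi v → ∑ j, (c j : ℚ) * x j ≤ ((c ⬝ᵥ v : ℤ) : ℚ) := by
      intro v hv
      have h := hopt _ (boxLP_feasible_intCast hv)
      rw [hval] at h
      change ∑ j, ((c j : ℤ) : ℝ) * ((x j : ℚ) : ℝ) ≤ _ at h
      exact_mod_cast h
    have hcsum : ∑ s, ((c ⬝ᵥ y s : ℤ) : ℚ) = ∑ _s : Fin N, ∑ j, (c j : ℚ) * x j := by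
      rw [← Int.cast_sum, ← dotProduct_sum, hsum, Finset.sum_const, Finset.card_univ,
        Fintype.card_fin, nsmul_eq_mul, Finset.mul_sum]
      simp only [dotProduct, Int.cast_sum, Int.cast_mul, hX]
      exact Finset.sum_congr rfl fun j _ => by ring
    -- The parts have the optimal value on average and none is below it, so each one is optimal;
    -- `hc` then identifies all of them, and their common value is `x`.
    have hceq : ∀ s, ((c ⬝ᵥ y s : ℤ) : ℚ) = ∑ j, (c j : ℚ) * x j := by
      have := (Finset.sum_eq_sum_iff_of_le (s := Finset.univ)
        (f := fun _ : Fin N => ∑ j, (c j : ℚ) * x j) (g := fun s => ((c ⬝ᵥ y s : ℤ) : ℚ))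
        (fun s _ => hcx _ (hyf s))).1 hcsum.symm
      exact fun s => (this s (Finset.mem_univ s)).symm
    set s₀ : Fin N := ⟨0, hN⟩
    have hyeq : ∀ s, y s = y s₀ := fun s => hc _ _ (hyf s) (hyf s₀) (by
      have := (hceq s).trans (hceq s₀).symm
      exact_mod_cast this)
    have hxz : ∀ j, x j = (y s₀ j : ℚ) := by
      intro j
      have h1 : X j = N * y s₀ j := by
        have := congrFun hsum j
        simp only [hyeq, Finset.sum_const, Finset.card_univ, Fintype.card_fin] at this
        simpa using this.symm
      have h2 := hX j
      rw [h1] at h2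
      push_cast at h2
      exact (mul_left_cancel₀ hNQ.ne' h2).symm
    refine ⟨y s₀, congrArg _ (funext hxz), hyf s₀, fun v hv => ?_⟩
    have := hcx v hv
    rw [← hceq s₀] at this
    exact_mod_cast this

/-! ### Perturbed objectives with distinct values at integral points. -/

theorem abs_sum_pow_mul_lt {D : ℤ} (hD : 0 < D) (z : Fin n → ℤ) (hz : ∀ j, |z j| < D) :
    |∑ j : Fin n, D ^ (j : ℕ) * z j| < D ^ n := by
  induction n with
  | zero => simp
  | succ n ih =>
    rw [Fin.sum_univ_castSucc]
    have h1 := ih (fun j => z j.castSucc) fun j => hz _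
    have h2 : |D ^ n * z (Fin.last n)| ≤ D ^ n * (D - 1) := by
      rw [abs_mul, abs_of_pos (pow_pos hD n)]
      exact mul_le_mul_of_nonneg_left (by have := hz (Fin.last n); omega) (pow_pos hD n).le
    simp only [Fin.val_castSucc, Fin.val_last]
    calc _ ≤ _ := abs_add_le _ _
      _ < D ^ n + D ^ n * (D - 1) := add_lt_add_of_lt_of_le h1 h2
      _ = D ^ (n + 1) := by ring

theorem eq_zero_of_mul_add_eq_zero {K a b : ℤ} (hb : |b| < K) (h : K * a + b = 0) :
    a = 0 ∧ b = 0 := by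
  have ha : a = 0 := by
    have h2 : |K * a| < K := by
      have : K * a = -b := by linarith
      rw [this, abs_neg]
      exact hb
    have hK : 0 < K := (abs_nonneg b).trans_lt hb
    rw [abs_mul, abs_of_pos hK] at h2
    by_contra hne
    have := Int.one_le_abs hne
    nlinarith
  subst ha
  simpa using h

/-- Peel off the leading digit: the lower digits contribute less than `D ^ n` in absolute value and
cannot cancel a nonzero multiple of `D ^ n`. -/
theorem eq_zero_of_sum_pow_mul_eq_zero {D : ℤ} (hD : 0 < D) (z : Fin n → ℤ) (hz : ∀ j, |z j| < D)
    (h : ∑ j : Fin n, D ^ (j : ℕ) * z j = 0) : z = 0 := by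
  induction n with
  | zero => exact Subsingleton.elim _ _
  | succ n ih =>
    rw [Fin.sum_univ_castSucc] at h
    simp only [Fin.val_castSucc, Fin.val_last] at h
    obtain ⟨h1, h2⟩ := eq_zero_of_mul_add_eq_zero
      (abs_sum_pow_mul_lt hD (fun j => z j.castSucc) fun j => hz _) ((add_comm _ _).trans h)
    have h3 := ih (fun j => z j.castSucc) (fun j => hz _) h2
    ext j
    refine Fin.lastCases h1 (fun i => congrFun h3 i) j

/-- A large multiple of an objective plus a perturbation that separates the integral points with
entries in `[-R, R]`. -/
def perturbed (R : ℤ) (c : Fin n → ℤ) : Fin n → ℤ :=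
  fun j => (2 * R + 1) ^ (j : ℕ) + (2 * R + 1) ^ n * c j

theorem perturbed_dotProduct (R : ℤ) (c z : Fin n → ℤ) :
    perturbed R c ⬝ᵥ z =
      (2 * R + 1) ^ n * (c ⬝ᵥ z) + ∑ j : Fin n, (2 * R + 1) ^ (j : ℕ) * z j := by
  simp only [perturbed, dotProduct, Finset.mul_sum, ← Finset.sum_add_distrib]
  exact Finset.sum_congr rfl fun j _ => by ring

/-- Differences of integral points of the box have entries of absolute value at most `2R`, which are
digits in base `D = 2R + 1`. So the perturbation separates these points, and it changes their
comparison by less than `D ^ n`, the weight of one unit of `c`: the minimizer of the perturbed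
objective also minimizes `c`. -/
theorem perturbed_answer (hW : W.IsTotallyUnimodular) {R : ℤ} (hR : 0 ≤ R)
    (hlo : ∀ j, -R ≤ lo j) (hhi : ∀ j, hi j ≤ R)
    (a : (boxLP W w (perturbed R c) lo hi).Answer) (ha : LP.IsRight _ a) :
    (a = .infeasible ∧ ∀ y, ¬ IntFeasible W w lo hi y) ∨
    ∃ z : Fin n → ℤ, a = .optimal (fun j => (z j : ℚ)) ∧ IntFeasible W w lo hi z ∧
      ∀ y, IntFeasible W w lo hi y → c ⬝ᵥ z ≤ c ⬝ᵥ y := by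
  have hD : 0 < 2 * R + 1 := by omega
  have hdiff : ∀ y y', IntFeasible W w lo hi y → IntFeasible W w lo hi y' →
      ∀ j, |(y - y') j| < 2 * R + 1 := by
    intro y y' hy hy' j
    have h1 := hy.2.1 j
    have h2 := hy.2.2 j
    have h3 := hy'.2.1 j
    have h4 := hy'.2.2 j
    have h5 := hlo j
    have h6 := hhi j
    rw [Pi.sub_apply, abs_lt]
    constructor <;> linarith
  have hinj : ∀ y y', IntFeasible W w lo hi y → IntFeasible W w lo hi y' →
      perturbed R c ⬝ᵥ y = perturbed R c ⬝ᵥ y' → y = y' := by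
    intro y y' hy hy' h
    have h2 := hdiff y y' hy hy'
    have h3 : perturbed R c ⬝ᵥ (y - y') = 0 := by rw [dotProduct_sub, h, sub_self]
    rw [perturbed_dotProduct] at h3
    have h4 := (eq_zero_of_mul_add_eq_zero (abs_sum_pow_mul_lt hD _ h2) h3).2
    exact sub_eq_zero.1 (eq_zero_of_sum_pow_mul_eq_zero hD _ h2 h4)
  rcases boxLP_answer hW hinj a ha with h | ⟨z, hz, hzf, hmin⟩
  · exact Or.inl h
  · refine Or.inr ⟨z, hz, hzf, fun y hy => ?_⟩
    have h1 := hmin y hy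
    have h2 := abs_sum_pow_mul_lt hD _ (hdiff z y hzf hy)
    have h3 : perturbed R c ⬝ᵥ (z - y) ≤ 0 := by rw [dotProduct_sub]; linarith
    rw [perturbed_dotProduct, dotProduct_sub] at h3
    by_contra hcon
    have h4 : 1 ≤ c ⬝ᵥ z - c ⬝ᵥ y := by omega
    have h5 := (abs_lt.1 h2).1
    have h6 := mul_le_mul_of_nonneg_left h4 (pow_pos hD n).le
    linarith

end BoxLP

/-! ### Unboundedness, ranges of the variables, and cells -/

theorem sum_dite_lt_eq_sum {k n : ℕ} (hk : k ≤ n) (f : Fin k → ℤ) :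
    ∑ j : Fin n, (if h : (j : ℕ) < k then f ⟨j, h⟩ else 0) = ∑ i, f i := by
  obtain ⟨d, rfl⟩ := Nat.exists_eq_add_of_le hk
  rw [Fin.sum_univ_add]
  simp

theorem isTotallyUnimodular_fromRows_neg_one_one {m n : ℕ} {W : Matrix (Fin m) (Fin n) ℤ}
    (hW : W.IsTotallyUnimodular) :
    (W.fromRows (Matrix.fromRows (-1 : Matrix (Fin n) (Fin n) ℤ)
      (1 : Matrix (Fin n) (Fin n) ℤ))).IsTotallyUnimodular := by
  refine hW.fromRows_unitlike ?_
  rintro - (i | i)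
  · exact ⟨i, -1, funext fun j => by simp [Pi.single_apply, Matrix.one_apply, eq_comm, apply_ite]⟩
  · exact ⟨i, 1, funext fun j => by simp [Pi.single_apply, Matrix.one_apply, eq_comm]⟩

namespace IQP

variable (I : IQP)

/-! ### The magnitude of the data. -/

/-- A bound on the data of an instance, the constraint matrix excepted. -/
def mag : ℤ := 4 + I.k + ∑ i, I.w i * I.w i + ∑ i, I.q i + ∑ j, I.h j * I.h j

/-- The reason for squares in `mag`: they bound absolute values and are computed without case
distinctions. -/
theorem abs_le_mul_self (a : ℤ) : |a| ≤ a * a := by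
  rcases eq_or_ne a 0 with rfl | h
  · simp
  · have := Int.one_le_abs h
    nlinarith [abs_mul_abs_self a]

theorem sum_mul_self_nonneg {ι : Type*} [Fintype ι] (f : ι → ℤ) : 0 ≤ ∑ i, f i * f i :=
  Finset.sum_nonneg fun _ _ => mul_self_nonneg _

theorem sum_q_nonneg : 0 ≤ ∑ i, I.q i := Finset.sum_nonneg fun i _ => (I.q_pos i).le

theorem four_le_mag : 4 ≤ I.mag := by
  have h1 := sum_mul_self_nonneg I.w
  have h2 := sum_mul_self_nonneg I.h
  have h3 := I.sum_q_nonneg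
  unfold mag
  omega

theorem sum_abs_w_le : ∑ i, |I.w i| ≤ I.mag := by
  have h1 : ∑ i, |I.w i| ≤ ∑ i, I.w i * I.w i := Finset.sum_le_sum fun i _ => abs_le_mul_self _
  have h2 := sum_mul_self_nonneg I.h
  have h3 := I.sum_q_nonneg
  unfold mag
  omega

theorem sum_abs_h_le : ∑ i, |I.h i| ≤ I.mag := by
  have h1 : ∑ i, |I.h i| ≤ ∑ i, I.h i * I.h i := Finset.sum_le_sum fun i _ => abs_le_mul_self _
  have h2 := sum_mul_self_nonneg I.w
  have h3 := I.sum_q_nonneg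
  unfold mag
  omega

theorem sum_q_le : ∑ i, I.q i ≤ I.mag := by
  have h1 := sum_mul_self_nonneg I.w
  have h2 := sum_mul_self_nonneg I.h
  unfold mag
  omega

theorem k_le_mag : (I.k : ℤ) ≤ I.mag := by
  have h1 := sum_mul_self_nonneg I.w
  have h2 := sum_mul_self_nonneg I.h
  have h3 := I.sum_q_nonneg
  unfold mag
  omega

theorem mag_pow_le {a b : ℕ} (hab : a ≤ b) : I.mag ^ a ≤ I.mag ^ b :=
  pow_le_pow_right₀ (by have := I.four_le_mag; omega) hab

/-- The summand `4` in `mag` lets one more power absorb constant factors; the choices of exponents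
below rest on this. -/
theorem four_mul_mag_pow_le (a : ℕ) : 4 * I.mag ^ a ≤ I.mag ^ (a + 1) := by
  have h := I.four_le_mag
  have : 0 ≤ I.mag ^ a := pow_nonneg (by omega) a
  rw [pow_succ]
  nlinarith

/-- The number that bounds the variables in all linear programs. -/
def boxRadius : ℤ := I.mag ^ 7

variable {I}

theorem Feasible.add_smul {x y : Fin I.n → ℤ} (hx : I.Feasible x) (hy : I.W *ᵥ y ≤ 0) {t : ℤ}
    (ht : 0 ≤ t) : I.Feasible (x + t • y) := by
  intro i
  rw [Matrix.mulVec_add, Matrix.mulVec_smul]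
  have h1 := hx i
  have h2 : (I.W *ᵥ y) i ≤ 0 := hy i
  simp only [Pi.add_apply, Pi.smul_apply, smul_eq_mul]
  nlinarith

theorem obj_add_smul (x y : Fin I.n → ℤ) (t : ℤ) :
    I.obj (x + t • y) = I.obj x +
      t * (∑ i : Fin I.k, -2 * I.q i * x (Fin.castLE I.hk i) * y (Fin.castLE I.hk i) + I.h ⬝ᵥ y) -
      t ^ 2 * ∑ i : Fin I.k, I.q i * y (Fin.castLE I.hk i) ^ 2 := by
  simp only [obj, dotProduct_add, dotProduct_smul, Pi.add_apply, Pi.smul_apply, smul_eq_mul]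
  have : ∑ i : Fin I.k, -I.q i * (x (Fin.castLE I.hk i) + t * y (Fin.castLE I.hk i)) ^ 2 =
      ∑ i : Fin I.k, -I.q i * x (Fin.castLE I.hk i) ^ 2 +
      t * (∑ i : Fin I.k, -2 * I.q i * x (Fin.castLE I.hk i) * y (Fin.castLE I.hk i)) -
      t ^ 2 * ∑ i : Fin I.k, I.q i * y (Fin.castLE I.hk i) ^ 2 := by
    rw [Finset.mul_sum, Finset.mul_sum, ← Finset.sum_add_distrib, ← Finset.sum_sub_distrib]
    exact Finset.sum_congr rfl fun i _ => by ring
  rw [this]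
  ring

/-- Along `x + t y` the objective is quadratic in `t` with leading coefficient `-∑ q_i y_i² ≤ -1`,
whatever the sign of the linear term. -/
theorem unbounded_of_ray_of_quadratic {x y : Fin I.n → ℤ} (hx : I.Feasible x) (hy : I.W *ᵥ y ≤ 0)
    {i : Fin I.k} (hi : y (Fin.castLE I.hk i) ≠ 0) : I.Unbounded := by
  intro B
  set L := ∑ i : Fin I.k, -2 * I.q i * x (Fin.castLE I.hk i) * y (Fin.castLE I.hk i) + I.h ⬝ᵥ y
    with hL
  set Q := ∑ i : Fin I.k, I.q i * y (Fin.castLE I.hk i) ^ 2 with hQ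
  have hQ1 : 1 ≤ Q := by
    have h1 : I.q i * y (Fin.castLE I.hk i) ^ 2 ≤ Q :=
      Finset.single_le_sum (f := fun i : Fin I.k => I.q i * y (Fin.castLE I.hk i) ^ 2)
        (fun i _ => mul_nonneg (I.q_pos i).le (sq_nonneg _)) (Finset.mem_univ i)
    have h2 := mul_pos (I.q_pos i) (sq_pos_of_ne_zero hi)
    omega
  set t := |L| + |I.obj x| + |B| + 1 with ht
  have h1 := abs_nonneg L
  have h2 := abs_nonneg (I.obj x)
  have h3 := abs_nonneg B
  refine ⟨x + t • y, hx.add_smul hy (by omega), ?_⟩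
  rw [obj_add_smul, ← hL, ← hQ]
  have h4 := le_abs_self L
  have h5 := le_abs_self (I.obj x)
  have h6 := neg_abs_le B
  have h7 : t * 1 ≤ t * (t - L) := mul_le_mul_of_nonneg_left (by omega) (by omega)
  have h8 : t ^ 2 * 1 ≤ t ^ 2 * Q := mul_le_mul_of_nonneg_left hQ1 (sq_nonneg t)
  nlinarith

theorem obj_add_smul_of_linear {y : Fin I.n → ℤ} (hy : ∀ i : Fin I.k, y (Fin.castLE I.hk i) = 0)
    (x : Fin I.n → ℤ) (t : ℤ) : I.obj (x + t • y) = I.obj x + t * (I.h ⬝ᵥ y) := by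
  rw [obj_add_smul]
  simp [hy]

theorem unbounded_of_ray_of_linear {x y : Fin I.n → ℤ} (hx : I.Feasible x) (hy : I.W *ᵥ y ≤ 0)
    (hy0 : ∀ i : Fin I.k, y (Fin.castLE I.hk i) = 0) (hh : I.h ⬝ᵥ y < 0) : I.Unbounded := by
  intro B
  have h2 := abs_nonneg (I.obj x)
  have h3 := abs_nonneg B
  refine ⟨x + (|I.obj x| + |B| + 1) • y, hx.add_smul hy (by omega), ?_⟩
  rw [obj_add_smul_of_linear hy0]
  have h5 := le_abs_self (I.obj x)
  have h6 := neg_abs_le B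
  nlinarith

/-- `x` is feasible and satisfies `-R ≤ x ≤ R` for the box radius `R`. -/
def InBox (x : Fin I.n → ℤ) : Prop :=
  IntFeasible I.W I.w (fun _ => -I.boxRadius) (fun _ => I.boxRadius) x

theorem inBox_of_abs_le {x : Fin I.n → ℤ} (hx : I.Feasible x) (h : ∀ j, |x j| ≤ I.boxRadius) :
    InBox x :=
  ⟨hx, fun j => (abs_le.1 (h j)).1, fun j => (abs_le.1 (h j)).2⟩

theorem mag_le_boxRadius : 4 * I.mag ≤ I.boxRadius := by
  have h1 := I.four_mul_mag_pow_le 1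
  have h2 := I.mag_pow_le (show 1 + 1 ≤ 7 by norm_num)
  unfold boxRadius
  linarith

/-- For `c = 0` the condition on rays is void, so a nonempty feasible region always contains a point
with entries at most `mag`. -/
theorem exists_small_feasible (hW : I.W.IsTotallyUnimodular) {x : Fin I.n → ℤ}
    (hx : I.Feasible x) (c : Fin I.n → ℤ)
    (hray : ∀ y : Fin I.n → ℤ, I.W *ᵥ y ≤ 0 → (∀ j, |y j| ≤ 1) → 0 ≤ c ⬝ᵥ y) :
    ∃ v, InBox v ∧ (∀ j, |v j| ≤ I.mag) ∧ c ⬝ᵥ v ≤ c ⬝ᵥ x := by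
  rcases exists_ray_or_small hW c hx with ⟨y, hy, hy1, hc⟩ | ⟨v, hv, hv1, hc⟩
  · exact absurd (hray y hy hy1) (not_le.2 hc)
  · have hv2 : ∀ j, |v j| ≤ I.mag := fun j => (hv1 j).trans I.sum_abs_w_le
    refine ⟨v, inBox_of_abs_le hv fun j => (hv2 j).trans ?_, hv2, hc⟩
    have := I.four_le_mag
    have := mag_le_boxRadius (I := I)
    omega

/-- What the minimum of `x_i` or of `-x_i` over the box tells about its range. -/
theorem side_of_box_min (hW : I.W.IsTotallyUnimodular) (i : Fin I.k) {s : ℤ}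
    (hs : s = 1 ∨ s = -1) {z : Fin I.n → ℤ} (hz : InBox z)
    (hmin : ∀ y, InBox y → s * z (Fin.castLE I.hk i) ≤ s * y (Fin.castLE I.hk i)) :
    s * z (Fin.castLE I.hk i) ≤ I.mag ∧
    (-I.mag ≤ s * z (Fin.castLE I.hk i) →
      ∀ x, I.Feasible x → s * z (Fin.castLE I.hk i) ≤ s * x (Fin.castLE I.hk i)) ∧
    (s * z (Fin.castLE I.hk i) < -I.mag → I.Unbounded) := by
  set p := Fin.castLE I.hk i
  have hdot : ∀ x : Fin I.n → ℤ, Pi.single p s ⬝ᵥ x = s * x p := fun x => by simp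
  have habs : ∀ a b : ℤ, |a| ≤ b → -b ≤ s * a ∧ s * a ≤ b := by
    intro a b h
    have := abs_le.1 h
    rcases hs with rfl | rfl <;> constructor <;> linarith
  obtain ⟨v, hvb, hv, -⟩ := exists_small_feasible hW hz.1 0 (fun _ _ _ => by simp)
  have hup : s * z p ≤ I.mag := (hmin v hvb).trans (habs _ _ (hv p)).2
  by_cases hray : ∃ y : Fin I.n → ℤ, I.W *ᵥ y ≤ 0 ∧ (∀ j, |y j| ≤ 1) ∧ s * y p < 0
  · obtain ⟨y, hy, hy1, hyp⟩ := hray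
    have hpos : 0 ≤ 2 * I.mag + 1 := by have := I.four_le_mag; omega
    -- From a coordinate value of at most `A`, `2A + 1` steps lead below `-A`, and entries of size
    -- `3A + 1 ≤ 4A` still fit into the box.
    have hbox : InBox (v + (2 * I.mag + 1) • y) := by
      refine inBox_of_abs_le (Feasible.add_smul hvb.1 hy hpos) fun j => ?_
      simp only [Pi.add_apply, Pi.smul_apply, smul_eq_mul]
      have h1 := abs_add_le (v j) ((2 * I.mag + 1) * y j)
      rw [abs_mul, abs_of_nonneg hpos] at h1
      have h2 := mul_le_mul_of_nonneg_left (hy1 j) hpos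
      have h3 := hv j
      have := I.four_le_mag
      have := mag_le_boxRadius (I := I)
      linarith
    have hlt : s * z p < -I.mag := by
      have h1 := hmin _ hbox
      simp only [Pi.add_apply, Pi.smul_apply, smul_eq_mul] at h1
      have h2 := (habs _ _ (hv p)).2
      nlinarith
    refine ⟨hup, fun h => absurd hlt (not_lt.2 h), fun _ => ?_⟩
    refine unbounded_of_ray_of_quadratic hz.1 hy (i := i) fun h0 => ?_
    change y p = 0 at h0
    simp [h0] at hyp
  · push Not at hray
    -- Without an improving ray every feasible point is dominated by a small point of the box, so
    -- the minimum over the box is global and at least `-A`.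
    have key : ∀ x, I.Feasible x → ∃ v, InBox v ∧ (∀ j, |v j| ≤ I.mag) ∧ s * v p ≤ s * x p := by
      intro x hx
      have := exists_small_feasible hW hx (Pi.single p s) (fun y hy hy1 => by
        rw [hdot]
        exact hray y hy hy1)
      simpa only [hdot] using this
    refine ⟨hup, fun _ x hx => ?_, fun hlt => ?_⟩
    · obtain ⟨v, hv, -, hvx⟩ := key x hx
      exact (hmin v hv).trans hvx
    · obtain ⟨v, -, hv1, hvz⟩ := key z hz.1
      have := (habs _ _ (hv1 p)).1
      omega

/-! ### Ranges of the nonlinear variables and the spread of the objective. -/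

/-- The range of the variable `x_i` on the feasible region is `[l, u]`. -/
def IsRange (i : Fin I.k) (l u : ℤ) : Prop :=
  (∀ x, I.Feasible x → l ≤ x (Fin.castLE I.hk i) ∧ x (Fin.castLE I.hk i) ≤ u) ∧
  ((∃ x, I.Feasible x) → (∃ a, I.Feasible a ∧ a (Fin.castLE I.hk i) = l) ∧
    ∃ b, I.Feasible b ∧ b (Fin.castLE I.hk i) = u)

/-- For a fixed sum, `2 (a² + b² - c² - d²) = (a - b)² - (c - d)²`. The halves satisfy `|c - d| ≤
1`, and `c - d` has the parity of `a - b`. -/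
theorem obj_le_of_balanced {a b c d : ℤ} (hsum : c + d = a + b) (hc : Balanced 2 (a + b) c)
    (hd : Balanced 2 (a + b) d) :
    c ^ 2 + d ^ 2 ≤ a ^ 2 + b ^ 2 ∧ (a - b) ^ 2 - 1 ≤ 2 * (a ^ 2 + b ^ 2 - c ^ 2 - d ^ 2) := by
  obtain ⟨e, he | he⟩ := Int.even_or_odd' (a + b)
  · have h1 := (hc e).1 (by push_cast; omega)
    have h2 := (hd e).1 (by push_cast; omega)
    obtain rfl : c = e := by omega
    obtain rfl : d = c := by omega
    obtain rfl : b = 2 * d - a := by omega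
    constructor <;> nlinarith [sq_nonneg (a - d)]
  · have h1 := (hc e).2 (by push_cast; omega)
    have h2 := (hd e).2 (by push_cast; omega)
    have h3 : b = 2 * e + 1 - a := by omega
    have hne : a - e ≤ 0 ∨ 1 ≤ a - e := by omega
    have hcd : (c = e ∧ d = e + 1) ∨ (c = e + 1 ∧ d = e) := by omega
    subst h3
    have h4 : 0 ≤ (a - e) * (a - e - 1) := by rcases hne with h | h <;> nlinarith
    rcases hcd with ⟨rfl, rfl⟩ | ⟨rfl, rfl⟩ <;> constructor <;> nlinarith

/-- The midpoint estimate for the spread of the objective. -/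
theorem spread_lower_bound (hW : I.W.IsTotallyUnimodular) {a b : Fin I.n → ℤ} (ha : I.Feasible a)
    (hb : I.Feasible b) {fmin fmax : ℤ} (hmin : ∀ y, I.Feasible y → fmin ≤ I.obj y)
    (hmax : ∀ y, I.Feasible y → I.obj y ≤ fmax) (i : Fin I.k) :
    I.q i * ((a (Fin.castLE I.hk i) - b (Fin.castLE I.hk i)) ^ 2 - 1) ≤ 4 * (fmax - fmin) := by
  -- The two balanced parts of `a + b` replace the midpoint, which need not be integral; rounding
  -- keeps them feasible because `w` is integral.
  obtain ⟨y, hsum, hy⟩ := exists_balanced_decomposition hW (N := 2) (by norm_num) (a + b)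
  rw [Fin.sum_univ_two] at hsum
  have hfeas : ∀ s, I.Feasible (y s) := fun s r => ((hy s).1 r (I.w r)).1 (by
    rw [Matrix.mulVec_add, Pi.add_apply]
    have h1 := ha r
    have h2 := hb r
    push_cast
    linarith)
  set p := fun i : Fin I.k => Fin.castLE I.hk i
  have hterm : ∀ l : Fin I.k, y 0 (p l) ^ 2 + y 1 (p l) ^ 2 ≤ a (p l) ^ 2 + b (p l) ^ 2 ∧
      (a (p l) - b (p l)) ^ 2 - 1 ≤
        2 * (a (p l) ^ 2 + b (p l) ^ 2 - y 0 (p l) ^ 2 - y 1 (p l) ^ 2) := fun l =>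
    obj_le_of_balanced (congrFun hsum (p l)) ((hy 0).2 (p l)) ((hy 1).2 (p l))
  have hlin : I.h ⬝ᵥ y 0 + I.h ⬝ᵥ y 1 = I.h ⬝ᵥ a + I.h ⬝ᵥ b := by
    rw [← dotProduct_add, hsum, dotProduct_add]
  have hobj : I.obj (y 0) + I.obj (y 1) - I.obj a - I.obj b =
      ∑ l, I.q l * (a (p l) ^ 2 + b (p l) ^ 2 - y 0 (p l) ^ 2 - y 1 (p l) ^ 2) := by
    have h1 : ∑ l, I.q l * (a (p l) ^ 2 + b (p l) ^ 2 - y 0 (p l) ^ 2 - y 1 (p l) ^ 2) =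
        ∑ l, -I.q l * y 0 (p l) ^ 2 + ∑ l, -I.q l * y 1 (p l) ^ 2 - ∑ l, -I.q l * a (p l) ^ 2 -
          ∑ l, -I.q l * b (p l) ^ 2 := by
      rw [← Finset.sum_add_distrib, ← Finset.sum_sub_distrib, ← Finset.sum_sub_distrib]
      exact Finset.sum_congr rfl fun i _ => by ring
    rw [h1]
    simp only [obj]
    linarith
  -- Every variable contributes a nonnegative gain, so the gain of `x_i` alone is a lower bound.
  have hi : I.q i * (a (p i) ^ 2 + b (p i) ^ 2 - y 0 (p i) ^ 2 - y 1 (p i) ^ 2) ≤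
      ∑ l, I.q l * (a (p l) ^ 2 + b (p l) ^ 2 - y 0 (p l) ^ 2 - y 1 (p l) ^ 2) :=
    Finset.single_le_sum
      (f := fun l => I.q l * (a (p l) ^ 2 + b (p l) ^ 2 - y 0 (p l) ^ 2 - y 1 (p l) ^ 2))
      (fun l _ => mul_nonneg (I.q_pos l).le (by linarith [(hterm l).1])) (Finset.mem_univ i)
  have h1 := hmin a ha
  have h2 := hmin b hb
  have h3 := hmax _ (hfeas 0)
  have h4 := hmax _ (hfeas 1)
  have h5 := mul_le_mul_of_nonneg_left (hterm i).2 (I.q_pos i).le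
  change I.q i * ((a (p i) - b (p i)) ^ 2 - 1) ≤ _
  linarith

end IQP

namespace IQP

variable {I : IQP}

/-! ### Cells -/

/-- Left end, in direction `i`, of the cell with number `c` in a subdivision of `∏ [l i, u i]` into
`P` parts in each direction. -/
def cellLo (l u : ℤ → ℤ) (P c i : ℕ) : ℤ :=
  if l i + ((c / P ^ i % P : ℕ) : ℤ) * ((u i - l i) / P + 1) ≤ u i then
    l i + ((c / P ^ i % P : ℕ) : ℤ) * ((u i - l i) / P + 1) else l i

/-- Right end, in direction `i`, of the cell with number `c`. -/
def cellHi (l u : ℤ → ℤ) (P c i : ℕ) : ℤ := cellLo l u P c i + (u i - l i) / P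

/-- Lower bounds on the variables for the cell with number `c`. -/
def loBound (I : IQP) (l u : ℤ → ℤ) (P c : ℕ) (j : Fin I.n) : ℤ :=
  if (j : ℕ) < I.k then cellLo l u P c j else -I.boxRadius

/-- Upper bounds on the variables for the cell with number `c`. -/
def hiBound (I : IQP) (l u : ℤ → ℤ) (P c : ℕ) (j : Fin I.n) : ℤ :=
  if (j : ℕ) < I.k then cellHi l u P c j else I.boxRadius

/-- The linear part of the linear underestimator of the objective on the cell with number `c`. -/
def cellCost (I : IQP) (l u : ℤ → ℤ) (P c : ℕ) (j : Fin I.n) : ℤ :=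
  I.h j - if h : (j : ℕ) < I.k then I.q ⟨j, h⟩ * (cellLo l u P c j + cellHi l u P c j) else 0

def InCell (l u : ℤ → ℤ) (P c : ℕ) (y : Fin I.n → ℤ) : Prop :=
  IntFeasible I.W I.w (loBound I l u P c) (hiBound I l u P c) y

/-- Four times the bound on the error of the linear underestimators. -/
def gap (I : IQP) (l u : ℤ → ℤ) (P : ℕ) : ℤ :=
  ∑ i : Fin I.k, I.q i * ((u (i : ℕ) - l (i : ℕ)) / P) ^ 2

/-- Parts of `⌊(u - l) / P⌋ + 1` integers may overshoot `u`. The fallback to `l` in `cellLo` keeps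
the bounds of superfluous cells of the size of `l` and `u`, so that the size of the linear programs
does not depend on `ε`. -/
theorem le_cellLo {l u : ℤ → ℤ} {P c i : ℕ} (h : l i ≤ u i) :
    l i ≤ cellLo l u P c i ∧ cellLo l u P c i ≤ u i := by
  have h1 : (0 : ℤ) ≤ (u i - l i) / P :=
    Int.ediv_nonneg (by omega) (by omega)
  unfold cellLo
  split_ifs with h2
  · refine ⟨?_, h2⟩
    have := mul_nonneg (Int.natCast_nonneg (c / P ^ i % P)) (show (0 : ℤ) ≤ (u i - l i) / P + 1 by omega)
    omega
  · exact ⟨le_rfl, h⟩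

theorem InCell.bounds {l u : ℤ → ℤ} {P c : ℕ} {y : Fin I.n → ℤ} (h : InCell l u P c y)
    (i : Fin I.k) : cellLo l u P c i ≤ y (Fin.castLE I.hk i) ∧
      y (Fin.castLE I.hk i) ≤ cellHi l u P c i := by
  have h1 := h.2.1 (Fin.castLE I.hk i)
  have h2 := h.2.2 (Fin.castLE I.hk i)
  simp only [loBound, hiBound, Fin.val_castLE, i.2, if_true] at h1 h2
  exact ⟨h1, h2⟩

/-- With `s`, `t` the ends of the cell, `-x² = -(s + t) x + (x - s) (t - x) + s t`: secant slope,
error term and constant. -/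
theorem obj_eq_cellCost (l u : ℤ → ℤ) (P c : ℕ) (y : Fin I.n → ℤ) :
    I.obj y = I.cellCost l u P c ⬝ᵥ y +
      ∑ i : Fin I.k, I.q i * ((y (Fin.castLE I.hk i) - cellLo l u P c i) *
        (cellHi l u P c i - y (Fin.castLE I.hk i)) + cellLo l u P c i * cellHi l u P c i) := by
  have h1 : I.cellCost l u P c ⬝ᵥ y = I.h ⬝ᵥ y - ∑ i : Fin I.k, I.q i *
      (cellLo l u P c i + cellHi l u P c i) * y (Fin.castLE I.hk i) := by
    rw [← sum_dite_lt_eq_sum I.hk, dotProduct, dotProduct, ← Finset.sum_sub_distrib]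
    refine Finset.sum_congr rfl fun j _ => ?_
    unfold cellCost
    split_ifs with h
    · simp only [Fin.castLE_mk, Fin.eta]
      ring
    · ring
  rw [h1, obj, sub_add_eq_add_sub, add_comm, add_sub_assoc, ← Finset.sum_sub_distrib]
  congr 1
  exact Finset.sum_congr rfl fun i _ => by ring

/-- The error term `(x - s) (t - x)` is nonnegative on the cell, which is needed at `y`, and at most
`(t - s)² / 4` everywhere, which is needed at `z`. The factor `4` avoids fractions. -/
theorem obj_le_of_cellCost_le {l u : ℤ → ℤ} {P c : ℕ} {z y : Fin I.n → ℤ}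
    (hy : InCell l u P c y) (h : I.cellCost l u P c ⬝ᵥ z ≤ I.cellCost l u P c ⬝ᵥ y) :
    4 * I.obj z ≤ 4 * I.obj y + I.gap l u P := by
  rw [obj_eq_cellCost l u P c z, obj_eq_cellCost l u P c y]
  have : 4 * ∑ i : Fin I.k, I.q i * ((z (Fin.castLE I.hk i) - cellLo l u P c i) *
        (cellHi l u P c i - z (Fin.castLE I.hk i)) + cellLo l u P c i * cellHi l u P c i) ≤
      4 * ∑ i : Fin I.k, I.q i * ((y (Fin.castLE I.hk i) - cellLo l u P c i) *
        (cellHi l u P c i - y (Fin.castLE I.hk i)) + cellLo l u P c i * cellHi l u P c i) +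
      I.gap l u P := by
    rw [gap, Finset.mul_sum, Finset.mul_sum, ← Finset.sum_add_distrib]
    refine Finset.sum_le_sum fun i _ => ?_
    obtain ⟨h1, h2⟩ := hy.bounds i
    have h3 : (u (i : ℕ) - l (i : ℕ)) / P = cellHi l u P c i - cellLo l u P c i := by
      simp [cellHi]
    rw [h3]
    have h4 := mul_nonneg (sub_nonneg.2 h1) (sub_nonneg.2 h2)
    set s := cellLo l u P c i
    set t := cellHi l u P c i
    have h5 : 4 * ((z (Fin.castLE I.hk i) - s) * (t - z (Fin.castLE I.hk i)) + s * t) ≤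
        4 * ((y (Fin.castLE I.hk i) - s) * (t - y (Fin.castLE I.hk i)) + s * t) + (t - s) ^ 2 := by
      nlinarith [sq_nonneg (2 * z (Fin.castLE I.hk i) - s - t)]
    have h6 := mul_le_mul_of_nonneg_left h5 (I.q_pos i).le
    linarith
  linarith

/-- The cells cover the box. -/
theorem exists_inCell {l u : ℤ → ℤ} {P : ℕ} (hP : 0 < P) {y : Fin I.n → ℤ} (hy : InBox y)
    (hlu : ∀ i : Fin I.k, l (i : ℕ) ≤ y (Fin.castLE I.hk i) ∧ y (Fin.castLE I.hk i) ≤ u (i : ℕ)) :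
    ∃ c < P ^ I.k, InCell l u P c y := by
  have hP' : (0 : ℤ) < P := by exact_mod_cast hP
  have hstep : ∀ i : Fin I.k, 0 < (u (i : ℕ) - l (i : ℕ)) / (P : ℤ) + 1 := by
    intro i
    have h1 := hlu i
    have : (0 : ℤ) ≤ (u (i : ℕ) - l (i : ℕ)) / P := Int.ediv_nonneg (by omega) hP'.le
    omega
  -- The index of the part containing `y_i` is a digit in base `P`, because `P` parts of `⌊(u - l) /
  -- P⌋ + 1` integers cover `[l, u]`.
  have hd : ∀ i : Fin I.k, ((y (Fin.castLE I.hk i) - l (i : ℕ)) /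
      ((u (i : ℕ) - l (i : ℕ)) / (P : ℤ) + 1)).toNat < P := by
    intro i
    have h1 := hlu i
    rw [Int.toNat_lt' hP, Int.ediv_lt_iff_lt_mul (hstep i)]
    have h2 := Int.lt_ediv_add_one_mul_self (u (i : ℕ) - l (i : ℕ)) hP'
    linarith
  let c := finFunctionFinEquiv fun i : Fin I.k => (⟨_, hd i⟩ : Fin P)
  have hc : ∀ i : Fin I.k, (((c : ℕ) / P ^ (i : ℕ) % P : ℕ) : ℤ) =
      (y (Fin.castLE I.hk i) - l (i : ℕ)) / ((u (i : ℕ) - l (i : ℕ)) / (P : ℤ) + 1) := by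
    intro i
    have h1 : finFunctionFinEquiv.symm c i = ⟨_, hd i⟩ := by simp [c]
    have h2 : ((finFunctionFinEquiv.symm c i : Fin P) : ℕ) = (c : ℕ) / P ^ (i : ℕ) % P := rfl
    rw [← h2, h1]
    exact Int.toNat_of_nonneg (Int.ediv_nonneg (by have := hlu i; omega) (hstep i).le)
  have hmem : ∀ i : Fin I.k, cellLo l u P c i ≤ y (Fin.castLE I.hk i) ∧
      y (Fin.castLE I.hk i) ≤ cellHi l u P c i := by
    intro i
    obtain ⟨h1, h2⟩ := hlu i
    have h3 := Int.ediv_mul_le (y (Fin.castLE I.hk i) - l (i : ℕ)) (hstep i).ne'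
    have h4 := Int.lt_ediv_add_one_mul_self (y (Fin.castLE I.hk i) - l (i : ℕ)) (hstep i)
    unfold cellHi cellLo
    rw [hc i, if_pos (by linarith)]
    constructor
    · linarith
    · rw [add_mul] at h4
      linarith
  refine ⟨c, c.2, hy.1, fun j => ?_, fun j => ?_⟩
  · unfold loBound
    split_ifs with h
    · exact (hmem ⟨j, h⟩).1
    · exact hy.2.1 j
  · unfold hiBound
    split_ifs with h
    · exact (hmem ⟨j, h⟩).2
    · exact hy.2.2 j

/-! ### Feasible points with fixed nonlinear part -/

/-- The dichotomy for the system in which two opposite inequalities fix each nonlinear variable; it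
remains totally unimodular. Its right-hand side has absolute sum at most `A + 2A² ≤ A³`. -/
theorem exists_ray_or_small_fixed (hW : I.W.IsTotallyUnimodular) {x : Fin I.n → ℤ}
    (hx : I.Feasible x) (hxA : ∀ i : Fin I.k, |x (Fin.castLE I.hk i)| ≤ I.mag) (c : Fin I.n → ℤ) :
    (∃ y : Fin I.n → ℤ, I.W *ᵥ y ≤ 0 ∧ (∀ i : Fin I.k, y (Fin.castLE I.hk i) = 0) ∧
      (∀ j, |y j| ≤ 1) ∧ c ⬝ᵥ y < 0) ∨
    (∃ v : Fin I.n → ℤ, I.Feasible v ∧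
      (∀ i : Fin I.k, v (Fin.castLE I.hk i) = x (Fin.castLE I.hk i)) ∧
      (∀ j, |v j| ≤ I.mag ^ 3) ∧ c ⬝ᵥ v ≤ c ⬝ᵥ x) := by
  set B : Matrix (Fin I.m ⊕ (Fin I.k ⊕ Fin I.k)) (Fin I.n) ℤ :=
    (I.W.fromRows (Matrix.fromRows (-1 : Matrix (Fin I.n) (Fin I.n) ℤ)
      (1 : Matrix (Fin I.n) (Fin I.n) ℤ))).submatrix
      (Sum.map id (Sum.map (Fin.castLE I.hk) (Fin.castLE I.hk))) id with hBdef
  have hB : B.IsTotallyUnimodular := (isTotallyUnimodular_fromRows_neg_one_one hW).submatrix _ _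
  have e1 : ∀ (y : Fin I.n → ℤ) i, (B *ᵥ y) (Sum.inl i) = (I.W *ᵥ y) i := fun y i => rfl
  have e2 : ∀ (y : Fin I.n → ℤ) i, (B *ᵥ y) (Sum.inr (Sum.inl i)) = -y (Fin.castLE I.hk i) := by
    intro y i
    simp [B, Matrix.mulVec, dotProduct, Matrix.one_apply]
  have e3 : ∀ (y : Fin I.n → ℤ) i, (B *ᵥ y) (Sum.inr (Sum.inr i)) = y (Fin.castLE I.hk i) := by
    intro y i
    simp [B, Matrix.mulVec, dotProduct, Matrix.one_apply]
  set b : Fin I.m ⊕ (Fin I.k ⊕ Fin I.k) → ℤ :=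
    Sum.elim I.w (Sum.elim (fun i => -x (Fin.castLE I.hk i)) fun i => x (Fin.castLE I.hk i)) with hb
  have hxb : B *ᵥ x ≤ b := by
    rintro (i | i | i)
    · exact hx i
    · rw [e2]; rfl
    · rw [e3]; rfl
  rcases exists_ray_or_small hB c hxb with ⟨y, hy, hy1, hc⟩ | ⟨v, hv, hv1, hc⟩
  · refine Or.inl ⟨y, fun i => hy (Sum.inl i), fun i => ?_, hy1, hc⟩
    have h1 := hy (Sum.inr (Sum.inl i))
    have h2 := hy (Sum.inr (Sum.inr i))
    rw [e2] at h1
    rw [e3] at h2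
    simp only [Pi.zero_apply] at h1 h2
    omega
  · refine Or.inr ⟨v, fun i => hv (Sum.inl i), fun i => ?_, fun j => (hv1 j).trans ?_, hc⟩
    · have h1 := hv (Sum.inr (Sum.inl i))
      have h2 := hv (Sum.inr (Sum.inr i))
      rw [e2] at h1
      rw [e3] at h2
      simp only [hb, Sum.elim_inr, Sum.elim_inl] at h1 h2
      omega
    · simp only [hb, Fintype.sum_sum_type, Sum.elim_inl, Sum.elim_inr, abs_neg]
      have h1 : ∑ i : Fin I.k, |x (Fin.castLE I.hk i)| ≤ I.mag * I.mag := by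
        calc ∑ i : Fin I.k, |x (Fin.castLE I.hk i)| ≤ ∑ i : Fin I.k, I.mag :=
              Finset.sum_le_sum fun i _ => hxA i
          _ = I.k * I.mag := by simp
          _ ≤ I.mag * I.mag :=
              mul_le_mul_of_nonneg_right I.k_le_mag (by have := I.four_le_mag; omega)
      have h2 := I.sum_abs_w_le
      have h3 := I.four_le_mag
      nlinarith

theorem abs_obj_le {v : Fin I.n → ℤ} (hv : ∀ i : Fin I.k, |v (Fin.castLE I.hk i)| ≤ I.mag)
    {b : ℕ} (hb : 2 ≤ b) (hv3 : ∀ j, |v j| ≤ I.mag ^ b) : |I.obj v| ≤ I.mag ^ (b + 2) := by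
  have hA := I.four_le_mag
  have h1 : |∑ i : Fin I.k, -I.q i * v (Fin.castLE I.hk i) ^ 2| ≤ I.mag * I.mag ^ 2 := by
    calc |∑ i : Fin I.k, -I.q i * v (Fin.castLE I.hk i) ^ 2|
        ≤ ∑ i : Fin I.k, |-I.q i * v (Fin.castLE I.hk i) ^ 2| := Finset.abs_sum_le_sum_abs _ _
      _ ≤ ∑ i : Fin I.k, I.q i * I.mag ^ 2 := by
          refine Finset.sum_le_sum fun i _ => ?_
          rw [abs_mul, abs_neg, abs_of_pos (I.q_pos i), abs_pow]
          exact mul_le_mul_of_nonneg_left (pow_le_pow_left₀ (abs_nonneg _) (hv i) 2) (I.q_pos i).le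
      _ = (∑ i : Fin I.k, I.q i) * I.mag ^ 2 := (Finset.sum_mul _ _ _).symm
      _ ≤ I.mag * I.mag ^ 2 := mul_le_mul_of_nonneg_right I.sum_q_le (sq_nonneg _)
  have h2 : |I.h ⬝ᵥ v| ≤ I.mag * I.mag ^ b := by
    calc |I.h ⬝ᵥ v| ≤ ∑ j, |I.h j * v j| := Finset.abs_sum_le_sum_abs _ _
      _ ≤ ∑ j, |I.h j| * I.mag ^ b := by
          refine Finset.sum_le_sum fun j _ => ?_
          rw [abs_mul]
          exact mul_le_mul_of_nonneg_left (hv3 j) (abs_nonneg _)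
      _ = (∑ j, |I.h j|) * I.mag ^ b := (Finset.sum_mul _ _ _).symm
      _ ≤ I.mag * I.mag ^ b := mul_le_mul_of_nonneg_right I.sum_abs_h_le (by positivity)
  have h3 := abs_add_le (∑ i : Fin I.k, -I.q i * v (Fin.castLE I.hk i) ^ 2) (I.h ⬝ᵥ v)
  have h4 := I.mag_pow_le hb
  have h5 : (0 : ℤ) ≤ I.mag ^ b := by positivity
  calc |I.obj v| ≤ _ := h3
    _ ≤ I.mag * I.mag ^ b + I.mag * I.mag ^ b :=
        add_le_add (h1.trans (mul_le_mul_of_nonneg_left h4 (by omega))) h2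
    _ ≤ I.mag ^ (b + 2) := by
        have h6 : 2 * (I.mag * I.mag ^ b) ≤ I.mag * (I.mag * I.mag ^ b) :=
          mul_le_mul_of_nonneg_right (by omega) (mul_nonneg (by omega) h5)
        calc _ = 2 * (I.mag * I.mag ^ b) := by ring
          _ ≤ _ := h6
          _ = _ := by ring

/-! ### Correctness of the best point found -/

/-- The error of the linear underestimators is at most `ε` times the spread of the objective. -/
theorem gap_le (hW : I.W.IsTotallyUnimodular) {ε : ℝ} (hε : 0 < ε) {P : ℕ}
    (hP : (I.k : ℝ) < ε * ((P : ℝ) * P - I.k)) {l u : ℤ → ℤ}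
    (hr : ∀ i : Fin I.k, IsRange i (l (i : ℕ)) (u (i : ℕ)))
    (hlu : ∀ i : Fin I.k, l (i : ℕ) ≤ u (i : ℕ)) (hne : ∃ x, I.Feasible x) {fmin fmax : ℤ}
    (hmin : ∀ y, I.Feasible y → fmin ≤ I.obj y) (hmax : ∀ y, I.Feasible y → I.obj y ≤ fmax) :
    (I.gap l u P : ℝ) ≤ 4 * ε * ((fmax : ℝ) - fmin) := by
  have hfm : fmin ≤ fmax := by
    obtain ⟨x, hx⟩ := hne
    exact (hmin x hx).trans (hmax x hx)
  have hfm' : (0 : ℝ) ≤ (fmax : ℝ) - fmin := by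
    have : (fmin : ℝ) ≤ fmax := by exact_mod_cast hfm
    linarith
  have hterm : ∀ i : Fin I.k, I.q i * ((u (i : ℕ) - l (i : ℕ)) / P) ^ 2 * ((P : ℤ) ^ 2 - 1) ≤
      4 * (fmax - fmin) := by
    intro i
    obtain ⟨⟨a, ha, hai⟩, ⟨b, hb, hbi⟩⟩ := (hr i).2 hne
    have h1 := spread_lower_bound hW hb ha hmin hmax i
    rw [hai, hbi] at h1
    set d := u (i : ℕ) - l (i : ℕ) with hd
    have hd0 : 0 ≤ d := by have := hlu i; omega
    rcases eq_or_lt_of_le (Int.ediv_nonneg hd0 (Int.natCast_nonneg P)) with h0 | h0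
    · rw [← h0]
      simp only [ne_eq, OfNat.ofNat_ne_zero, not_false_eq_true, zero_pow, mul_zero, zero_mul]
      omega
    · have h2 : d / P * P ≤ d := Int.ediv_mul_le _ (by rintro h; simp [h] at h0)
      have h3 : (d / P * P) ^ 2 ≤ d ^ 2 :=
        pow_le_pow_left₀ (mul_nonneg h0.le (Int.natCast_nonneg P)) h2 2
      -- A positive width is at least `1`, which compensates for the `-1` from rounding the
      -- midpoint; a width of `0` causes no error at all.
      have h4 : (d / P) ^ 2 * ((P : ℤ) ^ 2 - 1) ≤ d ^ 2 - 1 := by nlinarith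
      have h5 := mul_le_mul_of_nonneg_left h4 (I.q_pos i).le
      linarith
  have hsum : I.gap l u P * ((P : ℤ) ^ 2 - 1) ≤ I.k * (4 * (fmax - fmin)) := by
    rw [gap, Finset.sum_mul]
    calc _ ≤ ∑ _i : Fin I.k, 4 * (fmax - fmin) := Finset.sum_le_sum fun i _ => hterm i
      _ = _ := by simp
  rcases Nat.eq_zero_or_pos I.k with hk | hk
  · have : I.gap l u P = 0 := by
      unfold gap
      have : IsEmpty (Fin I.k) := by rw [hk]; infer_instance
      simp
    rw [this]
    simp only [Int.cast_zero]
    positivity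
  · have hk1 : (1 : ℝ) ≤ I.k := by exact_mod_cast hk
    have hP1 : (I.k : ℝ) ≤ ε * ((P : ℝ) ^ 2 - 1) :=
      hP.le.trans (mul_le_mul_of_nonneg_left (by nlinarith) hε.le)
    have hP2 : 0 < (P : ℝ) ^ 2 - 1 := by
      by_contra hcon
      nlinarith [not_lt.1 hcon]
    have hsum' : (I.gap l u P : ℝ) * ((P : ℝ) ^ 2 - 1) ≤ I.k * (4 * ((fmax : ℝ) - fmin)) := by
      exact_mod_cast hsum
    have h6 : (I.k : ℝ) * (4 * ((fmax : ℝ) - fmin)) ≤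
        ε * ((P : ℝ) ^ 2 - 1) * (4 * ((fmax : ℝ) - fmin)) :=
      mul_le_mul_of_nonneg_right hP1 (by linarith)
    refine le_of_mul_le_mul_right ?_ hP2
    linarith

theorem gap_le_mag {P : ℕ} (hP : 0 < P) {l u : ℤ → ℤ} (hl : ∀ i : Fin I.k, -I.mag ≤ l (i : ℕ) ∧
    l (i : ℕ) ≤ u (i : ℕ) ∧ u (i : ℕ) ≤ I.mag) : I.gap l u P ≤ I.mag ^ 4 := by
  have hA := I.four_le_mag
  calc I.gap l u P ≤ ∑ i : Fin I.k, I.q i * (2 * I.mag) ^ 2 := by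
        refine Finset.sum_le_sum fun i _ => mul_le_mul_of_nonneg_left ?_ (I.q_pos i).le
        obtain ⟨h1, h2, h3⟩ := hl i
        have h4 : (0 : ℤ) ≤ (u (i : ℕ) - l (i : ℕ)) / P := Int.ediv_nonneg (by omega) (by omega)
        have h5 : (u (i : ℕ) - l (i : ℕ)) / P ≤ u (i : ℕ) - l (i : ℕ) :=
          Int.ediv_le_self _ (by omega)
        exact pow_le_pow_left₀ h4 (by omega) 2
    _ = (∑ i, I.q i) * (2 * I.mag) ^ 2 := (Finset.sum_mul _ _ _).symm
    _ ≤ I.mag * (2 * I.mag) ^ 2 := mul_le_mul_of_nonneg_right I.sum_q_le (sq_nonneg _)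
    _ = 4 * I.mag ^ 3 := by ring
    _ ≤ I.mag ^ 4 := I.four_mul_mag_pow_le 3

theorem exists_isOptimal (hne : ∃ x, I.Feasible x) {b : ℤ}
    (hb : ∀ x, I.Feasible x → b ≤ I.obj x) : ∃ x, I.IsOptimal x := by
  obtain ⟨x₀, hx₀⟩ := hne
  obtain ⟨m, ⟨x, hx, rfl⟩, hm⟩ := Int.exists_least_of_bdd (P := fun v => ∃ x, I.Feasible x ∧ I.obj x = v)
    ⟨b, fun v ⟨x, hx, hv⟩ => hv ▸ hb x hx⟩ ⟨_, x₀, hx₀, rfl⟩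
  exact ⟨x, hx, fun y hy => hm _ ⟨y, hy, rfl⟩⟩

/-- The best point found on the cells tells whether the problem is unbounded or infeasible, and is
an approximate solution otherwise. -/
theorem best_correct (hW : I.W.IsTotallyUnimodular) {ε : ℝ} (hε : 0 < ε) {P : ℕ} (hP0 : 0 < P)
    (hP : (I.k : ℝ) < ε * ((P : ℝ) * P - I.k)) {l u : ℤ → ℤ}
    (hr : ∀ i : Fin I.k, IsRange i (l (i : ℕ)) (u (i : ℕ)))
    (hl : ∀ i : Fin I.k, -I.mag ≤ l (i : ℕ) ∧ l (i : ℕ) ≤ u (i : ℕ) ∧ u (i : ℕ) ≤ I.mag)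
    {st best : ℤ} {xb : Fin I.n → ℤ}
    (hst : (st = 0 ∧ best = I.mag ^ 16) ∨ (st = 2 ∧ I.Feasible xb ∧ I.obj xb = best))
    (hall : ∀ c < P ^ I.k, ∀ y : Fin I.n → ℤ, InCell l u P c y →
      st = 2 ∧ 4 * best ≤ 4 * I.obj y + I.gap l u P) :
    (best ≤ -I.mag ^ 6 → I.Unbounded) ∧
    (-I.mag ^ 6 < best → (st = 0 ∧ I.Infeasible) ∨ (st = 2 ∧ I.IsApprox ε xb)) := by
  have hA := I.four_le_mag
  -- The exponent `7` of the box radius leaves room for a point of size `A³` followed by `A⁶ + 2A⁵`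
  -- steps along a ray.
  have hrad : ∀ a b : ℤ, |a| ≤ I.mag ^ 3 → |b| ≤ 1 →
      |a + (I.mag ^ 6 + 2 * I.mag ^ 5) * b| ≤ I.boxRadius := by
    intro a b ha hb
    have h3 : (0 : ℤ) ≤ I.mag ^ 6 + 2 * I.mag ^ 5 := by positivity
    have h1 := abs_add_le a ((I.mag ^ 6 + 2 * I.mag ^ 5) * b)
    rw [abs_mul, abs_of_nonneg h3] at h1
    have h2 := mul_le_mul_of_nonneg_left hb h3
    have h4 := I.four_mul_mag_pow_le 5
    have h5 := I.four_mul_mag_pow_le 6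
    have h6 := I.mag_pow_le (show 3 ≤ 6 by norm_num)
    norm_num at h4 h5
    unfold boxRadius
    linarith
  have hxA : ∀ x, I.Feasible x → ∀ i : Fin I.k, |x (Fin.castLE I.hk i)| ≤ I.mag := by
    intro x hx i
    have h1 := (hr i).1 x hx
    have h2 := hl i
    exact abs_le.2 ⟨by omega, by omega⟩
  have hcell : ∀ v, I.Feasible v → (∀ j, |v j| ≤ I.boxRadius) →
      st = 2 ∧ 4 * best ≤ 4 * I.obj v + I.gap l u P := by
    intro v hv hvR
    obtain ⟨c, hc, hvc⟩ := exists_inCell hP0 (inBox_of_abs_le hv hvR) fun i => (hr i).1 v hv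
    exact hall c hc v hvc
  have h3R : I.mag ^ 3 ≤ I.boxRadius := I.mag_pow_le (by norm_num)
  have hinf : st = 0 → I.Infeasible := by
    intro h0 x hx
    rcases exists_ray_or_small_fixed hW hx (hxA x hx) 0 with ⟨y, -, -, -, h⟩ | ⟨v, hv, -, hv3, -⟩
    · simp at h
    · have := (hcell v hv fun j => (hv3 j).trans h3R).1
      omega
  have hpos16 : 0 < I.mag ^ 16 := by positivity
  have hpos6 : 0 < I.mag ^ 6 := by positivity
  rcases hst with ⟨hst0, hbest⟩ | ⟨hst2, hxb, hobj⟩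
  · exact ⟨fun h => by omega, fun _ => Or.inl ⟨hst0, hinf hst0⟩⟩
  -- The nonlinear variables are bounded, so only rays that fix them matter. With an improving ray
  -- the box contains points of value at most `A⁵ - (A⁶ + 2A⁵)`, and the cell error of at most `A⁴ /
  -- 4` cannot lift the best value above `-A⁶`. Without one, the objective is at least `-A⁵` on the
  -- whole feasible region.
  by_cases hray : ∃ y : Fin I.n → ℤ, I.W *ᵥ y ≤ 0 ∧ (∀ i : Fin I.k, y (Fin.castLE I.hk i) = 0) ∧
      (∀ j, |y j| ≤ 1) ∧ I.h ⬝ᵥ y < 0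
  · obtain ⟨y, hy, hy0, hy1, hhy⟩ := hray
    refine ⟨fun _ => unbounded_of_ray_of_linear hxb hy hy0 hhy, fun hlt => ?_⟩
    exfalso
    rcases exists_ray_or_small_fixed hW hxb (hxA _ hxb) 0 with ⟨y, -, -, -, h⟩ | ⟨v, hv, -, hv3, -⟩
    · simp at h
    · have hpos : 0 ≤ I.mag ^ 6 + 2 * I.mag ^ 5 := by positivity
      have h1 := (hcell _ (hv.add_smul hy hpos) fun j => by
        simpa using hrad _ _ (hv3 j) (hy1 j)).2
      rw [obj_add_smul_of_linear hy0] at h1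
      have h2 := (abs_le.1 (abs_obj_le (hxA v hv) (by norm_num) hv3)).2
      have h3 := gap_le_mag hP0 hl
      have h4 := I.mag_pow_le (show 4 ≤ 5 by norm_num)
      have h5 : (I.mag ^ 6 + 2 * I.mag ^ 5) * (I.h ⬝ᵥ y) ≤ (I.mag ^ 6 + 2 * I.mag ^ 5) * (-1) :=
        mul_le_mul_of_nonneg_left (by omega) hpos
      have h6 : 0 < I.mag ^ 5 := by positivity
      norm_num at h2
      linarith
  · push Not at hray
    have hsmall : ∀ x, I.Feasible x → ∃ v, I.Feasible v ∧ (∀ j, |v j| ≤ I.boxRadius) ∧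
        -I.mag ^ 5 ≤ I.obj v ∧ I.obj v ≤ I.obj x := by
      intro x hx
      rcases exists_ray_or_small_fixed hW hx (hxA x hx) I.h with
        ⟨y, hy, hy0, hy1, h⟩ | ⟨v, hv, hvx, hv3, h⟩
      · exact absurd (hray y hy hy0 hy1) (not_le.2 h)
      · refine ⟨v, hv, fun j => (hv3 j).trans h3R,
          (abs_le.1 (abs_obj_le (hxA v hv) (by norm_num) hv3)).1, ?_⟩
        simp only [obj, hvx]
        linarith
    have hlow : ∀ x, I.Feasible x → -I.mag ^ 5 ≤ I.obj x := fun x hx => by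
      obtain ⟨v, -, -, h1, h2⟩ := hsmall x hx
      exact h1.trans h2
    constructor
    · intro h
      have h1 := hlow xb hxb
      have h2 := I.four_mul_mag_pow_le 5
      have h3 : 0 < I.mag ^ 5 := by positivity
      norm_num at h2
      omega
    · refine fun _ => Or.inr ⟨hst2, hxb, ?_⟩
      obtain ⟨xs, hxs⟩ := exists_isOptimal ⟨xb, hxb⟩ hlow
      refine ⟨xs, hxs, fun fmax hmax => ?_⟩
      have hle : ∀ y, I.Feasible y → I.obj y ≤ fmax := fun y hy => hmax.2 ⟨y, hy, rfl⟩
      rcases eq_or_lt_of_le (hle xs hxs.1) with heq | hlt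
      · exact Or.inl heq
      · refine Or.inr ⟨hlt, ?_⟩
        have hlt' : (0 : ℝ) < (fmax : ℝ) - I.obj xs := by
          have : (I.obj xs : ℝ) < fmax := by exact_mod_cast hlt
          linarith
        rw [div_le_iff₀ hlt']
        have hgap := gap_le hW hε hP hr (fun i => (hl i).2.1) ⟨xb, hxb⟩ hxs.2 hle
        -- The optimal solution itself may lie outside the box; a small point with the same
        -- nonlinear part and no larger objective lies in some cell.
        obtain ⟨v, hv, hvR, -, hvle⟩ := hsmall xs hxs.1
        have h1 := (hcell v hv hvR).2
        have h2 : 4 * I.obj xb ≤ 4 * I.obj xs + I.gap l u P := by rw [hobj]; linarith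
        have h3 : 4 * (I.obj xb : ℝ) ≤ 4 * (I.obj xs : ℝ) + (I.gap l u P : ℝ) := by
          exact_mod_cast h2
        linarith

end IQP

/-! ### Total correctness of programs, with resource bounds -/

theorem intSize_mono {a b : ℤ} (h : |a| ≤ b) : intSize a ≤ intSize b := by
  unfold intSize
  refine Nat.add_le_add_right (Nat.size_le_size ?_) 1
  have h1 := Int.natCast_natAbs a
  have h2 := Int.natCast_natAbs b
  have h3 := le_abs_self b
  omega

/-- Every memory cell has absolute value at most `X`. -/
def Bounded (X : ℤ) (σ : Store) : Prop := ∀ a i, |σ a i| ≤ X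

theorem Bounded.write {X : ℤ} {σ : Store} (h : Bounded X σ) {v : ℤ} (hv : |v| ≤ X) (a : ℕ) (i : ℤ) :
    Bounded X (σ.write a i v) := by
  intro a' i'
  unfold Store.write
  split_ifs
  · exact hv
  · exact h a' i'

theorem Store.write_of_ne (σ : Store) {a a' : ℕ} (h : a' ≠ a) (i v : ℤ) :
    σ.write a i v a' = σ a' := by
  funext i'
  simp [Store.write, h]

theorem Store.write_self (σ : Store) (a : ℕ) (i v : ℤ) : σ.write a i v a i = v := by
  simp [Store.write]

theorem Store.write_self_of_ne (σ : Store) (a : ℕ) {i i' : ℤ} (h : i' ≠ i) (v : ℤ) :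
    σ.write a i v a i' = σ a i' := by
  simp [Store.write, h]

namespace Expr

/-- If all memory cells are at most `X ≥ 2` in absolute value, then all numbers in the evaluation
are at most `X ^ weight`. -/
def weight : Expr → ℕ
  | const z => z.natAbs
  | get _ e => max 1 e.weight
  | add e f => max e.weight f.weight + 1
  | sub e f => max e.weight f.weight + 1
  | mul e f => e.weight + f.weight
  | div e f => max e.weight f.weight

theorem abs_eval_le {X : ℤ} (hX : 2 ≤ X) {σ : Store} (hσ : Bounded X σ) (e : Expr) :
    |e.eval σ| ≤ X ^ e.weight := by
  have hmono : ∀ {a b : ℕ}, a ≤ b → X ^ a ≤ X ^ b := fun h => pow_le_pow_right₀ (by omega) h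
  induction e with
  | const z =>
    simp only [eval, weight]
    calc |z| = ((z.natAbs : ℕ) : ℤ) := (Int.natCast_natAbs z).symm
      _ ≤ ((2 ^ z.natAbs : ℕ) : ℤ) := by exact_mod_cast Nat.lt_two_pow_self.le
      _ ≤ X ^ z.natAbs := by push_cast; exact pow_le_pow_left₀ (by norm_num) hX _
  | get a e _ =>
    simp only [eval, weight]
    exact (hσ a _).trans (by simpa using hmono (le_max_left 1 e.weight))
  | add e f he hf =>
    simp only [eval, weight]
    have h1 := he.trans (hmono (le_max_left e.weight f.weight))
    have h2 := hf.trans (hmono (le_max_right e.weight f.weight))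
    have h3 := abs_add_le (e.eval σ) (f.eval σ)
    have h4 := (abs_nonneg _).trans h1
    rw [pow_succ]
    nlinarith
  | sub e f he hf =>
    simp only [eval, weight]
    have h1 := he.trans (hmono (le_max_left e.weight f.weight))
    have h2 := hf.trans (hmono (le_max_right e.weight f.weight))
    have h3 := abs_sub (e.eval σ) (f.eval σ)
    have h4 := (abs_nonneg _).trans h1
    rw [pow_succ]
    nlinarith
  | mul e f he hf =>
    simp only [eval, weight]
    rw [abs_mul, pow_add]
    exact mul_le_mul he hf (abs_nonneg _) (pow_nonneg (by omega) _)
  | div e f he hf =>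
    simp only [eval, weight]
    refine le_trans ?_ (he.trans (hmono (le_max_left e.weight f.weight)))
    have h1 := Int.natAbs_ediv_le_natAbs (e.eval σ) (f.eval σ)
    have h2 := Int.natCast_natAbs (e.eval σ / f.eval σ)
    have h3 := Int.natCast_natAbs (e.eval σ)
    omega

theorem bits_le {X : ℤ} (hX : 2 ≤ X) {σ : Store} (hσ : Bounded X σ) (e : Expr) {N : ℕ}
    (hN : e.weight ≤ N) : e.bits σ ≤ intSize (X ^ N) := by
  have key : ∀ f : Expr, f.weight ≤ N → intSize (f.eval σ) ≤ intSize (X ^ N) := fun f hf =>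
    intSize_mono ((abs_eval_le hX hσ f).trans (pow_le_pow_right₀ (by omega) hf))
  induction e with
  | const z => exact key _ hN
  | get a e he =>
    exact max_le (key _ hN) (he (by simp only [weight] at hN; omega))
  | add e f he hf =>
    simp only [bits]
    have h := key _ hN
    simp only [weight] at hN
    exact max_le h (max_le (he (by omega)) (hf (by omega)))
  | sub e f he hf =>
    simp only [bits]
    have h := key _ hN
    simp only [weight] at hN
    exact max_le h (max_le (he (by omega)) (hf (by omega)))
  | mul e f he hf =>
    simp only [bits]
    have h := key _ hN
    simp only [weight] at hN
    exact max_le h (max_le (he (by omega)) (hf (by omega)))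
  | div e f he hf =>
    simp only [bits]
    have h := key _ hN
    simp only [weight] at hN
    exact max_le h (max_le (he (by omega)) (hf (by omega)))

end Expr

def Test.weight : Test → ℕ
  | .le e f => max e.weight f.weight
  | .leEps e f => max e.weight f.weight

theorem Test.bits_le {X : ℤ} (hX : 2 ≤ X) {σ : Store} (hσ : Bounded X σ) (t : Test) {N : ℕ}
    (hN : t.weight ≤ N) : t.bits σ ≤ intSize (X ^ N) := by
  cases t <;> simp only [Test.weight] at hN <;>
    exact max_le (Expr.bits_le hX hσ _ (by omega)) (Expr.bits_le hX hσ _ (by omega))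

/-- The solver, the accuracy, a bound on the memory cells, and a property of linear programs. -/
structure Setting where
  S : Solver
  ε : ℝ
  X : ℤ
  two_le : 2 ≤ X
  good : LP → Prop

/-- Started in `σ`, the program halts in a bounded memory that satisfies `Q`, within time `T` and
with at most `N` calls of the solver, all for good linear programs. -/
def Runs (C : Setting) (P : Prog) (σ : Store) (T N : ℕ) (Q : Store → Prop) : Prop :=
  ∃ τ r, Exec C.S C.ε P σ τ r ∧ r.time ≤ T ∧ r.bits ≤ intSize (C.X ^ 64) ∧ r.lps.length ≤ N ∧
    (∀ L ∈ r.lps, C.good L) ∧ Bounded C.X τ ∧ Q τ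

namespace Runs

variable {C : Setting} {P P' : Prog} {σ : Store} {T T' N N' : ℕ} {Q Q' : Store → Prop}

theorem mono (h : Runs C P σ T N Q) (hT : T ≤ T') (hN : N ≤ N')
    (hQ : ∀ τ, Bounded C.X τ → Q τ → Q' τ) : Runs C P σ T' N' Q' := by
  obtain ⟨τ, r, he, ht, hb, hn, hg, hτ, hq⟩ := h
  exact ⟨τ, r, he, ht.trans hT, hb, hn.trans hN, hg, hτ, hQ τ hτ hq⟩

theorem skip (hσ : Bounded C.X σ) (hQ : Q σ) : Runs C .skip σ 1 0 Q :=
  ⟨σ, _, Exec.skip σ, le_rfl, Nat.zero_le _, le_rfl, by simp, hσ, hQ⟩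

/-- Weights are syntactic, so for concrete expressions these conditions are decidable. Only the
stored value must be compared with `X`; intermediate results may reach `X ^ 64`. -/
theorem assign (hσ : Bounded C.X σ) (a : ℕ) {i e : Expr} (hi : i.weight ≤ 64) (he : e.weight ≤ 64)
    (hv : |e.eval σ| ≤ C.X) (hQ : Q (σ.write a (i.eval σ) (e.eval σ))) :
    Runs C (.assign a i e) σ (i.time + e.time + 1) 0 Q :=
  ⟨_, _, Exec.assign a i e σ, le_rfl,
    max_le (Expr.bits_le C.two_le hσ i hi) (Expr.bits_le C.two_le hσ e he), le_rfl, by simp,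
    hσ.write hv _ _, hQ⟩

theorem seq (h : Runs C P σ T N Q) (h' : ∀ τ, Bounded C.X τ → Q τ → Runs C P' τ T' N' Q') :
    Runs C (.seq P P') σ (T + T') (N + N') Q' := by
  obtain ⟨τ, r, he, ht, hb, hn, hg, hτ, hq⟩ := h
  obtain ⟨υ, s, he', ht', hb', hn', hg', hυ, hq'⟩ := h' τ hτ hq
  refine ⟨υ, _, Exec.seq he he', Nat.add_le_add ht ht', max_le hb hb', ?_, ?_, hυ, hq'⟩
  · simp only [Record.append, List.length_append]
    omega
  · intro L hL
    rcases List.mem_append.1 hL with h | h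
    exacts [hg L h, hg' L h]

theorem cond (hσ : Bounded C.X σ) {t : Test} (ht : t.weight ≤ 64)
    (h : t.Holds C.ε σ → Runs C P σ T N Q) (h' : ¬ t.Holds C.ε σ → Runs C P' σ T' N' Q) :
    Runs C (.cond t P P') σ (t.time + max T T') (max N N') Q := by
  have hb0 := Test.bits_le C.two_le hσ t ht
  by_cases hh : t.Holds C.ε σ
  · obtain ⟨τ, r, he, hT, hb, hn, hg, hτ, hq⟩ := h hh
    refine ⟨τ, _, Exec.condTrue hh he, ?_, max_le hb0 hb, ?_, ?_, hτ, hq⟩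
    · simp only [Record.append]
      omega
    · simp only [Record.append, List.nil_append]
      omega
    · simpa [Record.append] using hg
  · obtain ⟨τ, r, he, hT, hb, hn, hg, hτ, hq⟩ := h' hh
    refine ⟨τ, _, Exec.condFalse hh he, ?_, max_le hb0 hb, ?_, ?_, hτ, hq⟩
    · simp only [Record.append]
      omega
    · simp only [Record.append, List.nil_append]
      omega
    · simpa [Record.append] using hg

/-- Passes the remaining budget on to the second program, so that the totals can be fixed in
advance. -/
theorem bind (h : Runs C P σ T N Q) (hT : T ≤ T') (hN : N ≤ N')
    (h' : ∀ τ, Bounded C.X τ → Q τ → Runs C P' τ (T' - T) (N' - N) Q') :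
    Runs C (.seq P P') σ T' N' Q' :=
  (h.seq h').mono (by omega) (by omega) fun _ _ h => h

theorem assign_of_le (hσ : Bounded C.X σ) (a : ℕ) {i e : Expr} (hi : i.weight ≤ 64)
    (he : e.weight ≤ 64) (hT : i.time + e.time + 1 ≤ T) {u v : ℤ} (hu : i.eval σ = u)
    (hv : e.eval σ = v) (hX : |v| ≤ C.X) (hQ : Q (σ.write a u v)) :
    Runs C (.assign a i e) σ T N Q := by
  subst hu hv
  exact (assign hσ a hi he hX hQ).mono hT (Nat.zero_le _) fun _ _ h => h

theorem cond_of_le (hσ : Bounded C.X σ) {t : Test} (ht : t.weight ≤ 64) (hT : t.time ≤ T)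
    (h : t.Holds C.ε σ → Runs C P σ (T - t.time) N Q)
    (h' : ¬ t.Holds C.ε σ → Runs C P' σ (T - t.time) N Q) :
    Runs C (.cond t P P') σ T N Q :=
  (cond hσ ht h h').mono (by omega) (by omega) fun _ _ h => h

theorem skip_of_le (hσ : Bounded C.X σ) (hT : 1 ≤ T) (hQ : Q σ) : Runs C .skip σ T N Q :=
  (skip hσ hQ).mono hT (Nat.zero_le _) fun _ _ h => h

/-- A loop whose test holds exactly `M` times. -/
theorem loop {t : Test} (ht : t.weight ≤ 64) {M : ℕ} {Inv : ℕ → Store → Prop}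
    (hσ : Bounded C.X σ) {j : ℕ} (hj : j ≤ M) (h0 : Inv j σ)
    (step : ∀ j τ, j < M → Bounded C.X τ → Inv j τ →
      t.Holds C.ε τ ∧ Runs C P τ T N (Inv (j + 1)))
    (exit : ∀ τ, Inv M τ → ¬ t.Holds C.ε τ) :
    Runs C (.loop t P) σ ((M - j) * (t.time + T) + t.time) ((M - j) * N) (Inv M) := by
  have hb0 := fun (τ : Store) (hτ : Bounded C.X τ) => Test.bits_le C.two_le hτ t ht
  induction hd : M - j generalizing j σ with
  | zero =>
    obtain rfl : j = M := by omega
    refine ⟨σ, _, Exec.loopFalse (exit σ h0), ?_, hb0 σ hσ, by simp, by simp, hσ, h0⟩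
    simp
  | succ d ih =>
    obtain ⟨hh, τ, r, he, hT, hb, hn, hg, hτ, hq⟩ := step j σ (by omega) hσ h0
    obtain ⟨υ, s, he', hT', hb', hn', hg', hυ, hq'⟩ := ih (j := j + 1) hτ (by omega) hq (by omega)
    refine ⟨υ, _, Exec.loopTrue hh he he', ?_, max_le (hb0 σ hσ) (max_le hb hb'), ?_, ?_, hυ, hq'⟩
    · simp only [Record.append]
      rw [Nat.add_mul, Nat.one_mul]
      omega
    · simp only [Record.append, List.nil_append, List.length_append]
      rw [Nat.add_mul, Nat.one_mul]
      omega
    · intro L hL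
      rcases List.mem_append.1 (show L ∈ r.lps ++ s.lps from hL) with h | h
      exacts [hg L h, hg' L h]

end Runs

/-- Cell `0` of array `a`, used as a variable. -/
def var (a : ℕ) : Expr := .get a (.const 0)

/-- `for i = 0, …, b - 1 do P`. -/
def forProg (i : ℕ) (b : Expr) (P : Prog) : Prog :=
  .seq (.assign i (.const 0) (.const 0))
    (.loop (.le (.add (var i) (.const 1)) b)
      (.seq P (.assign i (.const 0) (.add (var i) (.const 1)))))

/-- The invariant for `j + 1` refers to the memory after the increment, so the body only has to
preserve the counter; `hInv` keeps the bound equal to `M` throughout. -/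
theorem Runs.for {C : Setting} {P : Prog} {σ : Store} {T N : ℕ} (hσ : Bounded C.X σ) (i : ℕ)
    {b : Expr} (hb : b.weight ≤ 64) {M : ℕ} (hM : (M : ℤ) ≤ C.X) (Inv : ℕ → Store → Prop)
    (h0 : Inv 0 (σ.write i 0 0))
    (hInv : ∀ j τ, j ≤ M → Inv j τ → τ i 0 = j ∧ b.eval τ = M)
    (step : ∀ j τ, j < M → Bounded C.X τ → Inv j τ →
      Runs C P τ T N fun υ => υ i 0 = j ∧ Inv (j + 1) (υ.write i 0 (j + 1))) :
    Runs C (forProg i b P) σ (3 + (M * (b.time + 5 + (T + 6)) + (b.time + 5))) (M * N) (Inv M) := by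
  have hX := C.two_le
  have h1 := Runs.seq (Runs.assign (Q := Inv 0) hσ i (i := .const 0) (e := .const 0) (by decide)
    (by decide) (by simp [Expr.eval]; omega) h0)
    fun τ hτ hq => Runs.loop (t := .le (.add (var i) (.const 1)) b) (M := M) (Inv := Inv)
      (by simp only [Test.weight, Expr.weight, var]; simp [hb]) hτ (Nat.zero_le M) hq
      (P := .seq P (.assign i (.const 0) (.add (var i) (.const 1)))) (T := T + 6) (N := N)
      (fun j υ hj hυ hq' => by
        obtain ⟨h1, h2⟩ := hInv j υ hj.le hq'
        constructor
        · simp only [Test.Holds, Expr.eval, var, h1, h2]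
          omega
        · refine (Runs.seq (step j υ hj hυ hq') (T' := 6) (N' := 0) fun ω hω ⟨h3, h4⟩ => ?_)
          refine Runs.assign hω i (i := .const 0) (e := .add (var i) (.const 1)) (by decide)
            (by simp only [Expr.weight, var]; decide) ?_ ?_
          · simp only [Expr.eval, var, h3]
            rw [abs_of_nonneg (by omega)]
            omega
          · simpa only [Expr.eval, var, h3] using h4)
      (fun υ hq' => by
        obtain ⟨h1, h2⟩ := hInv M υ le_rfl hq'
        simp only [Test.Holds, Expr.eval, var, h1, h2]
        omega)
  refine h1.mono ?_ ?_ fun _ _ h => h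
  · simp only [Expr.time, Test.time, var]
    simp only [Nat.sub_zero]
    rw [show 1 + 1 + 1 + 1 + b.time + 1 = b.time + 5 by ring]
  · simp

/-! ### Elementary loops -/

/-- Summation loop. Bounds are required for all partial sums, since each of them is stored. -/
theorem Runs.accumulate {C : Setting} {σ : Store} (hσ : Bounded C.X σ) {a : ℕ} (ha : a ≠ 28)
    {b e : Expr} (hb : b.weight ≤ 64) (he : e.weight ≤ 63) {M : ℕ} (hM : (M : ℤ) ≤ C.X) (f : ℕ → ℤ)
    (hbe : ∀ τ : Store, (∀ a', a' ≠ a → a' ≠ 28 → τ a' = σ a') → b.eval τ = M)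
    (hee : ∀ j < M, ∀ τ : Store, (∀ a', a' ≠ a → a' ≠ 28 → τ a' = σ a') → τ 28 0 = j →
      e.eval τ = f j)
    (hf : ∀ j ≤ M, |σ a 0 + ∑ i ∈ Finset.range j, f i| ≤ C.X) :
    Runs C (forProg 28 b (.assign a (.const 0) (.add (var a) e))) σ
      (3 + (M * (b.time + 5 + (e.time + 5 + 6)) + (b.time + 5))) 0 fun τ =>
      (∀ a', a' ≠ a → a' ≠ 28 → τ a' = σ a') ∧ τ a 0 = σ a 0 + ∑ i ∈ Finset.range M, f i := by
  refine (Runs.for (N := 0) hσ 28 hb hM (fun j τ => (∀ a', a' ≠ a → a' ≠ 28 → τ a' = σ a') ∧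
    τ a 0 = σ a 0 + ∑ i ∈ Finset.range j, f i ∧ τ 28 0 = j) ?_ ?_ ?_).mono le_rfl (by simp)
    fun τ _ h => ⟨h.1, h.2.1⟩
  · refine ⟨fun a' _ h => Store.write_of_ne _ h _ _, ?_, by simp [Store.write_self]⟩
    rw [Store.write_of_ne _ ha]
    simp
  · exact fun j τ _ h => ⟨h.2.2, hbe τ h.1⟩
  · rintro j τ hj hτ ⟨h1, h2, h3⟩
    have hv : (Expr.add (var a) e).eval τ = σ a 0 + ∑ i ∈ Finset.range (j + 1), f i := by
      simp only [Expr.eval, var, h2, hee j hj τ h1 h3, Finset.sum_range_succ]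
      ring
    refine (Runs.assign (i := .const 0) (e := .add (var a) e) hτ a (by decide) ?_ ?_ ?_).mono
      (by simp only [Expr.time, var]; omega) le_rfl fun _ _ h => h
    · simp only [Expr.weight, var]
      omega
    · rw [hv]
      exact hf (j + 1) hj
    · rw [hv]
      refine ⟨?_, fun a' h h' => ?_, ?_, ?_⟩
      · rw [Store.write_of_ne _ ha.symm, h3]
      · rw [Store.write_of_ne _ h', Store.write_of_ne _ h, h1 a' h h']
      · rw [Store.write_of_ne _ ha]
        exact Store.write_self _ _ _ _
      · rw [Store.write_self]
        push_cast
        rfl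

theorem Runs.fill {C : Setting} {σ : Store} (hσ : Bounded C.X σ) {a : ℕ} (ha : a ≠ 28)
    {b e : Expr} (hb : b.weight ≤ 64) (he : e.weight ≤ 64) {M : ℕ} (hM : (M : ℤ) ≤ C.X) (f : ℕ → ℤ)
    (hbe : ∀ τ : Store, (∀ a', a' ≠ a → a' ≠ 28 → τ a' = σ a') → b.eval τ = M)
    (hee : ∀ j < M, ∀ τ : Store, (∀ a', a' ≠ a → a' ≠ 28 → τ a' = σ a') → τ 28 0 = j →
      e.eval τ = f j)
    (hf : ∀ j < M, |f j| ≤ C.X) :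
    Runs C (forProg 28 b (.assign a (var 28) e)) σ
      (3 + (M * (b.time + 5 + (e.time + 3 + 6)) + (b.time + 5))) 0 fun τ =>
      (∀ a', a' ≠ a → a' ≠ 28 → τ a' = σ a') ∧ ∀ j < M, τ a (j : ℤ) = f j := by
  refine (Runs.for (N := 0) hσ 28 hb hM (fun j τ => (∀ a', a' ≠ a → a' ≠ 28 → τ a' = σ a') ∧
    (∀ i < j, τ a (i : ℤ) = f i) ∧ τ 28 0 = j) ?_ ?_ ?_).mono le_rfl (by simp)
    fun τ _ h => ⟨h.1, h.2.1⟩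
  · exact ⟨fun a' _ h => Store.write_of_ne _ h _ _, by simp, by simp [Store.write_self]⟩
  · exact fun j τ _ h => ⟨h.2.2, hbe τ h.1⟩
  · rintro j τ hj hτ ⟨h1, h2, h3⟩
    have hv : e.eval τ = f j := hee j hj τ h1 h3
    have hi : (var 28).eval τ = j := h3
    refine (Runs.assign (i := var 28) (e := e) hτ a (by decide) he ?_ ?_).mono
      (by simp only [Expr.time, var]; omega) le_rfl fun _ _ h => h
    · rw [hv]
      exact hf j hj
    · rw [hv, hi]
      refine ⟨?_, fun a' h h' => ?_, fun i hij => ?_, ?_⟩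
      · rw [Store.write_of_ne _ ha.symm, h3]
      · rw [Store.write_of_ne _ h', Store.write_of_ne _ h, h1 a' h h']
      · rw [Store.write_of_ne _ ha]
        rcases Nat.lt_succ_iff_lt_or_eq.1 hij with h | rfl
        · rw [Store.write_self_of_ne _ _ (by exact_mod_cast h.ne), h2 i h]
        · rw [Store.write_self]
      · rw [Store.write_self]
        push_cast
        rfl

/-! ### The memory after the initialization -/

/-- Use of the arrays: 0-4 input; 5, 6 output; 7 `mag`; 8 box radius `R`; 9 powers of `2R + 1`; 10
flags; 11 `P`; 12, 13 ranges; 14 unboundedness found with the ranges; 15 number of cells; 16 current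
cell; 17 best value; 18 index of a nonlinear variable; 19 remaining digits of the cell number; 21-23
objective and bounds of the linear program; 24-26 answer; 27 objective value; 28 inner counter. -/
def nExpr : Expr := .get 0 (.const 0)
def mExpr : Expr := .get 0 (.const 1)
def kExpr : Expr := .get 0 (.const 2)

/-- The memory holds the input. -/
structure HasInput (I : IQP) (σ : Store) : Prop where
  n : σ 0 0 = I.n
  m : σ 0 1 = I.m
  k : σ 0 2 = I.k
  W : ∀ (i : Fin I.m) (j : Fin I.n), σ 1 ((i : ℕ) * (I.n : ℤ) + (j : ℕ)) = I.W i j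
  w : ∀ i : Fin I.m, σ 2 (i : ℕ) = I.w i
  q : ∀ i : Fin I.k, σ 3 (i : ℕ) = I.q i
  h : ∀ j : Fin I.n, σ 4 (j : ℕ) = I.h j

theorem HasInput.congr {I : IQP} {σ τ : Store} (hσ : HasInput I σ) (h : ∀ a < 5, τ a = σ a) :
    HasInput I τ := by
  constructor
  · rw [h 0 (by norm_num), hσ.n]
  · rw [h 0 (by norm_num), hσ.m]
  · rw [h 0 (by norm_num), hσ.k]
  · rw [h 1 (by norm_num)]
    exact hσ.W
  · rw [h 2 (by norm_num)]
    exact hσ.w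
  · rw [h 3 (by norm_num)]
    exact hσ.q
  · rw [h 4 (by norm_num)]
    exact hσ.h

/-- The memory holds the input and the numbers computed by the initialization. -/
structure Initialized (I : IQP) (σ : Store) : Prop extends HasInput I σ where
  mag : σ 7 0 = I.mag
  radius : σ 8 0 = I.boxRadius
  pow : ∀ j ≤ I.n, σ 9 (j : ℤ) = (2 * I.boxRadius + 1) ^ j
  flag : ∀ j : Fin I.n, σ 10 (j : ℕ) = 1

theorem Initialized.congr {I : IQP} {σ τ : Store} (hσ : Initialized I σ)
    (h : ∀ a < 11, a ≠ 5 → a ≠ 6 → τ a = σ a) : Initialized I τ where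
  toHasInput := hσ.toHasInput.congr fun a ha => h a (by omega) (by omega) (by omega)
  mag := by rw [h 7 (by norm_num) (by norm_num) (by norm_num), hσ.mag]
  radius := by rw [h 8 (by norm_num) (by norm_num) (by norm_num), hσ.radius]
  pow := by
    rw [h 9 (by norm_num) (by norm_num) (by norm_num)]
    exact hσ.pow
  flag := by
    rw [h 10 (by norm_num) (by norm_num) (by norm_num)]
    exact hσ.flag

/-- The bound on the data of the linear programs. -/
def IQP.lpBound (I : IQP) : ℤ := (2 * I.boxRadius + 1) ^ I.n * I.mag ^ 20

/-- The linear programs that the algorithm solves. -/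
def GoodLP (I : IQP) (L : LP) : Prop :=
  ∃ c lo hi : Fin I.n → ℤ, L = boxLP I.W I.w c lo hi ∧
    ∀ j, |c j| ≤ I.lpBound ∧ |lo j| ≤ I.lpBound ∧ |hi j| ≤ I.lpBound

/-- The setting for an instance: `X` is large in comparison with the data. -/
structure Fits (I : IQP) (C : Setting) : Prop where
  correct : C.S.Correct
  tu : I.W.IsTotallyUnimodular
  good : C.good = GoodLP I
  lpBound_le : I.lpBound ≤ C.X
  m_le : (I.m : ℤ) ≤ C.X

namespace IQP

variable (I : IQP)

theorem mag_pow_pos (a : ℕ) : 0 < I.mag ^ a := pow_pos (by have := I.four_le_mag; omega) a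

theorem boxRadius_pos : 0 < I.boxRadius := I.mag_pow_pos 7

theorem one_le_pow (j : ℕ) : 1 ≤ (2 * I.boxRadius + 1) ^ j :=
  one_le_pow₀ (by have := I.boxRadius_pos; omega)

theorem mul_mag_pow_le {a b : ℕ} (hb : b ≤ 20) (ha : a ≤ I.n) :
    (2 * I.boxRadius + 1) ^ a * I.mag ^ b ≤ I.lpBound := by
  unfold lpBound
  exact mul_le_mul (pow_le_pow_right₀ (by have := I.boxRadius_pos; omega) ha) (I.mag_pow_le hb)
    (I.mag_pow_pos b).le (by have := I.one_le_pow I.n; omega)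

theorem mag_pow_le_lpBound {b : ℕ} (hb : b ≤ 20) : I.mag ^ b ≤ I.lpBound := by
  simpa using I.mul_mag_pow_le hb (Nat.zero_le _)

theorem pow_le_lpBound {j : ℕ} (hj : j ≤ I.n) : (2 * I.boxRadius + 1) ^ j ≤ I.lpBound := by
  simpa using I.mul_mag_pow_le (Nat.zero_le 20) hj

theorem mag_le_lpBound : I.mag ≤ I.lpBound := by
  simpa using I.mag_pow_le_lpBound (b := 1) (by norm_num)

theorem boxRadius_le_lpBound : I.boxRadius ≤ I.lpBound := I.mag_pow_le_lpBound (b := 7) (by norm_num)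

theorem n_le_lpBound : (I.n : ℤ) ≤ I.lpBound := by
  refine le_trans ?_ (I.pow_le_lpBound le_rfl)
  have h1 : (I.n : ℤ) ≤ 2 ^ I.n := by exact_mod_cast Nat.lt_two_pow_self.le
  exact h1.trans (pow_le_pow_left₀ (by norm_num) (by have := I.boxRadius_pos; omega) _)

/-- `D ^ j + D ^ n |c_j| ≤ D ^ n (1 + |c_j|)`, which explains the exponent `20` in `lpBound`. -/
theorem abs_perturbed_le {c : Fin I.n → ℤ} {j : Fin I.n} (hc : |c j| ≤ I.mag ^ 19) :
    |perturbed I.boxRadius c j| ≤ I.lpBound := by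
  unfold perturbed
  have h0 := I.one_le_pow (j : ℕ)
  have h1 := I.one_le_pow I.n
  have h2 := abs_add_le ((2 * I.boxRadius + 1) ^ (j : ℕ)) ((2 * I.boxRadius + 1) ^ I.n * c j)
  rw [abs_mul, abs_of_pos (by omega : 0 < (2 * I.boxRadius + 1) ^ (j : ℕ)),
    abs_of_pos (by omega : 0 < (2 * I.boxRadius + 1) ^ I.n)] at h2
  have h3 : (2 * I.boxRadius + 1) ^ (j : ℕ) ≤ (2 * I.boxRadius + 1) ^ I.n :=
    pow_le_pow_right₀ (by have := I.boxRadius_pos; omega) j.2.le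
  have h4 : 1 + |c j| ≤ I.mag ^ 20 := by
    have := I.four_mul_mag_pow_le 19
    have := I.mag_pow_pos 19
    norm_num at *
    omega
  have h5 : (2 * I.boxRadius + 1) ^ I.n * (1 + |c j|) ≤ I.lpBound :=
    mul_le_mul_of_nonneg_left h4 (by omega)
  nlinarith

end IQP

/-! ### Initialization -/

/-- Compute `A := 4 + k + ∑ w_i² + ∑ q_i + ∑ h_j²`. -/
def magProg : Prog :=
  .seq (.assign 7 (.const 0) (.add (.const 4) kExpr)) <|
  .seq (forProg 28 mExpr (.assign 7 (.const 0)
    (.add (var 7) (.mul (.get 2 (var 28)) (.get 2 (var 28)))))) <|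
  .seq (forProg 28 kExpr (.assign 7 (.const 0) (.add (var 7) (.get 3 (var 28)))))
    (forProg 28 nExpr (.assign 7 (.const 0)
      (.add (var 7) (.mul (.get 4 (var 28)) (.get 4 (var 28))))))

theorem magProg_spec {I : IQP} {C : Setting} (hC : Fits I C) {σ : Store} (hσ : Bounded C.X σ)
    (hin : HasInput I σ) : Runs C magProg σ (60 * (I.n + I.m + I.k + 1)) 0 fun τ =>
      (∀ a, a ≠ 7 → a ≠ 28 → τ a = σ a) ∧ τ 7 0 = I.mag := by
  have hAX := I.mag_le_lpBound.trans hC.lpBound_le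
  have hA := I.four_le_mag
  have hk0 : (0 : ℤ) ≤ I.k := Int.natCast_nonneg _
  have sw : ∑ i ∈ Finset.range I.m, σ 2 (i : ℤ) * σ 2 (i : ℤ) = ∑ i, I.w i * I.w i := by
    rw [Finset.sum_range]
    exact Finset.sum_congr rfl fun i _ => by rw [hin.w]
  have sq : ∑ i ∈ Finset.range I.k, σ 3 (i : ℤ) = ∑ i, I.q i := by
    rw [Finset.sum_range]
    exact Finset.sum_congr rfl fun i _ => by rw [hin.q]
  have sh : ∑ i ∈ Finset.range I.n, σ 4 (i : ℤ) * σ 4 (i : ℤ) = ∑ i, I.h i * I.h i := by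
    rw [Finset.sum_range]
    exact Finset.sum_congr rfl fun i _ => by rw [hin.h]
  -- All summands of `mag` are nonnegative, so no partial sum exceeds the final value.
  have pw : ∀ j ≤ I.m, 0 ≤ ∑ i ∈ Finset.range j, σ 2 (i : ℤ) * σ 2 (i : ℤ) ∧
      ∑ i ∈ Finset.range j, σ 2 (i : ℤ) * σ 2 (i : ℤ) ≤ ∑ i, I.w i * I.w i := fun j hj =>
    ⟨Finset.sum_nonneg fun _ _ => mul_self_nonneg _, sw ▸ Finset.sum_le_sum_of_subset_of_nonneg
      (Finset.range_mono hj) fun _ _ _ => mul_self_nonneg _⟩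
  have hq0 : ∀ i ∈ Finset.range I.k, 0 ≤ σ 3 (i : ℤ) := fun i hi => by
    have := hin.q ⟨i, Finset.mem_range.1 hi⟩
    simp only at this
    rw [this]
    exact (I.q_pos _).le
  have pq : ∀ j ≤ I.k, 0 ≤ ∑ i ∈ Finset.range j, σ 3 (i : ℤ) ∧
      ∑ i ∈ Finset.range j, σ 3 (i : ℤ) ≤ ∑ i, I.q i := fun j hj =>
    ⟨Finset.sum_nonneg fun i hi => hq0 i (Finset.range_mono hj hi),
      sq ▸ Finset.sum_le_sum_of_subset_of_nonneg (Finset.range_mono hj) fun i hi _ => hq0 i hi⟩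
  have ph : ∀ j ≤ I.n, 0 ≤ ∑ i ∈ Finset.range j, σ 4 (i : ℤ) * σ 4 (i : ℤ) ∧
      ∑ i ∈ Finset.range j, σ 4 (i : ℤ) * σ 4 (i : ℤ) ≤ ∑ i, I.h i * I.h i := fun j hj =>
    ⟨Finset.sum_nonneg fun _ _ => mul_self_nonneg _, sh ▸ Finset.sum_le_sum_of_subset_of_nonneg
      (Finset.range_mono hj) fun _ _ _ => mul_self_nonneg _⟩
  have zw := IQP.sum_mul_self_nonneg I.w
  have zq := I.sum_q_nonneg
  have zh := IQP.sum_mul_self_nonneg I.h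
  have hdef : I.mag = 4 + I.k + ∑ i, I.w i * I.w i + ∑ i, I.q i + ∑ j, I.h j * I.h j := rfl
  have hnX : (I.n : ℤ) ≤ C.X := I.n_le_lpBound.trans hC.lpBound_le
  have hkX : (I.k : ℤ) ≤ C.X := I.k_le_mag.trans hAX
  refine Runs.mono (P := magProg) (N := 0 + (0 + (0 + 0)))
    (Runs.seq (Runs.assign (Q := fun τ => (∀ a, a ≠ 7 → a ≠ 28 → τ a = σ a) ∧ τ 7 0 = 4 + I.k) hσ 7
      (by decide) (by decide) ?_ ?_) fun τ₁ b₁ ⟨h₁, v₁⟩ =>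
    Runs.seq (Runs.accumulate b₁ (by decide) (by decide) (by decide) hC.m_le
      (fun i => σ 2 (i : ℤ) * σ 2 (i : ℤ)) ?_ ?_ ?_) fun τ₂ b₂ ⟨h₂, v₂⟩ =>
    Runs.seq (Runs.accumulate b₂ (by decide) (by decide) (by decide) hkX
      (fun i => σ 3 (i : ℤ)) ?_ ?_ ?_) fun τ₃ b₃ ⟨h₃, v₃⟩ =>
    Runs.mono (Runs.accumulate b₃ (by decide) (by decide) (by decide) hnX
      (fun i => σ 4 (i : ℤ) * σ 4 (i : ℤ)) ?_ ?_ ?_) le_rfl le_rfl ?_) ?_ le_rfl fun _ _ h => h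
  · simp only [Expr.eval, kExpr, hin.k]
    rw [abs_of_nonneg (by omega)]
    omega
  · simp only [Expr.eval, kExpr, hin.k]
    exact ⟨fun a h _ => Store.write_of_ne _ h _ _, Store.write_self _ _ _ _⟩
  · intro τ h
    simp only [Expr.eval, mExpr]
    rw [h 0 (by decide) (by decide), h₁ 0 (by decide) (by decide), hin.m]
  · intro j _ τ h hj
    simp only [Expr.eval, var, hj]
    rw [h 2 (by decide) (by decide), h₁ 2 (by decide) (by decide)]
  · intro j hj
    have := pw j hj
    rw [v₁, abs_of_nonneg (by omega)]
    omega
  · intro τ h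
    simp only [Expr.eval, kExpr]
    rw [h 0 (by decide) (by decide), h₂ 0 (by decide) (by decide), h₁ 0 (by decide) (by decide),
      hin.k]
  · intro j _ τ h hj
    simp only [Expr.eval, var, hj]
    rw [h 3 (by decide) (by decide), h₂ 3 (by decide) (by decide), h₁ 3 (by decide) (by decide)]
  · intro j hj
    have := pq j hj
    rw [v₂, v₁, sw, abs_of_nonneg (by omega)]
    omega
  · intro τ h
    simp only [Expr.eval, nExpr]
    rw [h 0 (by decide) (by decide), h₃ 0 (by decide) (by decide), h₂ 0 (by decide) (by decide),
      h₁ 0 (by decide) (by decide), hin.n]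
  · intro j _ τ h hj
    simp only [Expr.eval, var, hj]
    rw [h 4 (by decide) (by decide), h₃ 4 (by decide) (by decide), h₂ 4 (by decide) (by decide),
      h₁ 4 (by decide) (by decide)]
  · intro j hj
    have := ph j hj
    rw [v₃, v₂, v₁, sw, sq, abs_of_nonneg (by omega)]
    omega
  · rintro τ - ⟨h, v⟩
    refine ⟨fun a ha ha' => ?_, ?_⟩
    · rw [h a ha ha', h₃ a ha ha', h₂ a ha ha', h₁ a ha ha']
    · rw [v, v₃, v₂, v₁, sw, sq, sh, hdef]
  · simp only [Expr.time, nExpr, mExpr, kExpr, var]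
    omega

/-- The seventh power of a variable. -/
def pow7 (a : ℕ) : Expr :=
  .mul (var a) (.mul (var a) (.mul (var a) (.mul (var a) (.mul (var a) (.mul (var a) (var a))))))

/-- Compute the radius `R` of the box, the powers of `2 R + 1`, and the flags. -/
def powProg : Prog :=
  .seq (.assign 8 (.const 0) (pow7 7)) <|
  .seq (.assign 9 (.const 0) (.const 1)) <|
  .seq (forProg 28 nExpr (.assign 9 (.add (var 28) (.const 1))
    (.mul (.get 9 (var 28)) (.add (.mul (.const 2) (var 8)) (.const 1)))))
    (forProg 28 nExpr (.assign 10 (var 28) (.const 1)))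

theorem powProg_spec {I : IQP} {C : Setting} (hC : Fits I C) {σ : Store} (hσ : Bounded C.X σ)
    (hin : HasInput I σ) (hmag : σ 7 0 = I.mag) :
    Runs C powProg σ (80 * (I.n + 1)) 0 fun τ =>
      (∀ a, a ≠ 8 → a ≠ 9 → a ≠ 10 → a ≠ 28 → τ a = σ a) ∧ Initialized I τ := by
  have hRX := I.boxRadius_le_lpBound.trans hC.lpBound_le
  have hR := I.boxRadius_pos
  have hnX : (I.n : ℤ) ≤ C.X := I.n_le_lpBound.trans hC.lpBound_le
  have hX := C.two_le
  refine Runs.mono (P := powProg) (N := 0 + (0 + (I.n * 0 + 0)))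
    (Runs.seq (Runs.assign (Q := fun τ => (∀ a, a ≠ 8 → τ a = σ a) ∧ τ 8 0 = I.boxRadius) hσ 8
      (by decide) (by decide) ?_ ?_) fun τ₁ b₁ ⟨h₁, v₁⟩ =>
    Runs.seq (Runs.assign (Q := fun τ => (∀ a, a ≠ 9 → τ a = τ₁ a) ∧ τ 9 0 = 1) b₁ 9 (by decide)
      (by decide) ?_ ?_) fun τ₂ b₂ ⟨h₂, v₂⟩ =>
    Runs.seq (Runs.for (T := 15) (N := 0) b₂ 28 (by decide) hnX (fun j τ =>
      (∀ a, a ≠ 9 → a ≠ 28 → τ a = τ₂ a) ∧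
      (∀ i ≤ j, τ 9 (i : ℤ) = (2 * I.boxRadius + 1) ^ i) ∧ τ 28 0 = j) ?_ ?_ ?_)
        fun τ₃ b₃ ⟨h₃, v₃, _⟩ =>
    Runs.mono (Runs.fill b₃ (by decide) (by decide) (by decide) hnX (fun _ => 1) ?_ ?_ ?_) le_rfl le_rfl ?_) ?_
      (by simp) fun _ _ h => h
  · simp only [Expr.eval, pow7, var, hmag]
    rw [abs_of_nonneg (by have := I.four_le_mag; positivity)]
    refine le_trans (le_of_eq ?_) hRX
    unfold IQP.boxRadius
    ring
  · simp only [Expr.eval, pow7, var, hmag]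
    refine ⟨fun a h => Store.write_of_ne _ h _ _, ?_⟩
    rw [Store.write_self]
    unfold IQP.boxRadius
    ring
  · simp only [Expr.eval, abs_one]
    omega
  · exact ⟨fun a h => Store.write_of_ne _ h _ _, Store.write_self _ _ _ _⟩
  · refine ⟨fun a _ h => Store.write_of_ne _ h _ _, fun i hi => ?_, by simp [Store.write_self]⟩
    obtain rfl : i = 0 := by omega
    rw [Store.write_of_ne _ (by decide)]
    simpa using v₂
  · rintro j τ - ⟨h, -, hj⟩
    refine ⟨hj, ?_⟩
    simp only [Expr.eval, nExpr]
    rw [h 0 (by decide) (by decide), h₂ 0 (by decide), h₁ 0 (by decide), hin.n]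
  · rintro j τ hj hτ ⟨h, hp, hj'⟩
    have e1 : (Expr.add (var 28) (.const 1)).eval τ = ((j + 1 : ℕ) : ℤ) := by
      simp only [Expr.eval, var, hj']
      push_cast
      rfl
    have e2 : (Expr.mul (.get 9 (var 28)) (.add (.mul (.const 2) (var 8)) (.const 1))).eval τ =
        (2 * I.boxRadius + 1) ^ (j + 1) := by
      simp only [Expr.eval, var, hj']
      rw [hp j le_rfl, h 8 (by decide) (by decide), h₂ 8 (by decide), v₁, pow_succ]
    refine (Runs.assign hτ 9 (by decide) (by decide) ?_ ?_).mono (by decide) le_rfl fun _ _ h => h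
    · rw [e2, abs_of_nonneg (by positivity)]
      exact (I.pow_le_lpBound (by omega)).trans hC.lpBound_le
    · rw [e1, e2]
      refine ⟨?_, fun a ha ha' => ?_, fun i hi => ?_, ?_⟩
      · rw [Store.write_of_ne _ (by decide), hj']
      · rw [Store.write_of_ne _ ha', Store.write_of_ne _ ha, h a ha ha']
      · rw [Store.write_of_ne _ (by decide)]
        rcases Nat.le_succ_iff.1 hi with h | rfl
        · rw [Store.write_self_of_ne _ _ (by norm_cast; omega), hp i h]
        · rw [Store.write_self]
      · rw [Store.write_self]
        push_cast
        rfl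
  · intro τ h
    simp only [Expr.eval, nExpr]
    rw [h 0 (by decide) (by decide), h₃ 0 (by decide) (by decide), h₂ 0 (by decide),
      h₁ 0 (by decide), hin.n]
  · intro j _ τ _ _
    rfl
  · intro j _
    rw [abs_one]
    omega
  · rintro τ - ⟨h, v⟩
    have key : ∀ a, a ≠ 8 → a ≠ 9 → a ≠ 10 → a ≠ 28 → τ a = σ a := fun a h8 h9 h10 h28 => by
      rw [h a h10 h28, h₃ a h9 h28, h₂ a h9, h₁ a h8]
    refine ⟨key, ⟨hin.congr fun a ha => key a (by omega) (by omega) (by omega) (by omega), ?_, ?_, ?_,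
      fun j => v j j.2⟩⟩
    · rw [key 7 (by decide) (by decide) (by decide) (by decide), hmag]
    · rw [h 8 (by decide) (by decide), h₃ 8 (by decide) (by decide), h₂ 8 (by decide), v₁]
    · rw [h 9 (by decide) (by decide)]
      exact v₃
  · simp only [Expr.time, nExpr, var, pow7]
    omega

/-! ### The number of parts in each direction -/

/-- Find the least `P` with `k < ε (P² - k)`. -/
def partsProg : Prog :=
  .loop (.leEps (.sub (.const 0) kExpr) (.sub kExpr (.mul (var 11) (var 11))))
    (.assign 11 (.const 0) (.add (var 11) (.const 1)))

/-- The loop test `-k ≤ ε (k - j²)` is the division-free negation of `k < ε (j² - k)`; by minimality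
of `P` it holds for `j < P` and fails at `P`. -/
theorem partsProg_spec {I : IQP} {C : Setting} {P : ℕ} (hPX : (P : ℤ) ≤ C.X)
    (hP : (I.k : ℝ) < C.ε * ((P : ℝ) * P - I.k))
    (hmin : ∀ j < P, C.ε * ((j : ℝ) * j - I.k) ≤ I.k) {σ : Store} (hσ : Bounded C.X σ)
    (hk : σ 0 2 = I.k) (h0 : σ 11 0 = 0) :
    Runs C partsProg σ (P * 19 + 13) 0 fun τ => (∀ a, a ≠ 11 → τ a = σ a) ∧ τ 11 0 = P := by
  refine (Runs.loop (T := 6) (N := 0) (M := P) (j := 0)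
    (Inv := fun j τ => (∀ a, a ≠ 11 → τ a = σ a) ∧ τ 11 0 = j) (by decide) hσ (Nat.zero_le _)
    ⟨fun _ _ => rfl, by simpa using h0⟩ ?_ ?_).mono (by simp [Test.time, Expr.time, kExpr, var])
    (by simp) fun _ _ h => h
  · rintro j τ hj hτ ⟨h, hv⟩
    constructor
    · simp only [Test.Holds, Expr.eval, var, kExpr, h 0 (by decide), hk, hv]
      have := hmin j hj
      push_cast
      linarith
    · have e : (Expr.add (var 11) (.const 1)).eval τ = ((j + 1 : ℕ) : ℤ) := by
        simp only [Expr.eval, var, hv]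
        push_cast
        rfl
      refine Runs.assign hτ 11 (by decide) (by decide) ?_ ?_
      · rw [e, abs_of_nonneg (by omega)]
        omega
      · rw [e]
        exact ⟨fun a ha => by rw [Store.write_of_ne _ ha, h a ha], Store.write_self _ _ _ _⟩
  · rintro τ ⟨h, hv⟩
    simp only [Test.Holds, Expr.eval, var, kExpr, h 0 (by decide), hk, hv]
    push_cast
    linarith

/-! ### Solving a linear program -/

def solverCall : Call where
  nv := nExpr
  nc := mExpr
  matA := 1
  vecb := 2
  vecc := 21
  loFlag := 10
  loVal := 22
  hiFlag := 10
  hiVal := 23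
  status := 24
  num := 25
  den := 26

/-- The types of the data depend on the evaluated dimensions; with variables `n` and `m` the
dimensions can be rewritten. -/
theorem Call.lp_eq {κ : Call} {σ : Store} {n m : ℕ} (hn : κ.nv.eval σ = n) (hm : κ.nc.eval σ = m) :
    κ.lp σ = ⟨n, m, fun i j => σ κ.matA ((i : ℕ) * (n : ℤ) + (j : ℕ)), fun i => σ κ.vecb (i : ℕ),
      fun j => σ κ.vecc (j : ℕ),
      fun j => if σ κ.loFlag (j : ℕ) = 0 then none else some (σ κ.loVal (j : ℕ)),
      fun j => if σ κ.hiFlag (j : ℕ) = 0 then none else some (σ κ.hiVal (j : ℕ))⟩ := by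
  unfold Call.lp
  rw [hn, hm]
  rfl

theorem LP.mk_congr {n m : ℕ} {A A' : Matrix (Fin m) (Fin n) ℤ} {b b' : Fin m → ℤ}
    {c c' : Fin n → ℤ} {lo lo' hi hi' : Fin n → Option ℤ} (hA : A = A') (hb : b = b') (hc : c = c')
    (hlo : lo = lo') (hhi : hi = hi') :
    LP.mk n m A b c lo hi = LP.mk n m A' b' c' lo' hi' := by
  rw [hA, hb, hc, hlo, hhi]

theorem solverCall_lp_eq {I : IQP} {σ : Store} (hI : Initialized I σ) {c lo hi : Fin I.n → ℤ}
    (hc : ∀ j : Fin I.n, σ 21 (j : ℕ) = c j) (hlo : ∀ j : Fin I.n, σ 22 (j : ℕ) = lo j)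
    (hhi : ∀ j : Fin I.n, σ 23 (j : ℕ) = hi j) :
    solverCall.lp σ = boxLP I.W I.w c lo hi := by
  rw [Call.lp_eq (κ := solverCall) (n := I.n) (m := I.m) hI.n hI.m]
  refine LP.mk_congr ?_ (funext hI.w) (funext hc) ?_ ?_
  · ext i j
    exact hI.W i j
  · funext j
    simp [solverCall, hI.flag, hlo]
  · funext j
    simp [solverCall, hI.flag, hhi]

theorem Store.writeVec_of_ne (σ : Store) {a a' : ℕ} (h : a' ≠ a) {N : ℕ} (v : Fin N → ℤ) :
    σ.writeVec a v a' = σ a' := by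
  funext i
  simp [Store.writeVec, h]

theorem Store.writeVec_self (σ : Store) (a : ℕ) {N : ℕ} (v : Fin N → ℤ) (j : Fin N) :
    σ.writeVec a v a (j : ℕ) = v j := by
  simp [Store.writeVec]

theorem Bounded.writeVec {X : ℤ} {σ : Store} (h : Bounded X σ) {N : ℕ} {v : Fin N → ℤ}
    (hv : ∀ j, |v j| ≤ X) (a : ℕ) : Bounded X (σ.writeVec a v) := by
  intro a' i'
  unfold Store.writeVec
  split_ifs
  · exact hv _
  · exact h a' i'

/-- The answer is integral by `perturbed_answer`, so all denominators are `1` and the numerators in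
array 25 are the solution. The memory holds the perturbed objective, while the conclusion is about
the original `c`. -/
theorem solve_spec {I : IQP} {C : Setting} (hC : Fits I C) {σ : Store} (hσ : Bounded C.X σ)
    (hI : Initialized I σ) {c lo hi : Fin I.n → ℤ}
    (hc : ∀ j : Fin I.n, σ 21 (j : ℕ) = perturbed I.boxRadius c j)
    (hlo : ∀ j : Fin I.n, σ 22 (j : ℕ) = lo j) (hhi : ∀ j : Fin I.n, σ 23 (j : ℕ) = hi j)
    (hcb : ∀ j, |c j| ≤ I.mag ^ 19) (hlob : ∀ j, |lo j| ≤ I.boxRadius)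
    (hhib : ∀ j, |hi j| ≤ I.boxRadius) :
    Runs C (.solve solverCall) σ 5 1 fun τ =>
      (∀ a, a ≠ 24 → a ≠ 25 → a ≠ 26 → τ a = σ a) ∧
      ((τ 24 0 = 0 ∧ ∀ y, ¬ IntFeasible I.W I.w lo hi y) ∨
        (τ 24 0 = 2 ∧ ∃ z, IntFeasible I.W I.w lo hi z ∧
          (∀ y, IntFeasible I.W I.w lo hi y → c ⬝ᵥ z ≤ c ⬝ᵥ y) ∧
          ∀ j : Fin I.n, τ 25 (j : ℕ) = z j)) := by
  have hX := C.two_le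
  have hRX := I.boxRadius_le_lpBound.trans hC.lpBound_le
  have hlp := solverCall_lp_eq hI hc hlo hhi
  have hexec := Exec.solve (S := C.S) (ε := C.ε) solverCall σ
  rw [hlp] at hexec
  refine ⟨_, _, hexec, le_rfl, ?_, le_rfl, ?_, ?_⟩
  · exact max_le (Expr.bits_le hX hσ _ (by decide)) (Expr.bits_le hX hσ _ (by decide))
  · intro L hL
    obtain rfl := List.mem_singleton.1 hL
    rw [hC.good]
    exact ⟨_, lo, hi, rfl, fun j => ⟨I.abs_perturbed_le (hcb j),
      (hlob j).trans I.boxRadius_le_lpBound, (hhib j).trans I.boxRadius_le_lpBound⟩⟩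
  · rcases perturbed_answer hC.tu I.boxRadius_pos.le (fun j => (abs_le.1 (hlob j)).1)
      (fun j => (abs_le.1 (hhib j)).2) (C.S (boxLP I.W I.w (perturbed I.boxRadius c) lo hi))
      (hC.correct _) with ⟨ha, hinf⟩ | ⟨z, ha, hz, hmin⟩
    · rw [ha]
      refine ⟨hσ.write (by simp; omega) _ _, fun a h _ _ => Store.write_of_ne _ h _ _, Or.inl ⟨?_, hinf⟩⟩
      exact Store.write_self _ _ _ _
    · have key : σ.writeAnswer solverCall
          (C.S (boxLP I.W I.w (perturbed I.boxRadius c) lo hi)) =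
          ((σ.writeVec 25 z).writeVec 26 fun _ : Fin I.n => 1).write 24 0 2 := by
        rw [ha]
        rfl
      rw [key]
      refine ⟨((hσ.writeVec (fun j => ?_) _).writeVec (fun j => ?_) _).write ?_ _ _,
        fun a h1 h2 h3 => ?_, Or.inr ⟨?_, z, hz, hmin, fun j => ?_⟩⟩
      · have h1 := hz.2.1 j
        have h2 := hz.2.2 j
        have h3 := (abs_le.1 (hlob j)).1
        have h4 := (abs_le.1 (hhib j)).2
        exact (abs_le.2 ⟨by linarith, by linarith⟩).trans hRX
      · rw [abs_one]
        omega
      · rw [abs_of_nonneg (by norm_num)]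
        exact hX
      · rw [Store.write_of_ne _ h1, Store.writeVec_of_ne _ h3, Store.writeVec_of_ne _ h2]
      · exact Store.write_self _ _ _ _
      · rw [Store.write_of_ne _ (by decide), Store.writeVec_of_ne _ (by decide),
          Store.writeVec_self]

/-- Write an objective and the bounds of the box. -/
def setupProg (e : Expr) : Prog :=
  .seq (forProg 28 nExpr (.assign 21 (var 28) e)) <|
  .seq (forProg 28 nExpr (.assign 22 (var 28) (.sub (.const 0) (var 8))))
    (forProg 28 nExpr (.assign 23 (var 28) (var 8)))

theorem setupProg_spec {I : IQP} {C : Setting} (hC : Fits I C) {σ : Store} (hσ : Bounded C.X σ)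
    (hI : Initialized I σ) {e : Expr} (he : e.weight ≤ 64) (het : e.time ≤ 12) (f : ℕ → ℤ)
    (hee : ∀ j < I.n, ∀ τ : Store, (∀ a', a' ≠ 21 → a' ≠ 28 → τ a' = σ a') → τ 28 0 = j →
      e.eval τ = f j)
    (hf : ∀ j < I.n, |f j| ≤ C.X) :
    Runs C (setupProg e) σ (70 * (I.n + 1)) 0 fun τ =>
      (∀ a, a ≠ 21 → a ≠ 22 → a ≠ 23 → a ≠ 28 → τ a = σ a) ∧
      ∀ j < I.n, τ 21 (j : ℤ) = f j ∧ τ 22 (j : ℤ) = -I.boxRadius ∧ τ 23 (j : ℤ) = I.boxRadius := by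
  have hRX := I.boxRadius_le_lpBound.trans hC.lpBound_le
  have hR := I.boxRadius_pos
  have hnX : (I.n : ℤ) ≤ C.X := I.n_le_lpBound.trans hC.lpBound_le
  refine Runs.mono (P := setupProg e) (N := 0 + (0 + 0))
    (Runs.seq (Runs.fill hσ (by decide) (by decide) he hnX f ?_ hee hf)
      fun τ₁ b₁ ⟨h₁, v₁⟩ =>
    Runs.seq (Runs.fill b₁ (by decide) (by decide) (by decide) hnX (fun _ => -I.boxRadius) ?_ ?_ ?_)
      fun τ₂ b₂ ⟨h₂, v₂⟩ =>
    Runs.mono (Runs.fill b₂ (by decide) (by decide) (by decide) hnX (fun _ => I.boxRadius) ?_ ?_ ?_)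
      le_rfl le_rfl ?_) ?_ le_rfl fun _ _ h => h
  · intro τ h
    simp only [Expr.eval, nExpr]
    rw [h 0 (by decide) (by decide), hI.n]
  · intro τ h
    simp only [Expr.eval, nExpr]
    rw [h 0 (by decide) (by decide), h₁ 0 (by decide) (by decide), hI.n]
  · intro j _ τ h _
    simp only [Expr.eval, var]
    rw [h 8 (by decide) (by decide), h₁ 8 (by decide) (by decide), hI.radius]
    ring
  · intro j _
    rw [abs_neg, abs_of_pos hR]
    exact hRX
  · intro τ h
    simp only [Expr.eval, nExpr]
    rw [h 0 (by decide) (by decide), h₂ 0 (by decide) (by decide), h₁ 0 (by decide) (by decide),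
      hI.n]
  · intro j _ τ h _
    simp only [Expr.eval, var]
    rw [h 8 (by decide) (by decide), h₂ 8 (by decide) (by decide), h₁ 8 (by decide) (by decide),
      hI.radius]
  · intro j _
    rw [abs_of_pos hR]
    exact hRX
  · rintro τ - ⟨h₃, v₃⟩
    refine ⟨fun a h21 h22 h23 h28 => ?_, fun j hj => ⟨?_, ?_, v₃ j hj⟩⟩
    · rw [h₃ a h23 h28, h₂ a h22 h28, h₁ a h21 h28]
    · rw [h₃ 21 (by decide) (by decide), h₂ 21 (by decide) (by decide), v₁ j hj]
    · rw [h₃ 22 (by decide) (by decide), v₂ j hj]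
  · simp only [Expr.time, nExpr, var]
    have : I.n * (1 + 1 + 5 + (e.time + 3 + 6)) ≤ I.n * 28 := Nat.mul_le_mul_left _ (by omega)
    omega

/-! ### The ranges of the nonlinear variables -/

/-- The ends of the computed intervals are small. -/
def SmallIntervals (I : IQP) (l u : ℤ → ℤ) : Prop :=
  ∀ i : ℕ, -I.mag ≤ l i ∧ l i ≤ u i ∧ u i ≤ I.mag

theorem IQP.infeasible_of_not_inBox {I : IQP} (hW : I.W.IsTotallyUnimodular)
    (h : ∀ y : Fin I.n → ℤ, ¬ IQP.InBox y) : I.Infeasible := by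
  intro x hx
  obtain ⟨v, hv, -⟩ := IQP.exists_small_feasible hW hx 0 fun _ _ _ => by simp
  exact h v hv

/-- The `i`-th entry of the point found by the solver. -/
def pointExpr : Expr := .get 25 (var 18)

/-- The factor of the original objective in the objectives of the linear programs. -/
def factorExpr : Expr := .get 9 nExpr

/-- Write the objective `x_i` and the bounds of the box. -/
def costProg : Prog :=
  .seq (setupProg (.get 9 (var 28)))
    (.assign 21 (var 18) (.add (.get 21 (var 18)) factorExpr))

/-- Use the minimum of `x_i` over the box. -/
def lowerProg : Prog :=
  .seq costProg <|
  .seq (.solve solverCall)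
    (.cond (.le (.const 2) (var 24))
      (.cond (.le (.const 0) (.mul (.add pointExpr (var 7)) (.sub (var 7) pointExpr)))
        (.seq (.assign 12 (var 18) pointExpr) (.assign 13 (var 18) pointExpr))
        (.assign 14 (.const 0) (.const 1)))
      .skip)

/-- Use the maximum of `x_i` over the box. -/
def upperProg : Prog :=
  .seq (.assign 21 (var 18) (.sub (.get 21 (var 18)) (.add factorExpr factorExpr))) <|
  .seq (.solve solverCall)
    (.cond (.le (.const 2) (var 24))
      (.cond (.le (.const 0) (.mul (.sub pointExpr (.get 12 (var 18))) (.sub (var 7) pointExpr)))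
        (.assign 13 (var 18) pointExpr)
        (.assign 14 (.const 0) (.const 1)))
      .skip)

/-- The memory after the minimum of `x_i` has been used. -/
structure LowerDone (I : IQP) (σ : Store) (i : Fin I.k) (τ : Store) : Prop where
  frame : ∀ a < 12, τ a = σ a
  counter : τ 18 0 = (i : ℕ)
  cost : ∀ j : Fin I.n, τ 21 (j : ℕ) = perturbed I.boxRadius (Pi.single (Fin.castLE I.hk i) 1) j
  lo : ∀ j : Fin I.n, τ 22 (j : ℕ) = -I.boxRadius
  hi : ∀ j : Fin I.n, τ 23 (j : ℕ) = I.boxRadius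
  small : SmallIntervals I (τ 12) (τ 13)
  ranges : (τ 14 0 = 1 ∧ I.Unbounded) ∨ (τ 14 0 = 0 ∧
    (∀ i' : Fin I.k, (i' : ℕ) < i → IQP.IsRange i' (τ 12 (i' : ℕ)) (τ 13 (i' : ℕ))) ∧
    (∀ x, I.Feasible x → τ 12 (i : ℕ) ≤ x (Fin.castLE I.hk i)) ∧
    ((∃ x, I.Feasible x) → ∃ a, I.Feasible a ∧ a (Fin.castLE I.hk i) = τ 12 (i : ℕ)))

/-- The memory after `i` ranges have been computed. -/
structure RangesDone (I : IQP) (σ : Store) (i : ℕ) (τ : Store) : Prop where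
  frame : ∀ a < 12, τ a = σ a
  counter : τ 18 0 = i
  small : SmallIntervals I (τ 12) (τ 13)
  ranges : (τ 14 0 = 1 ∧ I.Unbounded) ∨ (τ 14 0 = 0 ∧
    ∀ i' : Fin I.k, (i' : ℕ) < i → IQP.IsRange i' (τ 12 (i' : ℕ)) (τ 13 (i' : ℕ)))

theorem costProg_spec {I : IQP} {C : Setting} (hC : Fits I C) {σ : Store} (hσ : Bounded C.X σ)
    (hI : Initialized I σ) {p : Fin I.n} (hp : σ 18 0 = (p : ℕ)) :
    Runs C costProg σ (70 * (I.n + 1) + 15) 0 fun τ =>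
      (∀ a, a ≠ 21 → a ≠ 22 → a ≠ 23 → a ≠ 28 → τ a = σ a) ∧
      (∀ j : Fin I.n, τ 21 (j : ℕ) = perturbed I.boxRadius (Pi.single p 1) j) ∧
      (∀ j : Fin I.n, τ 22 (j : ℕ) = -I.boxRadius) ∧
      ∀ j : Fin I.n, τ 23 (j : ℕ) = I.boxRadius := by
  refine Runs.bind (setupProg_spec hC hσ hI (by decide) (by decide)
    (fun j => (2 * I.boxRadius + 1) ^ j) (fun j hj τ h hj' => ?_) fun j hj => ?_)
    (by omega) le_rfl fun τ₁ b₁ ⟨h₁, v₁⟩ => ?_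
  · simp only [Expr.eval, var, hj', h 9 (by decide) (by decide)]
    exact hI.pow j hj.le
  · have := I.one_le_pow j
    rw [abs_of_nonneg (by omega)]
    exact (I.pow_le_lpBound hj.le).trans hC.lpBound_le
  have e18 : τ₁ 18 0 = (p : ℕ) := by
    rw [h₁ 18 (by decide) (by decide) (by decide) (by decide), hp]
  refine Runs.assign_of_le b₁ 21 (by decide) (by decide)
    (by simp only [Expr.time, var, factorExpr, nExpr]; omega) (u := (p : ℕ))
    (v := perturbed I.boxRadius (Pi.single p 1) p) e18 ?_ ?_ ?_
  · simp only [Expr.eval, var, factorExpr, nExpr, e18]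
    rw [(v₁ p p.2).1, h₁ 0 (by decide) (by decide) (by decide) (by decide), hI.n,
      h₁ 9 (by decide) (by decide) (by decide) (by decide), hI.pow I.n le_rfl]
    simp [perturbed]
  · refine (I.abs_perturbed_le ?_).trans hC.lpBound_le
    have := I.mag_pow_pos 19
    rw [Pi.single_eq_same, abs_one]
    omega
  · refine ⟨fun a h21 h22 h23 h28 => ?_, fun j => ?_, fun j => ?_, fun j => ?_⟩
    · rw [Store.write_of_ne _ h21, h₁ a h21 h22 h23 h28]
    · by_cases hj : j = p
      · rw [hj, Store.write_self]
      · rw [Store.write_self_of_ne _ _ (by exact_mod_cast fun h => hj (Fin.ext h)), (v₁ j j.2).1]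
        simp [perturbed, hj]
    · rw [Store.write_of_ne _ (by decide), (v₁ j j.2).2.1]
    · rw [Store.write_of_ne _ (by decide), (v₁ j j.2).2.2]

theorem abs_single_le {I : IQP} (p : Fin I.n) {s : ℤ} (hs : |s| = 1) (j : Fin I.n) :
    |(Pi.single p s : Fin I.n → ℤ) j| ≤ I.mag ^ 19 := by
  have := I.mag_pow_pos 19
  by_cases hj : j = p
  · rw [hj, Pi.single_eq_same]
    omega
  · rw [Pi.single_eq_of_ne hj, abs_zero]
    omega

theorem lowerProg_spec {I : IQP} {C : Setting} (hC : Fits I C) {σ₀ σ : Store} (hσ : Bounded C.X σ)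
    (h₀ : Initialized I σ₀) (i : Fin I.k) (hI : RangesDone I σ₀ i σ) :
    Runs C lowerProg σ (70 * (I.n + 1) + 70) 1 (LowerDone I σ₀ i) := by
  have hX := C.two_le
  have hσI : Initialized I σ := h₀.congr fun a ha _ _ => hI.frame a (by omega)
  set p := Fin.castLE I.hk i with hp
  have hA := I.four_le_mag
  have hAX := I.mag_le_lpBound.trans hC.lpBound_le
  have hlt : ∀ i' : ℕ, i' < i → ((i' : ℕ) : ℤ) ≠ ((i : ℕ) : ℤ) := fun i' h => by
    exact_mod_cast h.ne
  refine Runs.bind (costProg_spec hC hσ hσI (p := p) hI.counter) (by omega) (Nat.zero_le _)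
    fun τ₂ b₂ ⟨h₂, vc, vl, vh⟩ => ?_
  refine Runs.bind (solve_spec hC b₂ (hσI.congr fun a ha _ _ => h₂ a (by omega) (by omega)
    (by omega) (by omega)) vc vl vh (abs_single_le p abs_one)
    (fun _ => by rw [abs_neg, abs_of_pos I.boxRadius_pos])
    fun _ => by rw [abs_of_pos I.boxRadius_pos]) (by omega) le_rfl fun τ₃ b₃ ⟨h₃, v₃⟩ => ?_
  have hfr3 : ∀ a, a < 21 → τ₃ a = σ a := fun a ha => by
    rw [h₃ a (by omega) (by omega) (by omega), h₂ a (by omega) (by omega) (by omega) (by omega)]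
  have f12 := hfr3 12 (by decide)
  have f13 := hfr3 13 (by decide)
  have f14 := hfr3 14 (by decide)
  have f18 : τ₃ 18 0 = (i : ℕ) := by rw [hfr3 18 (by decide), hI.counter]
  have f7 : τ₃ 7 0 = I.mag := by rw [hfr3 7 (by decide), hσI.mag]
  have build : ∀ τ : Store, (∀ a, a ≠ 12 → a ≠ 13 → a ≠ 14 → τ a = τ₃ a) →
      SmallIntervals I (τ 12) (τ 13) → ((τ 14 0 = 1 ∧ I.Unbounded) ∨ (τ 14 0 = 0 ∧
        (∀ i' : Fin I.k, (i' : ℕ) < i → IQP.IsRange i' (τ 12 (i' : ℕ)) (τ 13 (i' : ℕ))) ∧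
        (∀ x, I.Feasible x → τ 12 (i : ℕ) ≤ x p) ∧
        ((∃ x, I.Feasible x) → ∃ a, I.Feasible a ∧ a p = τ 12 (i : ℕ)))) →
      LowerDone I σ₀ i τ := by
    intro τ h hs hr
    refine ⟨fun a ha => ?_, ?_, fun j => ?_, fun j => ?_, fun j => ?_, hs, hr⟩
    · rw [h a (by omega) (by omega) (by omega), hfr3 a (by omega), hI.frame a ha]
    · rw [h 18 (by decide) (by decide) (by decide), f18]
    · rw [h 21 (by decide) (by decide) (by decide), h₃ 21 (by decide) (by decide) (by decide), vc]
    · rw [h 22 (by decide) (by decide) (by decide), h₃ 22 (by decide) (by decide) (by decide), vl]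
    · rw [h 23 (by decide) (by decide) (by decide), h₃ 23 (by decide) (by decide) (by decide), vh]
  have htime : 70 * (I.n + 1) + 70 - (70 * (I.n + 1) + 15) - 5 = 50 := by omega
  rw [htime]
  refine Runs.cond_of_le b₃ (by decide) (by decide) (fun ht => ?_) fun ht => ?_
  · simp only [Test.Holds, Expr.eval, var] at ht
    rcases v₃ with ⟨hs, -⟩ | ⟨-, z, hz, hmin, hnum⟩
    · omega
    have hmin' : ∀ y, IQP.InBox y → 1 * z p ≤ 1 * y p := fun y hy => by
      simpa using hmin y hy
    obtain ⟨hle, hlow, hunb⟩ := IQP.side_of_box_min hC.tu i (Or.inl rfl) hz hmin'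
    simp only [one_mul, ← hp] at hle hlow hunb
    have ex : ∀ τ : Store, τ 25 = τ₃ 25 → τ 18 = τ₃ 18 → pointExpr.eval τ = z p := by
      intro τ h25 h18
      simp only [pointExpr, Expr.eval, var, h25, h18, f18]
      exact hnum p
    refine Runs.cond_of_le b₃ (by decide) (by decide) (fun ht' => ?_) fun ht' => ?_
    · simp only [Test.Holds, Expr.eval, ex τ₃ rfl rfl, var, f7] at ht'
      have hzA : -I.mag ≤ z p := by
        by_contra hcon
        nlinarith
      have habs : |z p| ≤ C.X := (abs_le.2 ⟨hzA, hle⟩).trans hAX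
      -- The upper end is provisionally set to the minimum too, so that `l ≤ u` holds at every
      -- stage.
      refine Runs.bind (Q := fun τ => τ = τ₃.write 12 (i : ℕ) (z p)) (T := 6) (N := 0)
        (Runs.assign_of_le b₃ 12 (by decide) (by decide) (by decide) f18 (ex τ₃ rfl rfl) habs rfl)
        (by decide) (by decide) fun τ₄ b₄ h₄ => ?_
      refine Runs.assign_of_le b₄ 13 (by decide) (by decide) (by decide) (u := (i : ℕ)) ?_
        (ex τ₄ ?_ ?_) habs ?_
      · rw [h₄]
        simp only [Expr.eval, var]
        rw [Store.write_of_ne _ (by decide), f18]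
      · rw [h₄, Store.write_of_ne _ (by decide)]
      · rw [h₄, Store.write_of_ne _ (by decide)]
      · rw [h₄]
        refine build _ (fun a ha hb _ => ?_) (fun i' => ?_) ?_
        · rw [Store.write_of_ne _ hb, Store.write_of_ne _ ha]
        · rw [Store.write_of_ne _ (by decide)]
          by_cases hi' : ((i' : ℕ) : ℤ) = ((i : ℕ) : ℤ)
          · rw [hi', Store.write_self, Store.write_self]
            exact ⟨hzA, le_rfl, hle⟩
          · rw [Store.write_self_of_ne _ _ hi', Store.write_self_of_ne _ _ hi',
              Store.write_of_ne _ (by decide), f12, f13]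
            exact hI.small i'
        · rw [Store.write_of_ne _ (by decide), Store.write_of_ne _ (by decide),
            Store.write_of_ne _ (by decide), f14, Store.write_self]
          rcases hI.ranges with h | ⟨h, hr⟩
          · exact Or.inl h
          · refine Or.inr ⟨h, fun i' hi' => ?_, hlow hzA, fun _ => ⟨z, hz.1, rfl⟩⟩
            rw [Store.write_self_of_ne _ _ (hlt i' hi'), Store.write_self_of_ne _ _ (hlt i' hi'),
              Store.write_of_ne _ (by decide), f12, f13]
            exact hr i' hi'
    · simp only [Test.Holds, Expr.eval, ex τ₃ rfl rfl, var, f7] at ht'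
      have hzA : z p < -I.mag := by
        by_contra hcon
        exact ht' (mul_nonneg (by omega) (by omega))
      refine Runs.assign_of_le b₃ 14 (by decide) (by decide) (by decide) (u := 0) (v := 1) rfl rfl
        (by rw [abs_one]; omega) ?_
      refine build _ (fun a _ _ hc => Store.write_of_ne _ hc _ _) ?_ (Or.inl ⟨?_, hunb hzA⟩)
      · rw [Store.write_of_ne _ (by decide), Store.write_of_ne _ (by decide), f12, f13]
        exact hI.small
      · exact Store.write_self _ _ _ _
  · simp only [Test.Holds, Expr.eval, var] at ht
    rcases v₃ with ⟨-, hinf⟩ | ⟨hs, -⟩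
    swap
    · omega
    have hinf' := IQP.infeasible_of_not_inBox hC.tu hinf
    refine Runs.skip_of_le b₃ (by decide) (build _ (fun _ _ _ _ => rfl) ?_ ?_)
    · rw [f12, f13]
      exact hI.small
    · rw [f12, f13, f14]
      rcases hI.ranges with h | ⟨h, hr⟩
      · exact Or.inl h
      · exact Or.inr ⟨h, hr, fun x hx => absurd hx (hinf' x), fun ⟨x, hx⟩ => absurd hx (hinf' x)⟩

/-- Subtracting `2 D ^ n` from one coefficient turns the objective `x_i` into `-x_i`. Given `l ≤ A`,
the sign of the product tests `l ≤ z_i ≤ A`. If unboundedness has been detected earlier, `l` may be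
a meaningless default and `l ≤ z_i` may fail; the interval is then left alone. -/
theorem upperProg_spec {I : IQP} {C : Setting} (hC : Fits I C) {σ₀ σ : Store} (hσ : Bounded C.X σ)
    (h₀ : Initialized I σ₀) (i : Fin I.k) (hI : LowerDone I σ₀ i σ) :
    Runs C upperProg σ 70 1 fun τ =>
      τ 18 0 = (i : ℕ) ∧ RangesDone I σ₀ (i + 1) (τ.write 18 0 ((i : ℕ) + 1)) := by
  have hX := C.two_le
  have hσI : Initialized I σ := h₀.congr fun a ha _ _ => hI.frame a (by omega)
  set p := Fin.castLE I.hk i with hp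
  have hA := I.four_le_mag
  have hAX := I.mag_le_lpBound.trans hC.lpBound_le
  have hlt : ∀ i' : Fin I.k, i' ≠ i → ((i' : ℕ) : ℤ) ≠ ((i : ℕ) : ℤ) := fun i' h => by
    exact_mod_cast fun h' => h (Fin.ext h')
  have hvp : (Expr.sub (.get 21 (var 18)) (.add factorExpr factorExpr)).eval σ =
      perturbed I.boxRadius (Pi.single p (-1)) p := by
    have h21 := hI.cost p
    simp only [p, Fin.val_castLE] at h21
    simp only [Expr.eval, var, factorExpr, nExpr, hI.counter, hσI.n]
    rw [h21, hσI.pow I.n le_rfl]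
    simp [perturbed, p]
    ring
  refine Runs.bind (T := 20) (N := 0) (Q := fun τ => (∀ a, a ≠ 21 → τ a = σ a) ∧
      ∀ j : Fin I.n, τ 21 (j : ℕ) = perturbed I.boxRadius (Pi.single p (-1)) j)
    (Runs.assign_of_le hσ 21 (by decide) (by decide) (by decide) (u := (p : ℕ)) hI.counter hvp
      ((I.abs_perturbed_le (abs_single_le p (by norm_num) p)).trans hC.lpBound_le)
      ⟨fun a ha => Store.write_of_ne _ ha _ _, fun j => ?_⟩) (by decide) (by decide)
    fun τ₂ b₂ ⟨h₂, vc⟩ => ?_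
  · by_cases hj : j = p
    · rw [hj, Store.write_self]
    · rw [Store.write_self_of_ne _ _ (by exact_mod_cast fun h => hj (Fin.ext h)), hI.cost]
      simp [perturbed, hj, ← hp]
  refine Runs.bind (solve_spec hC b₂ (hσI.congr fun a ha _ _ => h₂ a (by omega)) vc
    (lo := fun _ => -I.boxRadius) (hi := fun _ => I.boxRadius)
    (fun j => by rw [h₂ 22 (by decide), hI.lo]) (fun j => by rw [h₂ 23 (by decide), hI.hi])
    (abs_single_le p (by norm_num))
    (fun _ => by rw [abs_neg, abs_of_pos I.boxRadius_pos])
    fun _ => by rw [abs_of_pos I.boxRadius_pos]) (by decide) (by decide) fun τ₃ b₃ ⟨h₃, v₃⟩ => ?_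
  have hfr3 : ∀ a, a < 21 → τ₃ a = σ a := fun a ha => by
    rw [h₃ a (by omega) (by omega) (by omega), h₂ a (by omega)]
  have f12 := hfr3 12 (by decide)
  have f13 := hfr3 13 (by decide)
  have f14 := hfr3 14 (by decide)
  have f18 : τ₃ 18 0 = (i : ℕ) := by rw [hfr3 18 (by decide), hI.counter]
  have f7 : τ₃ 7 0 = I.mag := by rw [hfr3 7 (by decide), hσI.mag]
  have build : ∀ τ : Store, (∀ a, a ≠ 13 → a ≠ 14 → τ a = τ₃ a) →
      SmallIntervals I (τ 12) (τ 13) → ((τ 14 0 = 1 ∧ I.Unbounded) ∨ (τ 14 0 = 0 ∧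
        ∀ i' : Fin I.k, (i' : ℕ) < i + 1 →
          IQP.IsRange i' (τ 12 (i' : ℕ)) (τ 13 (i' : ℕ)))) →
      τ 18 0 = (i : ℕ) ∧ RangesDone I σ₀ (i + 1) (τ.write 18 0 ((i : ℕ) + 1)) := by
    intro τ h hs hr
    refine ⟨by rw [h 18 (by decide) (by decide), f18], fun a ha => ?_, ?_, ?_, ?_⟩
    · rw [Store.write_of_ne _ (by omega), h a (by omega) (by omega), hfr3 a (by omega),
        hI.frame a ha]
    · rw [Store.write_self]
      push_cast
      rfl
    · rw [Store.write_of_ne _ (by decide), Store.write_of_ne _ (by decide)]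
      exact hs
    · rw [Store.write_of_ne _ (by decide), Store.write_of_ne _ (by decide),
        Store.write_of_ne _ (by decide)]
      exact hr
  have hcases : ∀ i' : Fin I.k, (i' : ℕ) < i + 1 → i' ≠ i → (i' : ℕ) < i := fun i' h hne =>
    (Nat.lt_succ_iff_lt_or_eq.1 h).resolve_right fun h' => hne (Fin.ext h')
  have hl := (hI.small i).1
  have hlA : σ 12 ((i : ℕ) : ℤ) ≤ I.mag := (hI.small i).2.1.trans (hI.small i).2.2
  refine Runs.cond_of_le b₃ (by decide) (by decide) (fun ht => ?_) fun ht => ?_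
  · simp only [Test.Holds, Expr.eval, var] at ht
    rcases v₃ with ⟨hs, -⟩ | ⟨-, z, hz, hmin, hnum⟩
    · omega
    have hmin' : ∀ y, IQP.InBox y → -1 * z p ≤ -1 * y p := fun y hy => by
      simpa using hmin y hy
    obtain ⟨hle, hlow, hunb⟩ := IQP.side_of_box_min hC.tu i (Or.inr rfl) hz hmin'
    simp only [← hp] at hle hlow hunb
    have ex : pointExpr.eval τ₃ = z p := by
      simp only [pointExpr, Expr.eval, var, f18]
      exact hnum p
    refine Runs.cond_of_le b₃ (by decide) (by decide) (fun ht' => ?_) fun ht' => ?_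
    · simp only [Test.Holds, Expr.eval, ex, var, f7, f18, f12] at ht'
      have hzA : z p ≤ I.mag := by
        by_contra hcon
        nlinarith
      have hlz : σ 12 ((i : ℕ) : ℤ) ≤ z p := by
        by_contra hcon
        nlinarith
      refine Runs.assign_of_le b₃ 13 (by decide) (by decide) (by decide) f18 ex
        ((abs_le.2 ⟨by omega, hzA⟩).trans hAX) ?_
      refine build _ (fun a ha _ => Store.write_of_ne _ ha _ _) (fun i' => ?_) ?_
      · rw [Store.write_of_ne _ (by decide), f12]
        by_cases hi' : ((i' : ℕ) : ℤ) = ((i : ℕ) : ℤ)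
        · rw [hi', Store.write_self]
          exact ⟨hl, hlz, hzA⟩
        · rw [Store.write_self_of_ne _ _ hi', f13]
          exact hI.small i'
      · rw [Store.write_of_ne _ (by decide), Store.write_of_ne _ (by decide), f12, f14]
        rcases hI.ranges with h | ⟨h, hr, hlow', hatt⟩
        · exact Or.inl h
        · refine Or.inr ⟨h, fun i' hi' => ?_⟩
          by_cases hii : i' = i
          · subst hii
            rw [Store.write_self]
            refine ⟨fun x hx => ⟨hlow' x hx, ?_⟩, fun hne => ⟨hatt hne, z, hz.1, rfl⟩⟩
            have := hlow (by omega) x hx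
            change x p ≤ z p
            omega
          · rw [Store.write_self_of_ne _ _ (hlt i' hii), f13]
            exact hr i' (hcases i' hi' hii)
    · simp only [Test.Holds, Expr.eval, ex, var, f7, f18, f12] at ht'
      refine Runs.assign_of_le b₃ 14 (by decide) (by decide) (by decide) (u := 0) (v := 1) rfl rfl
        (by rw [abs_one]; omega) ?_
      refine build _ (fun a _ hc => Store.write_of_ne _ hc _ _) ?_ (Or.inl ⟨?_, ?_⟩)
      · rw [Store.write_of_ne _ (by decide), Store.write_of_ne _ (by decide), f12, f13]
        exact hI.small
      · exact Store.write_self _ _ _ _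
      · rcases hI.ranges with h | ⟨h, hr, hlow', hatt⟩
        · exact h.2
        · have h1 := hlow' z hz.1
          refine hunb ?_
          by_contra hcon
          exact ht' (mul_nonneg (sub_nonneg.2 h1) (by omega))
  · simp only [Test.Holds, Expr.eval, var] at ht
    rcases v₃ with ⟨-, hinf⟩ | ⟨hs, -⟩
    swap
    · omega
    have hinf' := IQP.infeasible_of_not_inBox hC.tu hinf
    refine Runs.skip_of_le b₃ (by decide) (build _ (fun _ _ _ => rfl) ?_ ?_)
    · rw [f12, f13]
      exact hI.small
    · rw [f12, f13, f14]
      rcases hI.ranges with h | ⟨h, hr, -⟩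
      · exact Or.inl h
      · refine Or.inr ⟨h, fun i' hi' => ?_⟩
        by_cases hii : i' = i
        · exact ⟨fun x hx => absurd hx (hinf' x), fun ⟨x, hx⟩ => absurd hx (hinf' x)⟩
        · exact hr i' (hcases i' hi' hii)

/-- Compute the ranges of the nonlinear variables. -/
def rangesProg : Prog := forProg 18 kExpr (.seq lowerProg upperProg)

theorem rangesProg_spec {I : IQP} {C : Setting} (hC : Fits I C) {σ : Store} (hσ : Bounded C.X σ)
    (hI : Initialized I σ) (h12 : ∀ i, σ 12 i = 0) (h13 : ∀ i, σ 13 i = 0) (h14 : σ 14 0 = 0) :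
    Runs C rangesProg σ (I.k * (70 * (I.n + 1) + 160) + 10) (2 * I.k) (RangesDone I σ I.k) := by
  have hkX : (I.k : ℤ) ≤ C.X := I.k_le_mag.trans (I.mag_le_lpBound.trans hC.lpBound_le)
  have hA := I.four_le_mag
  refine (Runs.for (T := 70 * (I.n + 1) + 140) (N := 2) hσ 18 (by decide) hkX (RangesDone I σ)
    ⟨fun a ha => Store.write_of_ne _ (by omega) _ _, Store.write_self _ _ _ _, ?_, ?_⟩ ?_ ?_).mono
    ?_ (by omega) fun _ _ h => h
  · rw [Store.write_of_ne _ (by decide), Store.write_of_ne _ (by decide)]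
    intro i
    rw [h12, h13]
    omega
  · rw [Store.write_of_ne _ (by decide)]
    exact Or.inr ⟨h14, fun i hi => absurd hi (Nat.not_lt_zero _)⟩
  · intro j τ _ h
    refine ⟨h.counter, ?_⟩
    simp only [Expr.eval, kExpr]
    rw [h.frame 0 (by decide), hI.k]
  · intro j τ hj hτ h
    refine Runs.bind (lowerProg_spec hC hτ hI ⟨j, hj⟩ h) (by omega) (by decide) fun τ₁ b₁ h₁ => ?_
    exact (upperProg_spec hC b₁ hI ⟨j, hj⟩ h₁).mono (by omega) (by decide) fun _ _ h => h
  · simp only [Expr.time, kExpr]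
    have : I.k * (1 + 1 + 5 + (70 * (I.n + 1) + 140 + 6)) ≤ I.k * (70 * (I.n + 1) + 160) :=
      Nat.mul_le_mul_left _ (by omega)
    omega

/-! ### The number of cells. -/

/-- Compute the number of cells. -/
def countProg : Prog :=
  .seq (.assign 15 (.const 0) (.const 1))
    (forProg 18 kExpr (.assign 15 (.const 0) (.mul (var 15) (var 11))))

theorem countProg_spec {I : IQP} {C : Setting} (hkX : (I.k : ℤ) ≤ C.X) {P : ℕ}
    (hPX : ∀ j ≤ I.k, (P : ℤ) ^ j ≤ C.X) {σ : Store} (hσ : Bounded C.X σ) (hk : σ 0 2 = I.k)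
    (hP : σ 11 0 = P) :
    Runs C countProg σ (I.k * 30 + 20) 0 fun τ =>
      (∀ a, a ≠ 15 → a ≠ 18 → τ a = σ a) ∧ τ 15 0 = (P : ℤ) ^ I.k := by
  have hX := C.two_le
  refine Runs.bind (T := 3) (N := 0) (Q := fun τ => (∀ a, a ≠ 15 → τ a = σ a) ∧ τ 15 0 = 1)
    (Runs.assign_of_le hσ 15 (by decide) (by decide) (by decide) (u := 0) (v := 1) rfl rfl
      (by rw [abs_one]; omega) ⟨fun a ha => Store.write_of_ne _ ha _ _, Store.write_self _ _ _ _⟩)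
    (by omega) le_rfl fun τ₁ b₁ ⟨h₁, v₁⟩ => ?_
  refine (Runs.for (T := 7) (N := 0) b₁ 18 (by decide) hkX (fun j τ =>
    (∀ a, a ≠ 15 → a ≠ 18 → τ a = σ a) ∧ τ 15 0 = (P : ℤ) ^ j ∧ τ 18 0 = j) ?_ ?_ ?_).mono
    ?_ (by omega) fun _ _ h => ⟨h.1, h.2.1⟩
  · refine ⟨fun a h15 h18 => ?_, ?_, Store.write_self _ _ _ _⟩
    · rw [Store.write_of_ne _ h18, h₁ a h15]
    · rw [Store.write_of_ne _ (by decide), v₁, pow_zero]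
  · rintro j τ - ⟨h, -, hj⟩
    refine ⟨hj, ?_⟩
    simp only [Expr.eval, kExpr]
    rw [h 0 (by decide) (by decide), hk]
  · rintro j τ hj hτ ⟨h, hv, hj'⟩
    refine Runs.assign_of_le hτ 15 (by decide) (by decide) (by decide) (u := 0)
      (v := (P : ℤ) ^ (j + 1)) rfl ?_ ?_ ⟨?_, fun a h15 h18 => ?_, ?_, ?_⟩
    · simp only [Expr.eval, var]
      rw [hv, h 11 (by decide) (by decide), hP, pow_succ]
    · rw [abs_of_nonneg (by positivity)]
      exact hPX _ hj
    · rw [Store.write_of_ne _ (by decide), hj']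
    · rw [Store.write_of_ne _ h18, Store.write_of_ne _ h15, h a h15 h18]
    · rw [Store.write_of_ne _ (by decide), Store.write_self]
    · rw [Store.write_self]
      push_cast
      rfl
  · simp only [Expr.time, kExpr]
    omega

/-! ### The linear program of a cell -/

/-- The width of the cells in direction `i`. -/
def widthExpr : Expr := .div (.sub (.get 13 (var 18)) (.get 12 (var 18))) (var 11)

/-- Write the bounds and the objective coefficient of the variable `x_i`. -/
def cellStep : Prog :=
  .seq (.assign 22 (var 18) (.add (.get 12 (var 18))
    (.mul (.sub (var 19) (.mul (.div (var 19) (var 11)) (var 11))) (.add widthExpr (.const 1))))) <|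
  .seq (.assign 19 (.const 0) (.div (var 19) (var 11))) <|
  .seq (.cond (.le (.get 22 (var 18)) (.get 13 (var 18))) .skip
    (.assign 22 (var 18) (.get 12 (var 18)))) <|
  .seq (.assign 23 (var 18) (.add (.get 22 (var 18)) widthExpr))
    (.assign 21 (var 18) (.sub (.get 21 (var 18)) (.mul factorExpr
      (.mul (.get 3 (var 18)) (.add (.get 22 (var 18)) (.get 23 (var 18)))))))

/-- Write the linear program of the cell whose number is in array 16. -/
def cellProg : Prog :=
  .seq (.assign 19 (.const 0) (var 16)) <|
  .seq (setupProg (.add (.get 9 (var 28)) (.mul factorExpr (.get 4 (var 28)))))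
    (forProg 18 kExpr cellStep)

/-- The memory after the data of the first `i` variables have been adapted to the cell. -/
structure CellDone (I : IQP) (σ : Store) (P c i : ℕ) (τ : Store) : Prop where
  frame : ∀ a < 18, τ a = σ a
  counter : τ 18 0 = i
  rest : τ 19 0 = (c / P ^ i : ℕ)
  cost : ∀ j : Fin I.n, τ 21 (j : ℕ) = perturbed I.boxRadius
    (fun j => if (j : ℕ) < i then I.cellCost (σ 12) (σ 13) P c j else I.h j) j
  lo : ∀ j : Fin I.n, τ 22 (j : ℕ) =
    if (j : ℕ) < i then IQP.cellLo (σ 12) (σ 13) P c j else -I.boxRadius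
  hi : ∀ j : Fin I.n, τ 23 (j : ℕ) =
    if (j : ℕ) < i then IQP.cellHi (σ 12) (σ 13) P c j else I.boxRadius

/-- The hypotheses on the memory for the search in the cells. -/
structure CellsReady (I : IQP) (C : Setting) (P : ℕ) (σ : Store) : Prop
    extends Initialized I σ where
  parts : σ 11 0 = P
  parts_pos : 0 < P
  small : SmallIntervals I (σ 12) (σ 13)
  parts_le : (P : ℤ) * I.mag ^ 3 ≤ C.X
  count_le : (P : ℤ) ^ I.k ≤ C.X

namespace IQP

variable {I : IQP} {l u : ℤ → ℤ}

theorem width_bounds (h : SmallIntervals I l u) (P i : ℕ) :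
    0 ≤ (u i - l i) / (P : ℤ) ∧ (u i - l i) / (P : ℤ) ≤ 2 * I.mag := by
  obtain ⟨h1, h2, h3⟩ := h i
  have h4 := Int.ediv_le_self (P : ℤ) (show 0 ≤ u i - l i by omega)
  exact ⟨Int.ediv_nonneg (by omega) (by omega), by omega⟩

theorem abs_cellLo_le (h : SmallIntervals I l u) (P c i : ℕ) : |cellLo l u P c i| ≤ I.mag := by
  have h1 := h i
  have h2 := le_cellLo (P := P) (c := c) h1.2.1
  exact abs_le.2 ⟨by omega, by omega⟩

theorem abs_cellHi_le (h : SmallIntervals I l u) (P c i : ℕ) : |cellHi l u P c i| ≤ 3 * I.mag := by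
  have h1 := abs_le.1 (abs_cellLo_le h P c i)
  have h2 := width_bounds h P i
  unfold cellHi
  exact abs_le.2 ⟨by omega, by omega⟩

theorem abs_h_le (j : Fin I.n) : |I.h j| ≤ I.mag :=
  (Finset.single_le_sum (f := fun j => |I.h j|) (fun _ _ => abs_nonneg _)
    (Finset.mem_univ j)).trans I.sum_abs_h_le

theorem q_le (i : Fin I.k) : I.q i ≤ I.mag :=
  (Finset.single_le_sum (f := fun i => I.q i) (fun i _ => (I.q_pos i).le)
    (Finset.mem_univ i)).trans I.sum_q_le

theorem abs_cellCost_le (h : SmallIntervals I l u) (P c : ℕ) (j : Fin I.n) :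
    |I.cellCost l u P c j| ≤ I.mag ^ 19 := by
  have hA := I.four_le_mag
  have h4 := I.mag_pow_le (show 4 ≤ 19 by norm_num)
  have h5 := I.mag_pow_le (show 1 ≤ 3 by norm_num)
  have h6 := I.four_mul_mag_pow_le 3
  have h7 := I.four_mul_mag_pow_le 2
  have h8 := I.abs_h_le j
  have h9 := I.mag_pow_pos 2
  norm_num at h6 h7 h5
  unfold cellCost
  split_ifs with hj
  · have h1 := abs_cellLo_le h P c j
    have h2 := abs_cellHi_le h P c j
    have h3 : |cellLo l u P c j + cellHi l u P c j| ≤ 4 * I.mag :=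
      (abs_add_le _ _).trans (by omega)
    have hq : |I.q ⟨j, hj⟩ * (cellLo l u P c j + cellHi l u P c j)| ≤ I.mag * (4 * I.mag) := by
      rw [abs_mul, abs_of_pos (I.q_pos _)]
      exact mul_le_mul (I.q_le _) h3 (abs_nonneg _) (by omega)
    have := abs_sub (I.h j) (I.q ⟨j, hj⟩ * (cellLo l u P c j + cellHi l u P c j))
    have h10 : I.mag * (4 * I.mag) = 4 * I.mag ^ 2 := by ring
    omega
  · rw [sub_zero]
    omega

end IQP

/-- The cell number is consumed in base `P`: the remainder of array 19 is the digit for `x_i`, the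
quotient is kept for the following variables. The perturbed objective is adapted by subtracting `D ^
n q_i (s + t)`. -/
theorem cellStep_spec {I : IQP} {C : Setting} (hC : Fits I C) {P c : ℕ} {σ τ : Store}
    (hσ : CellsReady I C P σ) (hc : (c : ℤ) ≤ C.X) (hτ : Bounded C.X τ) (i : Fin I.k)
    (h : CellDone I σ P c i τ) :
    Runs C cellStep τ 110 0 fun υ =>
      υ 18 0 = (i : ℕ) ∧ CellDone I σ P c (i + 1) (υ.write 18 0 ((i : ℕ) + 1)) := by
  have hX := C.two_le
  have hA := I.four_le_mag
  have hP := hσ.parts_pos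
  have hP1 : (1 : ℤ) ≤ P := by exact_mod_cast hP
  have hA3 := I.mag_pow_pos 3
  have hlu := hσ.small i
  have hw := IQP.width_bounds hσ.small P i
  have hlo := IQP.abs_cellLo_le hσ.small P c i
  have hhi := IQP.abs_cellHi_le hσ.small P c i
  have hAX : 4 * I.mag ≤ C.X :=
    I.mag_le_boxRadius.trans (I.boxRadius_le_lpBound.trans hC.lpBound_le)
  have hne : ∀ j : ℕ, j ≠ i → (j : ℤ) ≠ ((i : ℕ) : ℤ) := fun j hj => by exact_mod_cast hj
  have f0 : τ 0 = σ 0 := h.frame 0 (by decide)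
  have f3 := h.frame 3 (by decide)
  have f9 := h.frame 9 (by decide)
  have f11 := h.frame 11 (by decide)
  have f12 := h.frame 12 (by decide)
  have f13 := h.frame 13 (by decide)
  set l := σ 12 with hl
  set u := σ 13 with hu
  set s := l (i : ℕ) + ((c / P ^ (i : ℕ) % P : ℕ) : ℤ) * ((u (i : ℕ) - l (i : ℕ)) / P + 1) with hs
  have hdig : ((c / P ^ (i : ℕ) : ℕ) : ℤ) - ((c / P ^ (i : ℕ) : ℕ) : ℤ) / P * P =
      ((c / P ^ (i : ℕ) % P : ℕ) : ℤ) := by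
    rw [Int.natCast_mod]
    have := Int.mul_ediv_add_emod ((c / P ^ (i : ℕ) : ℕ) : ℤ) P
    linarith
  have hdP : ((c / P ^ (i : ℕ) % P : ℕ) : ℤ) ≤ P := by exact_mod_cast (Nat.mod_lt _ hP).le
  -- The tentative left end `s` may exceed `u` by an amount that grows with `P`, hence the
  -- hypothesis `parts_le`; the bounds finally written do not grow with `P`.
  have hsX : |s| ≤ C.X := by
    have h1 : ((c / P ^ (i : ℕ) % P : ℕ) : ℤ) * ((u (i : ℕ) - l (i : ℕ)) / P + 1) ≤
        P * (2 * I.mag + 1) := mul_le_mul hdP (by omega) (by omega) (by omega)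
    have h2 := mul_nonneg (Int.natCast_nonneg (c / P ^ (i : ℕ) % P))
      (show 0 ≤ (u (i : ℕ) - l (i : ℕ)) / (P : ℤ) + 1 by omega)
    have h3 : 3 * I.mag + 1 ≤ I.mag ^ 3 := by
      have h7 := I.four_mul_mag_pow_le 1
      have h8 := I.four_mul_mag_pow_le 2
      norm_num at h7 h8
      omega
    have h4 : (P : ℤ) * (3 * I.mag + 1) ≤ P * I.mag ^ 3 := mul_le_mul_of_nonneg_left h3 (by omega)
    have h5 := hσ.parts_le
    have h6 : I.mag * 1 ≤ I.mag * P := mul_le_mul_of_nonneg_left hP1 (by omega)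
    rw [hs]
    refine abs_le.2 ⟨by omega, ?_⟩
    nlinarith
  refine Runs.bind (T := 35) (N := 0) (Q := fun υ => υ = τ.write 22 (i : ℕ) s)
    (Runs.assign_of_le hτ 22 (by decide) (by decide) (by decide) h.counter ?_ hsX rfl)
    (by decide) le_rfl fun τ₁ b₁ h₁ => ?_
  · simp only [Expr.eval, var, widthExpr, h.counter, h.rest, f11, f12, f13, hσ.parts, hdig, hs]
  have e19 : τ₁ 19 0 = (c / P ^ (i : ℕ) : ℕ) := by
    rw [h₁, Store.write_of_ne _ (by decide), h.rest]
  have hquot : ((c / P ^ (i : ℕ) : ℕ) : ℤ) / P = (c / P ^ ((i : ℕ) + 1) : ℕ) := by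
    rw [pow_succ, ← Nat.div_div_eq_div_mul, Int.natCast_div (c / P ^ (i : ℕ)) P]
  refine Runs.bind (T := 10) (N := 0)
    (Q := fun υ => υ = τ₁.write 19 0 (c / P ^ ((i : ℕ) + 1) : ℕ))
    (Runs.assign_of_le b₁ 19 (by decide) (by decide) (by decide) (u := 0) rfl ?_ ?_ rfl)
    (by decide) le_rfl fun τ₂ b₂ h₂ => ?_
  · simp only [Expr.eval, var]
    rw [e19, h₁, Store.write_of_ne _ (by decide), f11, hσ.parts, hquot]
  · rw [abs_of_nonneg (Int.natCast_nonneg _)]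
    refine le_trans ?_ hc
    exact_mod_cast Nat.div_le_self _ _
  have g : ∀ a, a ≠ 22 → a ≠ 19 → τ₂ a = τ a := fun a ha hb => by
    rw [h₂, Store.write_of_ne _ hb, h₁, Store.write_of_ne _ ha]
  have g18 : τ₂ 18 0 = (i : ℕ) := by rw [g 18 (by decide) (by decide), h.counter]
  have g22 : τ₂ 22 = (τ.write 22 (i : ℕ) s) 22 := by rw [h₂, Store.write_of_ne _ (by decide), h₁]
  have g22s : τ₂ 22 (i : ℕ) = s := by rw [g22, Store.write_self]
  have g12 : τ₂ 12 = l := by rw [g 12 (by decide) (by decide), f12]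
  have g13 : τ₂ 13 = u := by rw [g 13 (by decide) (by decide), f13]
  refine Runs.bind (T := 20) (N := 0) (Q := fun υ => (∀ a, a ≠ 22 → υ a = τ₂ a) ∧
      υ 22 (i : ℕ) = IQP.cellLo l u P c i ∧ ∀ j : ℕ, j ≠ i → υ 22 j = τ 22 j)
    (Runs.cond_of_le b₂ (by decide) (by decide) (fun ht => ?_) fun ht => ?_)
    (by decide) le_rfl fun τ₃ b₃ ⟨h₃, v₃, w₃⟩ => ?_
  · simp only [Test.Holds, Expr.eval, var, g18, g22s, g13] at ht
    refine Runs.skip_of_le b₂ (by decide) ⟨fun _ _ => rfl, ?_, fun j hj => ?_⟩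
    · rw [g22s, IQP.cellLo, if_pos ht]
    · rw [g22, Store.write_self_of_ne _ _ (hne j hj)]
  · simp only [Test.Holds, Expr.eval, var, g18, g22s, g13] at ht
    refine Runs.assign_of_le b₂ 22 (by decide) (by decide) (by decide) (u := (i : ℕ))
      (v := l (i : ℕ)) g18 ?_ (abs_le.2 ⟨by omega, by omega⟩)
      ⟨fun a ha => Store.write_of_ne _ ha _ _, ?_, fun j hj => ?_⟩
    · simp only [Expr.eval, var, g18, g12]
    · rw [Store.write_self, IQP.cellLo, if_neg ht]
    · rw [Store.write_self_of_ne _ _ (hne j hj), g22, Store.write_self_of_ne _ _ (hne j hj)]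
  have k18 : τ₃ 18 0 = (i : ℕ) := by rw [h₃ 18 (by decide), g18]
  refine Runs.bind (T := 20) (N := 0)
    (Q := fun υ => υ = τ₃.write 23 (i : ℕ) (IQP.cellHi l u P c i))
    (Runs.assign_of_le b₃ 23 (by decide) (by decide) (by decide) k18 ?_ (by omega) rfl)
    (by decide) le_rfl fun τ₄ b₄ h₄ => ?_
  · simp only [Expr.eval, var, widthExpr, k18, v₃, IQP.cellHi]
    rw [h₃ 11 (by decide), h₃ 12 (by decide), h₃ 13 (by decide), g12, g13,
      g 11 (by decide) (by decide), f11, hσ.parts]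
  have m : ∀ a, a ≠ 22 → a ≠ 19 → a ≠ 23 → τ₄ a = τ a := fun a h1 h2 h3 => by
    rw [h₄, Store.write_of_ne _ h3, h₃ a h1, g a h1 h2]
  have m18 : τ₄ 18 0 = (i : ℕ) := by rw [m 18 (by decide) (by decide) (by decide), h.counter]
  have m22 : τ₄ 22 = τ₃ 22 := by rw [h₄, Store.write_of_ne _ (by decide)]
  have m23 : τ₄ 23 = (τ₃.write 23 (i : ℕ) (IQP.cellHi l u P c i)) 23 := by rw [h₄]
  set p := Fin.castLE I.hk i with hp
  refine Runs.assign_of_le b₄ 21 (by decide) (by decide) (by decide) (u := (i : ℕ))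
    (v := perturbed I.boxRadius (I.cellCost l u P c) p) m18 ?_
    ((I.abs_perturbed_le (IQP.abs_cellCost_le hσ.small P c p)).trans hC.lpBound_le) ⟨?_, ?_⟩
  · have hcost := h.cost p
    simp only [hp, Fin.val_castLE, perturbed, lt_irrefl, if_false] at hcost
    have hq : τ 3 (i : ℕ) = I.q i := by rw [f3, hσ.q]
    simp only [Expr.eval, var, factorExpr, nExpr, m18, m22, v₃, m23]
    rw [Store.write_self, m 21 (by decide) (by decide) (by decide),
      m 0 (by decide) (by decide) (by decide), m 9 (by decide) (by decide) (by decide),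
      m 3 (by decide) (by decide) (by decide), hq, f0, hσ.n, f9, hσ.pow I.n le_rfl, hcost]
    simp only [perturbed, IQP.cellCost, hp, Fin.val_castLE, i.2, dif_pos, Fin.eta]
    ring
  · rw [Store.write_of_ne _ (by decide), m18]
  · refine ⟨fun a ha => ?_, ?_, ?_, fun j => ?_, fun j => ?_, fun j => ?_⟩
    · rw [Store.write_of_ne _ (by omega), Store.write_of_ne _ (by omega),
        m a (by omega) (by omega) (by omega), h.frame a ha]
    · rw [Store.write_self]
      push_cast
      rfl
    · rw [Store.write_of_ne _ (by decide), Store.write_of_ne _ (by decide), h₄,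
        Store.write_of_ne _ (by decide), h₃ 19 (by decide), h₂, Store.write_self]
    · rw [Store.write_of_ne _ (by decide)]
      by_cases hj : (j : ℕ) = i
      · have hjp : j = p := Fin.ext hj
        rw [hj, Store.write_self, hjp]
        simp [perturbed, hp, hl, hu]
      · have : (j : ℕ) < i + 1 ↔ (j : ℕ) < i := by omega
        rw [Store.write_self_of_ne _ _ (hne j hj), m 21 (by decide) (by decide) (by decide), h.cost]
        simp only [perturbed, this]
    · rw [Store.write_of_ne _ (by decide), Store.write_of_ne _ (by decide), m22]
      by_cases hj : (j : ℕ) = i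
      · rw [hj, v₃, if_pos (Nat.lt_succ_self _)]
      · have : (j : ℕ) < i + 1 ↔ (j : ℕ) < i := by omega
        rw [w₃ j hj, h.lo, if_congr this rfl rfl]
    · rw [Store.write_of_ne _ (by decide), Store.write_of_ne _ (by decide), m23]
      by_cases hj : (j : ℕ) = i
      · rw [hj, Store.write_self, if_pos (Nat.lt_succ_self _)]
      · have : (j : ℕ) < i + 1 ↔ (j : ℕ) < i := by omega
        rw [Store.write_self_of_ne _ _ (hne j hj), h₃ 23 (by decide), g 23 (by decide) (by decide),
          h.hi, if_congr this rfl rfl]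

theorem cellProg_spec {I : IQP} {C : Setting} (hC : Fits I C) {P c : ℕ} {σ : Store}
    (hσ : CellsReady I C P σ) (hb : Bounded C.X σ) (hc : (c : ℤ) ≤ C.X) (h16 : σ 16 0 = c) :
    Runs C cellProg σ (70 * (I.n + 1) + I.k * 130 + 20) 0 (CellDone I σ P c I.k) := by
  have hkX : (I.k : ℤ) ≤ C.X := I.k_le_mag.trans (I.mag_le_lpBound.trans hC.lpBound_le)
  refine Runs.bind (T := 5) (N := 0) (Q := fun υ => υ = σ.write 19 0 c)
    (Runs.assign_of_le hb 19 (by decide) (by decide) (by decide) (u := 0) rfl h16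
      (by rwa [abs_of_nonneg (Int.natCast_nonneg _)]) rfl) (by omega) le_rfl fun τ₁ b₁ h₁ => ?_
  have g : ∀ a, a ≠ 19 → τ₁ a = σ a := fun a ha => by rw [h₁, Store.write_of_ne _ ha]
  have hh : ∀ j < I.n, ∀ τ : Store, (∀ a', a' ≠ 21 → a' ≠ 28 → τ a' = τ₁ a') → τ 28 0 = j →
      (Expr.add (.get 9 (var 28)) (.mul factorExpr (.get 4 (var 28)))).eval τ =
        (2 * I.boxRadius + 1) ^ j + (2 * I.boxRadius + 1) ^ I.n * σ 4 (j : ℤ) := by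
    intro j hj τ h hj'
    simp only [Expr.eval, var, factorExpr, nExpr, hj']
    rw [h 9 (by decide) (by decide), h 0 (by decide) (by decide), h 4 (by decide) (by decide),
      g 9 (by decide), g 0 (by decide), g 4 (by decide), hσ.n, hσ.pow I.n le_rfl, hσ.pow j hj.le]
  refine Runs.bind (setupProg_spec hC b₁ (hσ.toInitialized.congr fun a ha _ _ => g a (by omega))
    (by decide) (by decide)
    (fun j => (2 * I.boxRadius + 1) ^ j + (2 * I.boxRadius + 1) ^ I.n * σ 4 (j : ℤ)) hh
    fun j hj => ?_) (by omega) le_rfl fun τ₂ b₂ ⟨h₂, v₂⟩ => ?_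
  · have h4 := hσ.h ⟨j, hj⟩
    simp only at h4
    rw [h4]
    refine (I.abs_perturbed_le (c := I.h) (j := ⟨j, hj⟩) ?_).trans hC.lpBound_le
    refine (I.abs_h_le _).trans ?_
    simpa using I.mag_pow_le (show 1 ≤ 19 by norm_num)
  have gg : ∀ a, a < 19 → τ₂ a = σ a := fun a ha => by
    rw [h₂ a (by omega) (by omega) (by omega) (by omega), g a (by omega)]
  refine (Runs.for (T := 110) (N := 0) b₂ 18 (by decide) hkX (CellDone I σ P c)
    ⟨fun a ha => ?_, Store.write_self _ _ _ _, ?_, fun j => ?_, fun j => ?_, fun j => ?_⟩ ?_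
    fun j υ hj hυ h => cellStep_spec hC hσ hc hυ ⟨j, hj⟩ h).mono ?_ (by omega) fun _ _ h => h
  · rw [Store.write_of_ne _ (by omega), gg a (by omega)]
  · rw [Store.write_of_ne _ (by decide),
      h₂ 19 (by decide) (by decide) (by decide) (by decide), h₁, Store.write_self]
    simp
  · rw [Store.write_of_ne _ (by decide), (v₂ j j.2).1, hσ.h]
    simp [perturbed]
  · rw [Store.write_of_ne _ (by decide), (v₂ j j.2).2.1]
    simp
  · rw [Store.write_of_ne _ (by decide), (v₂ j j.2).2.2]
    simp
  · intro j υ _ h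
    refine ⟨h.counter, ?_⟩
    simp only [Expr.eval, kExpr]
    rw [h.frame 0 (by decide), hσ.k]
  · simp only [Expr.time, kExpr]
    omega

/-! ### The objective at the point found by the solver -/

/-- Compute the objective at the point found by the solver. -/
def objProg : Prog :=
  .seq (.assign 27 (.const 0) (.const 0)) <|
  .seq (forProg 28 kExpr (.assign 27 (.const 0) (.add (var 27) (.sub (.const 0)
    (.mul (.get 3 (var 28)) (.mul (.get 25 (var 28)) (.get 25 (var 28))))))))
    (forProg 28 nExpr (.assign 27 (.const 0)
      (.add (var 27) (.mul (.get 4 (var 28)) (.get 25 (var 28))))))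

/-- Stated for partial sums because the program stores them. For full sums it says that `A^16`, the
initial best value, is an upper bound for the objective on the box. -/
theorem IQP.abs_partial_obj_le {I : IQP} {z : Fin I.n → ℤ} (hz : ∀ j, |z j| ≤ I.boxRadius)
    {s : Finset (Fin I.k)} {t : Finset (Fin I.n)} :
    |∑ i ∈ s, -I.q i * z (Fin.castLE I.hk i) ^ 2 + ∑ j ∈ t, I.h j * z j| ≤ I.mag ^ 16 := by
  have hA := I.four_le_mag
  have hR := I.boxRadius_pos
  have h1 : |∑ i ∈ s, -I.q i * z (Fin.castLE I.hk i) ^ 2| ≤ I.mag * I.boxRadius ^ 2 := by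
    calc |∑ i ∈ s, -I.q i * z (Fin.castLE I.hk i) ^ 2|
        ≤ ∑ i ∈ s, |-I.q i * z (Fin.castLE I.hk i) ^ 2| := Finset.abs_sum_le_sum_abs _ _
      _ ≤ ∑ i ∈ s, I.q i * I.boxRadius ^ 2 := by
          refine Finset.sum_le_sum fun i _ => ?_
          rw [abs_mul, abs_neg, abs_of_pos (I.q_pos i), abs_pow]
          exact mul_le_mul_of_nonneg_left (pow_le_pow_left₀ (abs_nonneg _) (hz _) 2) (I.q_pos i).le
      _ = (∑ i ∈ s, I.q i) * I.boxRadius ^ 2 := (Finset.sum_mul _ _ _).symm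
      _ ≤ (∑ i, I.q i) * I.boxRadius ^ 2 := mul_le_mul_of_nonneg_right
          (Finset.sum_le_sum_of_subset_of_nonneg (Finset.subset_univ s) fun i _ _ => (I.q_pos i).le)
          (sq_nonneg _)
      _ ≤ I.mag * I.boxRadius ^ 2 := mul_le_mul_of_nonneg_right I.sum_q_le (sq_nonneg _)
  have h2 : |∑ j ∈ t, I.h j * z j| ≤ I.mag * I.boxRadius := by
    calc |∑ j ∈ t, I.h j * z j| ≤ ∑ j ∈ t, |I.h j * z j| := Finset.abs_sum_le_sum_abs _ _
      _ ≤ ∑ j ∈ t, |I.h j| * I.boxRadius := by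
          refine Finset.sum_le_sum fun j _ => ?_
          rw [abs_mul]
          exact mul_le_mul_of_nonneg_left (hz j) (abs_nonneg _)
      _ = (∑ j ∈ t, |I.h j|) * I.boxRadius := (Finset.sum_mul _ _ _).symm
      _ ≤ (∑ j, |I.h j|) * I.boxRadius := mul_le_mul_of_nonneg_right
          (Finset.sum_le_sum_of_subset_of_nonneg (Finset.subset_univ t) fun _ _ _ => abs_nonneg _)
          hR.le
      _ ≤ I.mag * I.boxRadius := mul_le_mul_of_nonneg_right I.sum_abs_h_le hR.le
  have h3 := abs_add_le (∑ i ∈ s, -I.q i * z (Fin.castLE I.hk i) ^ 2) (∑ j ∈ t, I.h j * z j)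
  have e1 : I.mag * I.boxRadius ^ 2 = I.mag ^ 15 := by
    unfold IQP.boxRadius
    ring
  have e2 : I.mag * I.boxRadius = I.mag ^ 8 := by
    unfold IQP.boxRadius
    ring
  have h4 := I.four_mul_mag_pow_le 15
  have h5 := I.mag_pow_le (show 8 ≤ 15 by norm_num)
  have h6 := I.mag_pow_pos 15
  norm_num at h4
  omega

theorem Finset.sum_range_eq_sum_fin {n j : ℕ} (hj : j ≤ n) {f : ℕ → ℤ} {g : Fin n → ℤ}
    (h : ∀ i : Fin n, f i = g i) :
    ∑ i ∈ Finset.range j, f i = ∑ i ∈ Finset.univ.filter (fun i : Fin n => (i : ℕ) < j), g i := by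
  refine (Finset.sum_bij (fun (i : Fin n) _ => (i : ℕ)) (fun i hi => ?_) (fun i _ i' _ h => Fin.ext h)
    (fun i hi => ?_) fun i _ => (h i).symm).symm
  · simpa using hi
  · have hi' := Finset.mem_range.1 hi
    exact ⟨⟨i, by omega⟩, by simpa using hi', rfl⟩

theorem objProg_spec {I : IQP} {C : Setting} (hC : Fits I C) {σ : Store} (hσ : Bounded C.X σ)
    (hI : HasInput I σ) {z : Fin I.n → ℤ} (hz : ∀ j, |z j| ≤ I.boxRadius)
    (h25 : ∀ j : Fin I.n, σ 25 (j : ℕ) = z j) :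
    Runs C objProg σ (80 * (I.n + 1)) 0 fun τ =>
      (∀ a, a ≠ 27 → a ≠ 28 → τ a = σ a) ∧ τ 27 0 = I.obj z := by
  have hX := C.two_le
  have hkn := I.hk
  have hnX : (I.n : ℤ) ≤ C.X := I.n_le_lpBound.trans hC.lpBound_le
  have hkX : (I.k : ℤ) ≤ C.X := I.k_le_mag.trans (I.mag_le_lpBound.trans hC.lpBound_le)
  have h16 : I.mag ^ 16 ≤ C.X := (I.mag_pow_le_lpBound (by norm_num)).trans hC.lpBound_le
  have hf : ∀ i : Fin I.k, 0 - σ 3 ((i : ℕ) : ℤ) * (σ 25 ((i : ℕ) : ℤ) * σ 25 ((i : ℕ) : ℤ)) =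
      -I.q i * z (Fin.castLE I.hk i) ^ 2 := by
    intro i
    have := h25 (Fin.castLE I.hk i)
    rw [Fin.val_castLE] at this
    rw [hI.q, this]
    ring
  have hg : ∀ j : Fin I.n, σ 4 ((j : ℕ) : ℤ) * σ 25 ((j : ℕ) : ℤ) = I.h j * z j := by
    intro j
    rw [hI.h, h25]
  refine Runs.bind (T := 3) (N := 0) (Q := fun υ => υ = σ.write 27 0 0)
    (Runs.assign_of_le hσ 27 (by decide) (by decide) (by decide) (u := 0) (v := 0) rfl rfl
      (by simp; omega) rfl) (by omega) le_rfl fun τ₁ b₁ h₁ => ?_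
  have g : ∀ a, a ≠ 27 → τ₁ a = σ a := fun a ha => by rw [h₁, Store.write_of_ne _ ha]
  have g27 : τ₁ 27 0 = 0 := by rw [h₁, Store.write_self]
  refine Runs.bind (T := 40 * I.k + 20) (N := 0) (Runs.mono (Runs.accumulate b₁ (a := 27) (by decide)
    (b := kExpr) (e := .sub (.const 0)
      (.mul (.get 3 (var 28)) (.mul (.get 25 (var 28)) (.get 25 (var 28)))))
    (by decide) (by decide) hkX
    (fun i => 0 - σ 3 (i : ℤ) * (σ 25 (i : ℤ) * σ 25 (i : ℤ))) ?_ ?_ ?_) ?_ le_rfl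
    fun _ _ h => h) (by omega) le_rfl fun τ₂ b₂ ⟨h₂, v₂⟩ => ?_
  · intro τ h
    simp only [Expr.eval, kExpr]
    rw [h 0 (by decide) (by decide), g 0 (by decide), hI.k]
  · intro j _ τ h hj
    simp only [Expr.eval, var, hj]
    rw [h 3 (by decide) (by decide), h 25 (by decide) (by decide), g 3 (by decide),
      g 25 (by decide)]
  · intro j hj
    rw [g27, zero_add, Finset.sum_range_eq_sum_fin hj hf]
    have := IQP.abs_partial_obj_le hz (s := Finset.univ.filter fun i : Fin I.k => (i : ℕ) < j)
      (t := ∅)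
    rw [Finset.sum_empty, add_zero] at this
    exact this.trans h16
  · simp only [Expr.time, kExpr, var]
    omega
  have v₂' : τ₂ 27 0 = ∑ i, -I.q i * z (Fin.castLE I.hk i) ^ 2 := by
    rw [v₂, g27, zero_add, Finset.sum_range]
    exact Finset.sum_congr rfl fun i _ => hf i
  refine Runs.mono (Runs.accumulate b₂ (a := 27) (by decide)
    (b := nExpr) (e := .mul (.get 4 (var 28)) (.get 25 (var 28)))
    (by decide) (by decide) hnX (fun j => σ 4 (j : ℤ) * σ 25 (j : ℤ)) ?_ ?_ ?_) ?_ (by decide) ?_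
  · intro τ h
    simp only [Expr.eval, nExpr]
    rw [h 0 (by decide) (by decide), h₂ 0 (by decide) (by decide), g 0 (by decide), hI.n]
  · intro j _ τ h hj
    simp only [Expr.eval, var, hj]
    rw [h 4 (by decide) (by decide), h 25 (by decide) (by decide), h₂ 4 (by decide) (by decide),
      h₂ 25 (by decide) (by decide), g 4 (by decide), g 25 (by decide)]
  · intro j hj
    rw [v₂', Finset.sum_range_eq_sum_fin hj hg]
    exact (IQP.abs_partial_obj_le hz).trans h16
  · simp only [Expr.time, nExpr, var]
    omega
  · rintro τ - ⟨h₃, v₃⟩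
    refine ⟨fun a h27 h28 => by rw [h₃ a h27 h28, h₂ a h27 h28, g a h27], ?_⟩
    rw [v₃, v₂', Finset.sum_range, IQP.obj, dotProduct]
    congr 1
    exact Finset.sum_congr rfl fun j _ => hg j

/-! ### The search in the cells -/

/-- Keep the point found by the solver if it is better than the best one so far. -/
def keepProg : Prog :=
  .seq objProg
    (.cond (.le (var 27) (var 17))
      (.seq (.assign 17 (.const 0) (var 27)) <|
        .seq (.assign 5 (.const 0) (.const 2))
          (forProg 28 nExpr (.assign 6 (var 28) (.get 25 (var 28)))))
      .skip)

theorem keepProg_spec {I : IQP} {C : Setting} (hC : Fits I C) {σ : Store} (hσ : Bounded C.X σ)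
    (hI : HasInput I σ) {z : Fin I.n → ℤ} (hz : ∀ j, |z j| ≤ I.boxRadius)
    (h25 : ∀ j : Fin I.n, σ 25 (j : ℕ) = z j) :
    Runs C keepProg σ (110 * (I.n + 1) + 20) 0 fun τ =>
      (∀ a < 25, a ≠ 5 → a ≠ 6 → a ≠ 17 → τ a = σ a) ∧
      ((I.obj z ≤ σ 17 0 ∧ τ 5 0 = 2 ∧ (fun j : Fin I.n => τ 6 (j : ℕ)) = z ∧ τ 17 0 = I.obj z) ∨
        (σ 17 0 < I.obj z ∧ τ 5 = σ 5 ∧ τ 6 = σ 6 ∧ τ 17 = σ 17)) := by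
  have hX := C.two_le
  have hnX : (I.n : ℤ) ≤ C.X := I.n_le_lpBound.trans hC.lpBound_le
  have hRX := I.boxRadius_le_lpBound.trans hC.lpBound_le
  refine Runs.bind (objProg_spec hC hσ hI hz h25) (by omega) le_rfl fun τ₁ b₁ ⟨h₁, v₁⟩ => ?_
  have g17 := h₁ 17 (by decide) (by decide)
  have htime : 110 * (I.n + 1) + 20 - 80 * (I.n + 1) = 30 * (I.n + 1) + 20 := by omega
  rw [htime]
  refine Runs.cond_of_le b₁ (by decide)
    (le_trans (by decide) (Nat.le_add_left 20 _)) (fun ht => ?_) fun ht => ?_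
  · simp only [Test.Holds, Expr.eval, var, g17, v₁] at ht
    have htm : 30 * (I.n + 1) + 20 - (Test.le (var 27) (var 17)).time = 30 * (I.n + 1) + 15 := rfl
    rw [htm]
    refine Runs.bind (T := 4) (N := 0) (Q := fun υ => υ = τ₁.write 17 0 (I.obj z))
      (Runs.assign_of_le b₁ 17 (by decide) (by decide) (by decide) (u := 0) rfl v₁
        (v₁ ▸ b₁ 27 0) rfl) (by omega) le_rfl fun τ₂ b₂ h₂ => ?_
    refine Runs.bind (T := 4) (N := 0) (Q := fun υ => υ = τ₂.write 5 0 2)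
      (Runs.assign_of_le b₂ 5 (by decide) (by decide) (by decide) (u := 0) (v := 2) rfl rfl
        (by rw [abs_of_nonneg (by norm_num)]; exact hX) rfl) (by omega) le_rfl fun τ₃ b₃ h₃ => ?_
    have g : ∀ a, a ≠ 5 → a ≠ 17 → τ₃ a = τ₁ a := fun a h5 h17 => by
      rw [h₃, Store.write_of_ne _ h5, h₂, Store.write_of_ne _ h17]
    refine Runs.mono (Runs.fill b₃ (a := 6) (by decide) (b := nExpr) (e := .get 25 (var 28))
      (by decide) (by decide) hnX (fun j => σ 25 (j : ℤ)) ?_ ?_ ?_) ?_ le_rfl ?_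
    · intro τ h
      simp only [Expr.eval, nExpr]
      rw [h 0 (by decide) (by decide), g 0 (by decide) (by decide),
        h₁ 0 (by decide) (by decide), hI.n]
    · intro j _ τ h hj
      simp only [Expr.eval, var, hj]
      rw [h 25 (by decide) (by decide), g 25 (by decide) (by decide),
        h₁ 25 (by decide) (by decide)]
    · intro j hj
      have := h25 ⟨j, hj⟩
      simp only at this
      rw [this]
      exact (hz _).trans hRX
    · simp only [Expr.time, nExpr, var]
      omega
    · rintro τ - ⟨h₄, v₄⟩
      refine ⟨fun a ha h5 h6 h17 => ?_, Or.inl ⟨ht, ?_, ?_, ?_⟩⟩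
      · rw [h₄ a h6 (by omega), g a h5 h17, h₁ a (by omega) (by omega)]
      · rw [h₄ 5 (by decide) (by decide), h₃, Store.write_self]
      · funext j
        rw [v₄ j j.2, h25]
      · rw [h₄ 17 (by decide) (by decide), h₃, Store.write_of_ne _ (by decide), h₂,
          Store.write_self]
  · simp only [Test.Holds, Expr.eval, var, g17, v₁] at ht
    refine Runs.skip_of_le b₁ ?_ ⟨fun a ha _ _ _ => h₁ a (by omega) (by omega),
      Or.inr ⟨not_le.1 ht, h₁ 5 (by decide) (by decide), h₁ 6 (by decide) (by decide), g17⟩⟩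
    simp only [Test.time, Expr.time, var]
    omega

/-- The search in one cell. -/
def searchStep : Prog :=
  .seq cellProg <|
  .seq (.solve solverCall)
    (.cond (.le (.const 2) (var 24)) keepProg .skip)

/-- The memory after the search in the first `c` cells. -/
structure Searched (I : IQP) (σ : Store) (P c : ℕ) (τ : Store) : Prop where
  frame : ∀ a < 16, a ≠ 5 → a ≠ 6 → τ a = σ a
  counter : τ 16 0 = c
  best : (τ 5 0 = 0 ∧ τ 17 0 = I.mag ^ 16) ∨ (τ 5 0 = 2 ∧
    I.Feasible (fun j => τ 6 (j : ℕ)) ∧ I.obj (fun j => τ 6 (j : ℕ)) = τ 17 0)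
  all : ∀ c' < c, ∀ y, IQP.InCell (σ 12) (σ 13) P c' y →
    τ 5 0 = 2 ∧ 4 * τ 17 0 ≤ 4 * I.obj y + I.gap (σ 12) (σ 13) P

theorem CellsReady.congr {I : IQP} {C : Setting} {P : ℕ} {σ τ : Store} (hσ : CellsReady I C P σ)
    (h : ∀ a < 16, a ≠ 5 → a ≠ 6 → τ a = σ a) : CellsReady I C P τ where
  toInitialized := hσ.toInitialized.congr fun a ha => h a (by omega)
  parts := by rw [h 11 (by decide) (by decide) (by decide), hσ.parts]
  parts_pos := hσ.parts_pos
  small := by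
    rw [h 12 (by decide) (by decide) (by decide), h 13 (by decide) (by decide) (by decide)]
    exact hσ.small
  parts_le := hσ.parts_le
  count_le := hσ.count_le

theorem searchStep_spec {I : IQP} {C : Setting} (hC : Fits I C) {P c : ℕ} {σ τ : Store}
    (hσ : CellsReady I C P σ) (hτ : Bounded C.X τ) (hc : c < P ^ I.k) (h : Searched I σ P c τ) :
    Runs C searchStep τ (180 * (I.n + 1) + I.k * 130 + 60) 1 fun υ =>
      υ 16 0 = c ∧ Searched I σ P (c + 1) (υ.write 16 0 (c + 1)) := by
  have hX := C.two_le
  have hcX : (c : ℤ) ≤ C.X := by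
    have : (c : ℤ) ≤ (P : ℤ) ^ I.k := by exact_mod_cast hc.le
    exact this.trans hσ.count_le
  have hR := I.boxRadius_pos
  have hAR := I.mag_le_boxRadius
  have hA := I.four_le_mag
  have hτR := hσ.congr h.frame
  have f12 := h.frame 12 (by decide) (by decide) (by decide)
  have f13 := h.frame 13 (by decide) (by decide) (by decide)
  refine Runs.bind (cellProg_spec hC hτR hτ hcX h.counter) (by omega) (Nat.zero_le _)
    fun τ₁ b₁ h₁ => ?_
  have hcost : ∀ j : Fin I.n, τ₁ 21 (j : ℕ) =
      perturbed I.boxRadius (I.cellCost (σ 12) (σ 13) P c) j := by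
    intro j
    rw [h₁.cost, f12, f13]
    by_cases hj : (j : ℕ) < I.k
    · simp [perturbed, hj]
    · simp [perturbed, hj, IQP.cellCost]
  have hlo : ∀ j : Fin I.n, τ₁ 22 (j : ℕ) = I.loBound (σ 12) (σ 13) P c j := fun j => by
    rw [h₁.lo, f12, f13, IQP.loBound]
  have hhi : ∀ j : Fin I.n, τ₁ 23 (j : ℕ) = I.hiBound (σ 12) (σ 13) P c j := fun j => by
    rw [h₁.hi, f12, f13, IQP.hiBound]
  have blo : ∀ j : Fin I.n, |I.loBound (σ 12) (σ 13) P c j| ≤ I.boxRadius := by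
    intro j
    unfold IQP.loBound
    split_ifs
    · have := IQP.abs_cellLo_le hσ.small P c j
      omega
    · rw [abs_neg, abs_of_pos hR]
  have bhi : ∀ j : Fin I.n, |I.hiBound (σ 12) (σ 13) P c j| ≤ I.boxRadius := by
    intro j
    unfold IQP.hiBound
    split_ifs
    · have := IQP.abs_cellHi_le hσ.small P c j
      omega
    · rw [abs_of_pos hR]
  refine Runs.bind (solve_spec hC b₁ (hτR.toInitialized.congr fun a ha _ _ => h₁.frame a (by omega))
    hcost hlo hhi (fun j => IQP.abs_cellCost_le hσ.small P c j) blo bhi)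
    (by omega) le_rfl fun τ₂ b₂ ⟨h₂, v₂⟩ => ?_
  have g : ∀ a, a < 18 → τ₂ a = τ a := fun a ha => by
    rw [h₂ a (by omega) (by omega) (by omega), h₁.frame a ha]
  have htime : 180 * (I.n + 1) + I.k * 130 + 60 - (70 * (I.n + 1) + I.k * 130 + 20) - 5 =
    110 * (I.n + 1) + 35 := by omega
  rw [htime]
  have build : ∀ υ : Store, (∀ a < 17, a ≠ 5 → a ≠ 6 → υ a = τ a) →
      ((υ 5 0 = 0 ∧ υ 17 0 = I.mag ^ 16) ∨ (υ 5 0 = 2 ∧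
        I.Feasible (fun j => υ 6 (j : ℕ)) ∧ I.obj (fun j => υ 6 (j : ℕ)) = υ 17 0)) →
      (∀ c' < c + 1, ∀ y, IQP.InCell (σ 12) (σ 13) P c' y →
        υ 5 0 = 2 ∧ 4 * υ 17 0 ≤ 4 * I.obj y + I.gap (σ 12) (σ 13) P) →
      υ 16 0 = c ∧ Searched I σ P (c + 1) (υ.write 16 0 (c + 1)) := by
    intro υ hf hb ha
    refine ⟨by rw [hf 16 (by decide) (by decide) (by decide), h.counter],
      fun a ha h5 h6 => ?_, ?_, ?_, ?_⟩
    · rw [Store.write_of_ne _ (by omega), hf a (by omega) h5 h6, h.frame a ha h5 h6]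
    · rw [Store.write_self]
      push_cast
      rfl
    · rw [Store.write_of_ne _ (by decide), Store.write_of_ne _ (by decide),
        Store.write_of_ne _ (by decide)]
      exact hb
    · rw [Store.write_of_ne _ (by decide), Store.write_of_ne _ (by decide)]
      exact ha
  refine Runs.cond_of_le b₂ (by decide)
    (le_trans (by decide) (Nat.le_add_left 35 _)) (fun ht => ?_) fun ht => ?_
  · simp only [Test.Holds, Expr.eval, var] at ht
    rcases v₂ with ⟨hs, -⟩ | ⟨-, z, hz, hmin, hnum⟩
    · omega
    have hzR : ∀ j, |z j| ≤ I.boxRadius := fun j => by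
      have h1 := hz.2.1 j
      have h2 := hz.2.2 j
      have h3 := (abs_le.1 (blo j)).1
      have h4 := (abs_le.1 (bhi j)).2
      exact abs_le.2 ⟨by omega, by omega⟩
    refine Runs.mono (keepProg_spec hC b₂ (hτR.toHasInput.congr fun a ha => g a (by omega)) hzR hnum)
      ?_ (Nat.zero_le _) ?_
    · simp only [Test.time, Expr.time, var]
      omega
    · rintro υ - ⟨h₃, v₃⟩
      rw [g 17 (by decide), g 5 (by decide), g 6 (by decide)] at v₃
      have h16 : I.obj z ≤ I.mag ^ 16 := (abs_le.1 (IQP.abs_partial_obj_le hzR (s := Finset.univ)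
        (t := Finset.univ))).2
      have hnew : ∀ y, IQP.InCell (σ 12) (σ 13) P c y →
          4 * I.obj z ≤ 4 * I.obj y + I.gap (σ 12) (σ 13) P := fun y hy =>
        IQP.obj_le_of_cellCost_le hy (hmin y hy)
      refine build υ (fun a ha h5 h6 => ?_) ?_ fun c' hc' y hy => ?_
      · rw [h₃ a (by omega) h5 h6 (by omega), g a (by omega)]
      · rcases v₃ with ⟨-, h5, h6, h17⟩ | ⟨-, h5, h6, h17⟩
        · refine Or.inr ⟨h5, ?_, ?_⟩
          · rw [h6]
            exact hz.1
          · rw [h6, h17]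
        · rw [h5, h6, h17]
          exact h.best
      · rcases v₃ with ⟨hle, h5, h6, h17⟩ | ⟨hlt, h5, h6, h17⟩
        · refine ⟨h5, ?_⟩
          rw [h17]
          rcases Nat.lt_succ_iff_lt_or_eq.1 hc' with hlt | rfl
          · have := (h.all c' hlt y hy).2
            omega
          · exact hnew y hy
        · rw [h5, h17]
          rcases Nat.lt_succ_iff_lt_or_eq.1 hc' with hlt' | rfl
          · exact h.all c' hlt' y hy
          · have := hnew y hy
            -- A point can be rejected only if one was kept before: against the initial value `A^16`
            -- the comparison `≤` always succeeds.
            rcases h.best with ⟨-, hb⟩ | ⟨hb, -⟩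
            · omega
            · exact ⟨hb, by omega⟩
  · simp only [Test.Holds, Expr.eval, var] at ht
    rcases v₂ with ⟨-, hinf⟩ | ⟨hs, -⟩
    swap
    · omega
    refine Runs.skip_of_le b₂ ?_ (build _ (fun a ha _ _ => g a (by omega)) ?_ fun c' hc' y hy => ?_)
    · simp only [Test.time, Expr.time, var]
      omega
    · rw [g 5 (by decide), g 6 (by decide), g 17 (by decide)]
      exact h.best
    · rw [g 5 (by decide), g 17 (by decide)]
      rcases Nat.lt_succ_iff_lt_or_eq.1 hc' with hlt' | rfl
      · exact h.all c' hlt' y hy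
      · exact absurd hy (hinf y)

/-- The square of an expression. -/
def sqExpr (e : Expr) : Expr := .mul e e

/-- Search all cells. -/
def searchProg : Prog :=
  .seq (.assign 17 (.const 0) (sqExpr (sqExpr (sqExpr (sqExpr (var 7))))))
    (forProg 16 (var 15) searchStep)

theorem searchProg_spec {I : IQP} {C : Setting} (hC : Fits I C) {P : ℕ} {σ : Store}
    (hσ : CellsReady I C P σ) (hb : Bounded C.X σ) (h5 : σ 5 0 = 0)
    (h15 : σ 15 0 = (P : ℤ) ^ I.k) :
    Runs C searchProg σ (P ^ I.k * (180 * (I.n + 1) + I.k * 130 + 80) + 80) (P ^ I.k)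
      (Searched I σ P (P ^ I.k)) := by
  have h16 : I.mag ^ 16 ≤ C.X := (I.mag_pow_le_lpBound (by norm_num)).trans hC.lpBound_le
  refine Runs.bind (T := 60) (N := 0) (Q := fun υ => υ = σ.write 17 0 (I.mag ^ 16))
    (Runs.assign_of_le hb 17 (by decide) (by decide) (by decide) (u := 0) rfl ?_
      (by rwa [abs_of_pos (I.mag_pow_pos 16)]) rfl) (by omega) (Nat.zero_le _) fun τ₁ b₁ h₁ => ?_
  · simp only [sqExpr, Expr.eval, var, hσ.mag]
    ring
  refine (Runs.for (T := 180 * (I.n + 1) + I.k * 130 + 60) (N := 1) (M := P ^ I.k) b₁ 16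
    (by decide) (by exact_mod_cast hσ.count_le) (Searched I σ P)
    ⟨fun a ha _ _ => ?_, Store.write_self _ _ _ _, Or.inl ⟨?_, ?_⟩,
      fun _ h => absurd h (Nat.not_lt_zero _)⟩ ?_
    fun c τ hc hτ h => searchStep_spec hC hσ hτ hc h).mono ?_ (by omega) fun _ _ h => h
  · rw [Store.write_of_ne _ (by omega), h₁, Store.write_of_ne _ (by omega)]
  · rw [Store.write_of_ne _ (by decide), h₁, Store.write_of_ne _ (by decide), h5]
  · rw [Store.write_of_ne _ (by decide), h₁, Store.write_self]
  · intro j τ _ h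
    refine ⟨h.counter, ?_⟩
    simp only [Expr.eval, var]
    rw [h.frame 15 (by decide) (by decide) (by decide), h15]
    push_cast
    rfl
  · have e : (var 15).time + 5 + (180 * (I.n + 1) + I.k * 130 + 60 + 6) ≤
        180 * (I.n + 1) + I.k * 130 + 80 := by
      simp only [Expr.time, var]
      omega
    have := Nat.mul_le_mul_left (P ^ I.k) e
    simp only [Expr.time, var] at this ⊢
    omega

/-! ### The algorithm -/

/-- Report unboundedness where it has been detected. -/
def reportProg : Prog :=
  .seq (.cond (.le (var 17) (.sub (.const 0) (.mul (sqExpr (sqExpr (var 7))) (sqExpr (var 7)))))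
    (.assign 5 (.const 0) (.const 1)) .skip)
    (.cond (.le (.const 1) (var 14)) (.assign 5 (.const 0) (.const 1)) .skip)

theorem reportProg_spec {C : Setting} {σ : Store} (hσ : Bounded C.X σ) :
    Runs C reportProg σ 50 0 fun τ => τ 6 = σ 6 ∧
      (((σ 17 0 ≤ -σ 7 0 ^ 6 ∨ 1 ≤ σ 14 0) ∧ τ 5 0 = 1) ∨
        (-σ 7 0 ^ 6 < σ 17 0 ∧ σ 14 0 < 1 ∧ τ 5 0 = σ 5 0)) := by
  have hX := C.two_le
  have he : (Expr.sub (.const 0) (.mul (sqExpr (sqExpr (var 7))) (sqExpr (var 7)))).eval σ =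
      -σ 7 0 ^ 6 := by
    simp only [sqExpr, Expr.eval, var]
    ring
  have h1 : |(1 : ℤ)| ≤ C.X := by
    rw [abs_one]
    omega
  refine Runs.bind (T := 30) (N := 0) (Q := fun τ => (∀ a, a ≠ 5 → τ a = σ a) ∧
    ((σ 17 0 ≤ -σ 7 0 ^ 6 ∧ τ 5 0 = 1) ∨ (-σ 7 0 ^ 6 < σ 17 0 ∧ τ 5 0 = σ 5 0)))
    (Runs.cond_of_le hσ (by decide) (by decide) (fun ht => ?_) fun ht => ?_) (by decide) le_rfl
    fun τ₁ b₁ ⟨h₁, v₁⟩ => ?_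
  · simp only [Test.Holds, he] at ht
    exact Runs.assign_of_le hσ 5 (by decide) (by decide) (by decide) (u := 0) (v := 1) rfl rfl h1
      ⟨fun a ha => Store.write_of_ne _ ha _ _, Or.inl ⟨ht, Store.write_self _ _ _ _⟩⟩
  · simp only [Test.Holds, he] at ht
    exact Runs.skip_of_le hσ (by decide) ⟨fun _ _ => rfl, Or.inr ⟨not_le.1 ht, rfl⟩⟩
  have g14 := h₁ 14 (by decide)
  have g6 := h₁ 6 (by decide)
  refine Runs.cond_of_le b₁ (by decide) (by decide) (fun ht => ?_) fun ht => ?_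
  · simp only [Test.Holds, Expr.eval, var, g14] at ht
    refine Runs.assign_of_le b₁ 5 (by decide) (by decide) (by decide) (u := 0) (v := 1) rfl rfl h1
      ⟨?_, Or.inl ⟨Or.inr ht, Store.write_self _ _ _ _⟩⟩
    rw [Store.write_of_ne _ (by decide), g6]
  · simp only [Test.Holds, Expr.eval, var, g14] at ht
    refine Runs.skip_of_le b₁ (by decide) ⟨g6, ?_⟩
    rcases v₁ with ⟨h, h'⟩ | ⟨h, h'⟩
    · exact Or.inl ⟨Or.inl h, h'⟩
    · exact Or.inr ⟨h, not_le.1 ht, h'⟩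

/-- The approximation algorithm. -/
def approxProg : Prog :=
  .seq magProg <| .seq powProg <| .seq partsProg <| .seq rangesProg <| .seq countProg <|
    .seq searchProg reportProg

/-! ### The input memory and the whole algorithm. -/

theorem hasInput_input (I : IQP) : HasInput I I.input := by
  have h0 : I.input 0 = (Store.writeVec (fun _ _ => 0) 0 ![(I.n : ℤ), (I.m : ℤ), (I.k : ℤ)]) 0 := by
    simp only [IQP.input]
    iterate 4 rw [Store.writeVec_of_ne _ (by decide)]
  constructor
  · rw [h0]
    exact Store.writeVec_self _ _ _ (0 : Fin 3)
  · rw [h0]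
    exact Store.writeVec_self _ _ _ (1 : Fin 3)
  · rw [h0]
    exact Store.writeVec_self _ _ _ (2 : Fin 3)
  · intro i j
    have h := Store.writeVec_self (Store.writeVec (fun _ _ => 0) 0 ![(I.n : ℤ), (I.m : ℤ), (I.k : ℤ)])
      1 (fun t : Fin (I.m * I.n) => I.W (finProdFinEquiv.symm t).1 (finProdFinEquiv.symm t).2)
      (finProdFinEquiv (i, j))
    simp only [Equiv.symm_apply_apply] at h
    have e : (((finProdFinEquiv (i, j) : Fin (I.m * I.n)) : ℕ) : ℤ) = (i : ℕ) * (I.n : ℤ) + (j : ℕ) := by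
      simp only [finProdFinEquiv_apply_val]
      push_cast
      ring
    rw [e] at h
    simp only [IQP.input]
    iterate 3 rw [Store.writeVec_of_ne _ (by decide)]
    exact h
  · intro i
    simp only [IQP.input]
    iterate 2 rw [Store.writeVec_of_ne _ (by decide)]
    exact Store.writeVec_self _ _ _ i
  · intro i
    simp only [IQP.input]
    rw [Store.writeVec_of_ne _ (by decide)]
    exact Store.writeVec_self _ _ _ i
  · intro j
    exact Store.writeVec_self _ _ _ j

theorem input_of_five_le (I : IQP) {a : ℕ} (ha : 5 ≤ a) (i : ℤ) : I.input a i = 0 := by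
  simp only [IQP.input]
  iterate 4 rw [Store.writeVec_of_ne _ (by omega)]
  exact congrFun (Store.writeVec_of_ne (fun _ _ => 0) (by omega) _) i

theorem bounded_input {I : IQP} {C : Setting} (hC : Fits I C) : Bounded C.X I.input := by
  have hX := C.two_le
  have hAX := I.mag_le_lpBound.trans hC.lpBound_le
  have h0 : Bounded C.X fun _ _ => 0 := fun _ _ => by
    rw [abs_zero]
    omega
  refine ((((h0.writeVec (fun i => ?_) 0).writeVec (fun t => ?_) 1).writeVec (fun i => ?_)
    2).writeVec (fun i => ?_) 3).writeVec (fun j => ?_) 4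
  · have hn := I.n_le_lpBound.trans hC.lpBound_le
    have hk := I.k_le_mag.trans hAX
    have hm := hC.m_le
    fin_cases i <;> simpa
  -- The entries of a totally unimodular matrix are `0` or `±1`, so `mag` can omit `W`.
  · obtain ⟨s, hs⟩ := hC.tu.apply (finProdFinEquiv.symm t).1 (finProdFinEquiv.symm t).2
    rw [← hs]
    cases s <;> simp <;> omega
  · exact ((Finset.single_le_sum (f := fun i => |I.w i|) (fun _ _ => abs_nonneg _)
      (Finset.mem_univ i)).trans I.sum_abs_w_le).trans hAX
  · rw [abs_of_pos (I.q_pos i)]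
    exact (I.q_le i).trans hAX
  · exact (I.abs_h_le j).trans hAX

theorem approxProg_spec {I : IQP} {C : Setting} (hC : Fits I C) (hε : 0 < C.ε) {P : ℕ}
    (hP0 : 0 < P) (hP : (I.k : ℝ) < C.ε * ((P : ℝ) * P - I.k))
    (hmin : ∀ j < P, C.ε * ((j : ℝ) * j - I.k) ≤ I.k) (hPX : (P : ℤ) * I.mag ^ 3 ≤ C.X)
    (hcX : (P : ℤ) ^ I.k ≤ C.X) :
    Runs C approxProg I.input (60 * (I.n + I.m + I.k + 1) + 80 * (I.n + 1) + (P * 19 + 13) +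
      (I.k * (70 * (I.n + 1) + 160) + 10) + (I.k * 30 + 20) +
      (P ^ I.k * (180 * (I.n + 1) + I.k * 130 + 80) + 80) + 50) (2 * I.k + P ^ I.k)
      (I.CorrectOutput C.ε) := by
  have hin := hasInput_input I
  have hP1 : (1 : ℤ) ≤ P := by exact_mod_cast hP0
  have hkX : (I.k : ℤ) ≤ C.X := I.k_le_mag.trans (I.mag_le_lpBound.trans hC.lpBound_le)
  have hzero := fun a (ha : 5 ≤ a) i => input_of_five_le I ha i
  refine Runs.bind (magProg_spec hC (bounded_input hC) hin) (by omega) (Nat.zero_le _)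
    fun τ₁ b₁ ⟨h₁, v₁⟩ => ?_
  refine Runs.bind (powProg_spec hC b₁ (hin.congr fun a ha => h₁ a (by omega) (by omega)) v₁)
    (by omega) (Nat.zero_le _) fun τ₂ b₂ ⟨h₂, v₂⟩ => ?_
  have g₂ : ∀ a, 11 ≤ a → a ≠ 28 → τ₂ a = I.input a := fun a ha h28 => by
    rw [h₂ a (by omega) (by omega) (by omega) h28, h₁ a (by omega) h28]
  refine Runs.bind (partsProg_spec ?_ hP hmin b₂ v₂.k ?_) (by omega) (Nat.zero_le _)
    fun τ₃ b₃ ⟨h₃, v₃⟩ => ?_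
  · refine le_trans ?_ hPX
    have := I.mag_pow_pos 3
    exact le_mul_of_one_le_right (by omega) (by omega)
  · rw [g₂ 11 (by decide) (by decide), hzero 11 (by decide)]
  have i₃ : Initialized I τ₃ := v₂.congr fun a ha _ _ => h₃ a (by omega)
  have g₃ : ∀ a, 12 ≤ a → a ≠ 28 → τ₃ a = I.input a := fun a ha h28 => by
    rw [h₃ a (by omega), g₂ a (by omega) h28]
  refine Runs.bind (rangesProg_spec hC b₃ i₃ (fun i => ?_) (fun i => ?_) ?_) (by omega)
    (Nat.le_add_right _ _) fun τ₄ b₄ h₄ => ?_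
  · rw [g₃ 12 (by decide) (by decide), hzero 12 (by decide)]
  · rw [g₃ 13 (by decide) (by decide), hzero 13 (by decide)]
  · rw [g₃ 14 (by decide) (by decide), hzero 14 (by decide)]
  refine Runs.bind (countProg_spec hkX (P := P) (fun j hj => ?_) b₄ ?_ ?_) (by omega)
    (Nat.zero_le _) fun τ₅ b₅ ⟨h₅, v₅⟩ => ?_
  · exact (pow_le_pow_right₀ hP1 hj).trans hcX
  · rw [h₄.frame 0 (by decide), i₃.k]
  · rw [h₄.frame 11 (by decide), v₃]
  have g₅ : ∀ a < 12, τ₅ a = τ₃ a := fun a ha => by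
    rw [h₅ a (by omega) (by omega), h₄.frame a ha]
  have e12 := h₅ 12 (by decide) (by decide)
  have e13 := h₅ 13 (by decide) (by decide)
  have e14 := h₅ 14 (by decide) (by decide)
  have r₅ : CellsReady I C P τ₅ :=
    { toInitialized := i₃.congr fun a ha _ _ => g₅ a (by omega)
      parts := by rw [g₅ 11 (by decide), v₃]
      parts_pos := hP0
      small := by
        rw [e12, e13]
        exact h₄.small
      parts_le := hPX
      count_le := hcX }
  refine Runs.bind (searchProg_spec hC r₅ b₅ ?_ v₅) (by omega) (by omega) fun τ₆ b₆ h₆ => ?_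
  · rw [g₅ 5 (by decide), h₃ 5 (by decide), h₂ 5 (by decide) (by decide) (by decide) (by decide),
      h₁ 5 (by decide) (by decide), hzero 5 (by decide)]
  refine (reportProg_spec b₆).mono (by omega) (Nat.zero_le _) ?_
  rintro τ - ⟨e6, hout⟩
  have m7 : τ₆ 7 0 = I.mag := by rw [h₆.frame 7 (by decide) (by decide) (by decide), r₅.mag]
  have m14 : τ₆ 14 0 = τ₄ 14 0 := by rw [h₆.frame 14 (by decide) (by decide) (by decide), e14]
  rw [m7, m14] at hout
  unfold IQP.CorrectOutput
  rcases h₄.ranges with ⟨h14, hunb⟩ | ⟨h14, hr⟩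
  · rcases hout with ⟨-, h⟩ | ⟨-, h, -⟩
    · exact Or.inr (Or.inl ⟨h, hunb⟩)
    · omega
  · obtain ⟨hu, ha⟩ := IQP.best_correct hC.tu hε hP0 hP (l := τ₄ 12) (u := τ₄ 13)
      (fun i => hr i i.2) (fun i => h₄.small i) h₆.best (by
        have := h₆.all
        rwa [e12, e13] at this)
    rw [e6]
    rcases hout with ⟨h | h, h5⟩ | ⟨h, -, h5⟩
    · exact Or.inr (Or.inl ⟨h5, hu h⟩)
    · omega
    · rw [h5]
      rcases ha h with h' | h'
      · exact Or.inl h'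
      · exact Or.inr (Or.inr h')

/-! ### Bounds on the resources -/

/-- The condition says `P² > k (1 + 1/ε)`; the inequality is strict, so the rounded-up root may have
to be increased by one. The case `k = 0` is singled out because the count of linear programs is then
`1`, and the time spent on finding `P` is charged to it. -/
theorem exists_parts {k : ℕ} {ε : ℝ} (hε : 0 < ε) :
    ∃ P : ℕ, 0 < P ∧ (k : ℝ) < ε * ((P : ℝ) * P - k) ∧ (∀ j < P, ε * ((j : ℝ) * j - k) ≤ k) ∧
      P ≤ ⌈Real.sqrt ((k : ℝ) * (1 + 1 / ε))⌉₊ + 1 ∧ (k = 0 → P = 1) := by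
  classical
  set c := ⌈Real.sqrt ((k : ℝ) * (1 + 1 / ε))⌉₊ with hc
  have hex : (k : ℝ) < ε * (((c + 1 : ℕ) : ℝ) * ((c + 1 : ℕ) : ℝ) - k) := by
    have h1 : Real.sqrt ((k : ℝ) * (1 + 1 / ε)) ≤ c := Nat.le_ceil _
    have h2 : (k : ℝ) * (1 + 1 / ε) ≤ (c : ℝ) ^ 2 := (Real.sqrt_le_left (Nat.cast_nonneg _)).1 h1
    have h3 : ε * ((k : ℝ) * (1 + 1 / ε)) ≤ ε * (c : ℝ) ^ 2 := mul_le_mul_of_nonneg_left h2 hε.le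
    have h4 : ε * ((k : ℝ) * (1 + 1 / ε)) = ε * k + k := by
      field_simp
    have h5 : (0 : ℝ) ≤ ε * c := mul_nonneg hε.le (Nat.cast_nonneg _)
    push_cast
    nlinarith
  have hex' : ∃ P : ℕ, (k : ℝ) < ε * ((P : ℝ) * P - k) := ⟨c + 1, hex⟩
  have hpos : 0 < Nat.find hex' := by
    rw [Nat.pos_iff_ne_zero]
    intro h0
    have h1 := Nat.find_spec hex'
    rw [h0] at h1
    have h2 : (0 : ℝ) ≤ ε * k := mul_nonneg hε.le (Nat.cast_nonneg _)
    have h3 : (0 : ℝ) ≤ k := Nat.cast_nonneg _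
    push_cast at h1
    nlinarith
  refine ⟨Nat.find hex', hpos, Nat.find_spec hex', fun j hj => not_lt.1 (Nat.find_min hex' hj),
    Nat.find_min' hex' hex, ?_⟩
  rintro rfl
  refine le_antisymm (Nat.find_min' hex' ?_) hpos
  simpa using hε

/-- Accounts for the `2k` linear programs of the ranges: `P + 2` is at most the base `3 + ⌈√(k (1 +
1/ε))⌉`. -/
theorem two_mul_add_pow_le {P k : ℕ} (hP : 0 < P) : 2 * k + P ^ k ≤ (P + 2) ^ k := by
  induction k with
  | zero => simp
  | succ k ih =>
    have h1 : 1 ≤ P ^ k := Nat.one_le_pow _ _ hP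
    calc 2 * (k + 1) + P ^ (k + 1) ≤ (2 * k + P ^ k) * (P + 2) := by
          rw [pow_succ]
          nlinarith
      _ ≤ (P + 2) ^ k * (P + 2) := Nat.mul_le_mul_right _ ih
      _ = (P + 2) ^ (k + 1) := (pow_succ _ _).symm

theorem intSize_le {a : ℤ} {e : ℕ} (h : |a| ≤ 2 ^ e) : intSize a ≤ e + 2 := by
  unfold intSize
  refine Nat.add_le_add_right (Nat.size_le.2 ?_) 1
  have h1 : a.natAbs ≤ 2 ^ e := by
    rw [← Int.natCast_natAbs] at h
    exact_mod_cast h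
  calc a.natAbs ≤ 2 ^ e := h1
    _ < 2 ^ (e + 1) := Nat.pow_lt_pow_right (by norm_num) (Nat.lt_succ_self e)

theorem abs_le_two_pow_intSize (a : ℤ) : |a| ≤ 2 ^ intSize a := by
  rw [← Int.natCast_natAbs]
  have h : a.natAbs < 2 ^ a.natAbs.size := Nat.lt_size_self _
  have h2 : 2 ^ a.natAbs.size ≤ 2 ^ intSize a :=
    Nat.pow_le_pow_right (by norm_num) (Nat.le_succ _)
  exact_mod_cast h.le.trans h2

namespace IQP

variable (I : IQP)

theorem intSize_w_le (i : Fin I.m) : intSize (I.w i) ≤ I.size := by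
  have := Finset.single_le_sum (f := fun i => intSize (I.w i)) (fun _ _ => Nat.zero_le _)
    (Finset.mem_univ i)
  unfold size
  omega

theorem intSize_q_le (i : Fin I.k) : intSize (I.q i) ≤ I.size := by
  have := Finset.single_le_sum (f := fun i => intSize (I.q i)) (fun _ _ => Nat.zero_le _)
    (Finset.mem_univ i)
  unfold size
  omega

theorem intSize_h_le (j : Fin I.n) : intSize (I.h j) ≤ I.size := by
  have := Finset.single_le_sum (f := fun j => intSize (I.h j)) (fun _ _ => Nat.zero_le _)
    (Finset.mem_univ j)
  unfold size
  omega

theorem n_add_m_add_k_le_size : I.n + I.m + I.k ≤ I.size := by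
  unfold size
  omega

theorem mag_le_two_pow : I.mag ≤ 2 ^ (3 * (I.size + 1)) := by
  set s := I.size with hs
  have hnmk := I.n_add_m_add_k_le_size
  have hs2 : (s : ℤ) ≤ 2 ^ s := by exact_mod_cast Nat.lt_two_pow_self.le
  have hp : (1 : ℤ) ≤ 2 ^ s := one_le_pow₀ (by norm_num)
  have entry : ∀ a : ℤ, intSize a ≤ s → |a| ≤ 2 ^ s := fun a ha =>
    (abs_le_two_pow_intSize a).trans (pow_le_pow_right₀ (by norm_num) ha)
  have sq : ∀ a : ℤ, intSize a ≤ s → a * a ≤ 2 ^ s * 2 ^ s := fun a ha => by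
    rw [← abs_mul_abs_self]
    exact mul_le_mul (entry a ha) (entry a ha) (abs_nonneg _) (by omega)
  have hw : ∑ i, I.w i * I.w i ≤ 2 ^ s * (2 ^ s * 2 ^ s) := by
    calc ∑ i, I.w i * I.w i ≤ ∑ _i : Fin I.m, (2 : ℤ) ^ s * 2 ^ s :=
          Finset.sum_le_sum fun i _ => sq _ (I.intSize_w_le i)
      _ = I.m * (2 ^ s * 2 ^ s) := by simp
      _ ≤ _ := mul_le_mul_of_nonneg_right (by omega) (by positivity)
  have hh : ∑ j, I.h j * I.h j ≤ 2 ^ s * (2 ^ s * 2 ^ s) := by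
    calc ∑ j, I.h j * I.h j ≤ ∑ _j : Fin I.n, (2 : ℤ) ^ s * 2 ^ s :=
          Finset.sum_le_sum fun j _ => sq _ (I.intSize_h_le j)
      _ = I.n * (2 ^ s * 2 ^ s) := by simp
      _ ≤ _ := mul_le_mul_of_nonneg_right (by omega) (by positivity)
  have hq : ∑ i, I.q i ≤ 2 ^ s * 2 ^ s := by
    calc ∑ i, I.q i ≤ ∑ _i : Fin I.k, (2 : ℤ) ^ s :=
          Finset.sum_le_sum fun i _ => (le_abs_self _).trans (entry _ (I.intSize_q_le i))
      _ = I.k * 2 ^ s := by simp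
      _ ≤ _ := mul_le_mul_of_nonneg_right (by omega) (by positivity)
  have e : (2 : ℤ) ^ (3 * (s + 1)) = 8 * (2 ^ s * (2 ^ s * 2 ^ s)) := by ring
  have h1 : (2 : ℤ) ^ s ≤ 2 ^ s * 2 ^ s := le_mul_of_one_le_right (by omega) hp
  have h2 : (2 : ℤ) ^ s * 2 ^ s ≤ 2 ^ s * (2 ^ s * 2 ^ s) :=
    le_mul_of_one_le_left (by positivity) hp
  rw [e, mag]
  linarith [show (I.k : ℤ) ≤ s by omega]

theorem lpBound_le_two_pow : I.lpBound ≤ 2 ^ (60 * (I.size + 1) ^ 2) := by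
  have hA := I.four_le_mag
  have hR : 2 * I.boxRadius + 1 ≤ I.mag ^ 8 := by
    have h1 := I.four_mul_mag_pow_le 7
    have h2 := I.boxRadius_pos
    unfold boxRadius at h2 ⊢
    norm_num at h1
    omega
  have hn := I.n_add_m_add_k_le_size
  calc I.lpBound ≤ (I.mag ^ 8) ^ I.n * I.mag ^ 20 := mul_le_mul_of_nonneg_right
        (pow_le_pow_left₀ (by have := I.boxRadius_pos; omega) hR _) (I.mag_pow_pos 20).le
    _ = I.mag ^ (8 * I.n + 20) := by rw [← pow_mul, ← pow_add]
    _ ≤ I.mag ^ (20 * (I.size + 1)) := I.mag_pow_le (by omega)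
    _ ≤ (2 ^ (3 * (I.size + 1))) ^ (20 * (I.size + 1)) :=
        pow_le_pow_left₀ (by omega) I.mag_le_two_pow _
    _ = 2 ^ (60 * (I.size + 1) ^ 2) := by
        rw [← pow_mul]
        congr 1
        ring

end IQP

/-- Matrix and right-hand side are those of the instance; the only new numbers are `3n` coefficients
and bounds, each of quadratic length. -/
theorem GoodLP.size_le {I : IQP} {L : LP} (h : GoodLP I L) : L.size ≤ 200 * (I.size + 1) ^ 3 := by
  obtain ⟨c, lo, hi, rfl, hb⟩ := h
  set B := 60 * (I.size + 1) ^ 2 + 2 with hB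
  have entry : ∀ a : ℤ, |a| ≤ I.lpBound → intSize a ≤ B := fun a ha =>
    intSize_le (ha.trans I.lpBound_le_two_pow)
  have hc : ∑ j, intSize (c j) ≤ I.n * B := by
    calc ∑ j, intSize (c j) ≤ ∑ _j : Fin I.n, B := Finset.sum_le_sum fun j _ => entry _ (hb j).1
      _ = I.n * B := by simp
  have hlo : ∑ j, (1 + intSize (lo j)) ≤ I.n * (1 + B) := by
    calc ∑ j, (1 + intSize (lo j)) ≤ ∑ _j : Fin I.n, (1 + B) :=
          Finset.sum_le_sum fun j _ => Nat.add_le_add_left (entry _ (hb j).2.1) 1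
      _ = I.n * (1 + B) := by simp
  have hhi : ∑ j, (1 + intSize (hi j)) ≤ I.n * (1 + B) := by
    calc ∑ j, (1 + intSize (hi j)) ≤ ∑ _j : Fin I.n, (1 + B) :=
          Finset.sum_le_sum fun j _ => Nat.add_le_add_left (entry _ (hb j).2.2) 1
      _ = I.n * (1 + B) := by simp
  have hs : I.n + I.m + ∑ i, ∑ j, intSize (I.W i j) + ∑ i, intSize (I.w i) ≤ I.size := by
    unfold IQP.size
    omega
  have hn : I.n ≤ I.size := by
    have := I.n_add_m_add_k_le_size
    omega
  have key : (boxLP I.W I.w c lo hi).size = I.n + I.m + ∑ i, ∑ j, intSize (I.W i j) +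
      ∑ i, intSize (I.w i) + ∑ j, intSize (c j) + ∑ j, (1 + intSize (lo j)) +
      ∑ j, (1 + intSize (hi j)) := rfl
  rw [key]
  have h1 : I.n * B + I.n * (1 + B) + I.n * (1 + B) ≤ I.size * (3 * B + 2) := by
    have := Nat.mul_le_mul_right (3 * B + 2) hn
    linarith
  have h2 : I.size + I.size * (3 * B + 2) ≤ 200 * (I.size + 1) ^ 3 := by
    rw [hB]
    nlinarith [Nat.zero_le I.size, sq_nonneg I.size, pow_nonneg (Nat.zero_le I.size) 3]
  omega

theorem parts_le_two_pow {I : IQP} {ε : ℝ} {P : ℕ}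
    (hP : P ≤ ⌈Real.sqrt ((I.k : ℝ) * (1 + 1 / ε))⌉₊ + 1) :
    P ≤ 2 ^ (I.size + Nat.size ⌈1 / ε⌉₊) := by
  set c := ⌈1 / ε⌉₊ with hc
  have h1 : ⌈Real.sqrt ((I.k : ℝ) * (1 + 1 / ε))⌉₊ ≤ I.k * (1 + c) := by
    rw [Nat.ceil_le, Real.sqrt_le_left (Nat.cast_nonneg _)]
    have h2 : (I.k : ℝ) * (1 + 1 / ε) ≤ I.k * (1 + c) :=
      mul_le_mul_of_nonneg_left (by have := Nat.le_ceil (1 / ε); linarith) (Nat.cast_nonneg _)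
    have h3 : I.k * (1 + c) ≤ (I.k * (1 + c)) ^ 2 := Nat.le_self_pow (by norm_num) _
    have h4 : (I.k : ℝ) * (1 + c) ≤ (((I.k * (1 + c) : ℕ)) : ℝ) ^ 2 := by exact_mod_cast h3
    exact h2.trans h4
  have h2 : c + 1 ≤ 2 ^ c.size := Nat.lt_size_self c
  have h3 : I.k + 1 ≤ 2 ^ I.size := by
    have := I.n_add_m_add_k_le_size
    have h4 : I.size < 2 ^ I.size := Nat.lt_two_pow_self
    omega
  calc P ≤ I.k * (1 + c) + 1 := by omega
    _ ≤ (I.k + 1) * (c + 1) := by nlinarith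
    _ ≤ 2 ^ I.size * 2 ^ c.size := Nat.mul_le_mul h3 h2
    _ = _ := (pow_add _ _ _).symm

/-- The search in the cells is charged by `P ^ k ≤ N`, the search for `P` by `P ≤ N`, the rest by `1
≤ N`. -/
theorem time_le {n m k P N : ℕ} (hk : k ≤ n) (hN : 1 ≤ N) (hP : P ≤ N) (hPk : P ^ k ≤ N) :
    60 * (n + m + k + 1) + 80 * (n + 1) + (P * 19 + 13) + (k * (70 * (n + 1) + 160) + 10) +
      (k * 30 + 20) + (P ^ k * (180 * (n + 1) + k * 130 + 80) + 80) + 50 ≤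
      N * (10000 * (n + m + 1) ^ 3) := by
  set s := n + m with hs
  have h1 : k * (70 * (n + 1) + 160) ≤ s * (70 * (s + 1) + 160) :=
    Nat.mul_le_mul (by omega) (by omega)
  have h2 : P ^ k * (180 * (n + 1) + k * 130 + 80) ≤ N * (310 * s + 260) :=
    Nat.mul_le_mul hPk (by omega)
  have h3 : 1 * (s * (70 * (s + 1) + 160) + 250 * s + 400) ≤
      N * (s * (70 * (s + 1) + 160) + 250 * s + 400) := Nat.mul_le_mul_right _ hN
  have h4 : N * (310 * s + 260 + 19 + (s * (70 * (s + 1) + 160) + 250 * s + 400)) ≤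
      N * (10000 * (s + 1) ^ 3) := by
    refine Nat.mul_le_mul_left _ ?_
    have e : (s + 1) ^ 3 = s ^ 3 + 3 * s ^ 2 + 3 * s + 1 := by ring
    have e' : s * (70 * (s + 1) + 160) = 70 * s ^ 2 + 230 * s := by ring
    rw [e, e']
    linarith [Nat.zero_le (s ^ 3), Nat.zero_le (s ^ 2), Nat.zero_le s]
  refine le_trans ?_ h4
  rw [Nat.mul_add N (310 * s + 260 + 19), Nat.mul_add N (310 * s + 260)]
  have h5 : 30 * k + 60 * k + 80 * n + 60 * s ≤ 230 * s := by omega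
  linarith

end ConcaveIQP

/-! ### The main theorem. -/

theorem theorem2 :
    ∃ (P : ConcaveIQP.Prog) (p : Polynomial ℕ),
      ∀ S : ConcaveIQP.Solver, S.Correct →
      ∀ ε : ℝ, 0 < ε → ε ≤ 1 →
      ∀ I : ConcaveIQP.IQP, I.W.IsTotallyUnimodular →
      ∃ (τ : ConcaveIQP.Store) (r : ConcaveIQP.Record),
        ConcaveIQP.Exec S ε P I.input τ r ∧
        I.CorrectOutput ε τ ∧
        r.lps.length ≤ ConcaveIQP.IQP.lpCount I.k ε ∧
        (∀ L ∈ r.lps,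
          L.size ≤ p.eval I.size ∧
          L.nv ≤ I.n ∧
          L.nc ≤ I.m ∧
          L.constraintMatrix.IsTotallyUnimodular) ∧
        r.time ≤ ConcaveIQP.IQP.lpCount I.k ε * p.eval (I.n + I.m) ∧
        r.bits ≤ p.eval (I.size + Nat.size ⌈1 / ε⌉₊) := by
  refine ⟨ConcaveIQP.approxProg, Polynomial.C 10000 * (Polynomial.X + 1) ^ 3,
    fun S hS ε hε _ I hW => ?_⟩
  have hp : ∀ x : ℕ, (Polynomial.C 10000 * (Polynomial.X + 1) ^ 3 : Polynomial ℕ).eval x =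
      10000 * (x + 1) ^ 3 := fun x => by simp
  simp only [hp]
  have hnmk := I.n_add_m_add_k_le_size
  have hkn := I.hk
  obtain ⟨P, hP0, hP, hmin, hPc, hk0⟩ := ConcaveIQP.exists_parts (k := I.k) hε
  set t := I.size + Nat.size ⌈1 / ε⌉₊ with ht
  have hst : I.size ≤ t := Nat.le_add_right _ _
  have hPt : (P : ℤ) ≤ 2 ^ t := by exact_mod_cast ConcaveIQP.parts_le_two_pow hPc
  have mono : ∀ {a b : ℕ}, a ≤ b → (2 : ℤ) ^ a ≤ 2 ^ b := fun h =>
    pow_le_pow_right₀ (by norm_num) h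
  have hts : (t + 1) ^ 2 = t * t + 2 * t + 1 := by ring
  have hsq : (I.size + 1) ^ 2 ≤ (t + 1) ^ 2 := Nat.pow_le_pow_left (by omega) 2
  -- The exponent is quadratic in `t` because `X` must exceed `lpBound ≤ 2 ^ (60 (size + 1)²)` and
  -- the number of cells `P ^ k ≤ 2 ^ (t k)`.
  let C : ConcaveIQP.Setting := ⟨S, ε, 2 ^ (100 * (t + 1) ^ 2),
    by simpa using mono (show 1 ≤ 100 * (t + 1) ^ 2 by omega), ConcaveIQP.GoodLP I⟩
  have hC : ConcaveIQP.Fits I C :=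
    { correct := hS
      tu := hW
      good := rfl
      lpBound_le := I.lpBound_le_two_pow.trans (mono (by omega))
      m_le := by
        have h1 : (I.m : ℤ) ≤ 2 ^ I.m := by exact_mod_cast Nat.lt_two_pow_self.le
        exact h1.trans (mono (by omega)) }
  have hPX : (P : ℤ) * I.mag ^ 3 ≤ C.X := by
    have h0 := I.four_le_mag
    calc (P : ℤ) * I.mag ^ 3 ≤ 2 ^ t * (2 ^ (3 * (I.size + 1))) ^ 3 :=
          mul_le_mul hPt (pow_le_pow_left₀ (by omega) I.mag_le_two_pow 3) (I.mag_pow_pos 3).le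
            (by positivity)
      _ = 2 ^ (t + 3 * (I.size + 1) * 3) := by rw [← pow_mul, ← pow_add]
      _ ≤ C.X := mono (by omega)
  have hcX : (P : ℤ) ^ I.k ≤ C.X := by
    calc (P : ℤ) ^ I.k ≤ (2 ^ t) ^ I.k := pow_le_pow_left₀ (Int.natCast_nonneg _) hPt _
      _ = 2 ^ (t * I.k) := (pow_mul _ _ _).symm
      _ ≤ C.X := mono (by
          have : t * I.k ≤ t * t := Nat.mul_le_mul_left _ (by omega)
          omega)
  obtain ⟨τ, r, hexec, htime, hbits, hlps, hgood, -, hout⟩ :=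
    ConcaveIQP.approxProg_spec hC hε hP0 hP hmin hPX hcX
  set N := ConcaveIQP.IQP.lpCount I.k ε with hN
  have hN1 : 1 ≤ N := Nat.one_le_pow _ _ (by omega)
  have hPN : (P + 2) ^ I.k ≤ N := Nat.pow_le_pow_left (by omega) _
  have hcount : 2 * I.k + P ^ I.k ≤ N := (ConcaveIQP.two_mul_add_pow_le hP0).trans hPN
  have hP' : P ≤ N := by
    rcases Nat.eq_zero_or_pos I.k with hk | hk
    · rw [hk0 hk]
      exact hN1
    · have := Nat.le_self_pow hk.ne' (P + 2)
      omega
  refine ⟨τ, r, hexec, hout, hlps.trans hcount, fun L hL => ?_, htime.trans ?_, hbits.trans ?_⟩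
  · refine ⟨(hgood L hL).size_le.trans (Nat.mul_le_mul_right _ (by norm_num)), ?_⟩
    obtain ⟨c, lo, hi, rfl, -⟩ := hgood L hL
    exact ⟨le_rfl, le_rfl, ConcaveIQP.isTotallyUnimodular_fromRows_neg_one_one hW⟩
  · exact ConcaveIQP.time_le hkn hN1 hP' (by omega)
  · have h1 : ConcaveIQP.intSize (C.X ^ 64) ≤ 100 * (t + 1) ^ 2 * 64 + 2 := by
      refine ConcaveIQP.intSize_le ?_
      rw [pow_mul, abs_of_pos (by positivity)]
    refine h1.trans ?_
    have h2 : (t + 1) ^ 2 ≤ (t + 1) ^ 3 := Nat.pow_le_pow_right (by omega) (by norm_num)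
    have h3 : 1 ≤ (t + 1) ^ 2 := Nat.one_le_pow _ _ (by omega)
    linarith
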